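/- Let $\Lambda$ be the space of (unparametrized, regular) analytic curves in $\mathbb C$, identified with their Schwarz functions $S$: the Schwarz function of a curve with regular holomorphic parametrization $\gamma$ is the holomorphic function $S$ near the curve with $S(\gamma(x))=\overline{\gamma(x)}$ for real $x$. Let $S_0\in\Lambda$ and let $\Gamma$ be a compact set of points of its curve (the whole curve if it is closed, otherwise any compact piece); all functions of $z$ are considered near $\Gamma$. A variation of Schwarz functions is a family $S(u,z)$, smooth in $(u,z)$ and holomorphic in $z$, given near each point of $\Gamma$ by a smooth family of regular analytic curves $w(u,x)$ with $S(u,w(u,x))=\overline{w(u,x)}$. A tangent vector to $\Lambda$ at $S$ is a function $X(z)=\partial_t S(t,z)|_{t=0}$ for a variation with $S(0,\cdot)=S$. Vector fields and real functions on $\Lambda$ near $S_0$ are understood to be extended to the linear space of holomorphic functions near $\Gamma$; they are smooth in the sense that they take smooth finite-dimensional families through $S_0$ (smooth in the parameters, holomorphic in $z$) to smooth families, and vector fields take values tangent to $\Lambda$ along variations of Schwarz functions through $S_0$. Write $X[F]$ for the derivative of a function $F$ by $X$, $\overline\nabla_XY$ for the derivative of $Y$ in the direction $X$ in the linear space, and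 $[X,Y]=\overline\nabla_XY-\overline\nabla_YX$; then $[X,Y][F]=X[Y[F]]-Y[X[F]]$. Set $$\nabla_XY=\overline\nabla_XY-\frac1{2S_z}\,(X_zY+Y_zX),$$ and for a field $V(t,\cdot)$ along a one-parameter family $S(t,\cdot)$ set $\nabla_{S_t}V=\partial_tV-\frac1{2S_z}(S_{tz}V+V_zS_t)$. (a) $\nabla$ is a symmetric affine connection on $\Lambda$: for vector fields $X,Y$ on $\Lambda$, $\nabla_XY$ is again a vector field on $\Lambda$ (in particular tangent to $\Lambda$), $\nabla$ is additive in $X$ and in $Y$, and $\nabla_{fX}Y=f\nabla_XY$, $\nabla_X(fY)=f\nabla_XY+X[f]Y$, $\nabla_XY-\nabla_YX=[X,Y]$ for smooth real functions $f$. If $S(t,\cdot)$ is a variation of Schwarz functions with $S(t_0,\cdot)=S_0$ and $S_t(t_0,\cdot)=X$, then $\nabla_XY$ at $S_0$ is $\nabla_{S_t}Y(S(t,\cdot))$ at $t=t_0$; for a two-parameter variation $S(r,t,z)$ of $S_0$, $\nabla_{S_r}S_t$ at $r=t=0$ is tangent to $\Lambda$ at $S_0$. The geodesic equation $\nabla_{S_t}S_t=0$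 for a variation $S(t,z)$ is equivalent to the equation of continuous Schwarzian reflection $$\ddot S-\frac{\dot S}{S'}\,\dot S'=0\qquad(\dot{}=\partial_t,\ {}'=\partial_z).$$ (b) $\nabla$ is Loos's canonical connection of the multiplication $S\cdot T=S\circ\bar T\circ S$, where $\bar T(z)=\overline{T(\bar z)}$: for vector fields $X,Y$ and smooth real functions $F$, $$(\nabla_XY)[F]=X[Y[F]]+\tfrac12\,\partial_r\partial_t F(P_r\cdot Q_t)\big|_{r=t=0}$$ at $S_0$, whenever $P_r$, $Q_t$ are variations of Schwarz functions with $P_0=Q_0=S_0$, $\partial_rP_r|_{r=0}=X$ and $\partial_tQ_t|_{t=0}=Y$ at $S_0$. It is conformally invariant: if $\varphi$ is an injective holomorphic map with nowhere vanishing derivative on a neighbourhood of $\Gamma$, then $\lambda(\varphi)S=\bar\varphi\circ S\circ\varphi^{-1}$ sends $S_0$ to a Schwarz function near $\varphi(\Gamma)$, its derivative $\lambda(\varphi)_*$ takes vector fields on $\Lambda$ near $S_0$ to vector fields on $\Lambda$ near $\lambda(\varphi)S_0$, and $\nabla_{\lambda(\varphi)_*X}\lambda(\varphi)_*Y=\lambda(\varphi)_*\nabla_XY$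 at $\lambda(\varphi)S_0$. Its Riemann tensor $R(X,Y)Z=\nabla_X\nabla_YZ-\nabla_Y\nabla_XZ-\nabla_{[X,Y]}Z$ is covariantly constant: for all vector fields, $$\nabla_W(R(X,Y)Z)-R(\nabla_WX,Y)Z-R(X,\nabla_WY)Z-R(X,Y)\nabla_WZ=0 .$$ -/

import Mathlib

open Topology Filter Set
open scoped ContDiff ComplexConjugate

noncomputable section

namespace SchwarzReflection

/-! ### Families of holomorphic functions -/

/-- `f u z` is smooth in `(u, z)` and holomorphic in `z`, for `u` near `u₀` and `z` in a
neighbourhood of the (compact) set `Γ`. -/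
def SmoothNear {E : Type} [NormedAddCommGroup E] [NormedSpace ℝ E]
    (f : E → ℂ → ℂ) (u₀ : E) (Γ : Set ℂ) : Prop :=
  ∃ (O : Set E) (U : Set ℂ), IsOpen O ∧ u₀ ∈ O ∧ IsOpen U ∧ Γ ⊆ U ∧
    ContDiffOn ℝ ∞ (fun p : E × ℂ => f p.1 p.2) (O ×ˢ U) ∧
    ∀ u ∈ O, DifferentiableOn ℂ (f u) U

/-! ### Schwarz functions, variations, tangent vectors -/

/-- `S` is holomorphic near `Γ`, and near each point of `Γ` it is the Schwarz function of an
analytic curve through that point: there is a regular holomorphic parametrization `γ` with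
`S (γ x) = conj (γ x)` for real `x`. So `Γ` is a set of points of the analytic curve
`{z | S z = conj z}`: the whole curve if this is closed, otherwise a compact piece of it. -/
def IsSchwarzFunction (S : ℂ → ℂ) (Γ : Set ℂ) : Prop :=
  (∃ U : Set ℂ, IsOpen U ∧ Γ ⊆ U ∧ DifferentiableOn ℂ S U) ∧
  ∀ z₀ ∈ Γ, ∃ (γ : ℂ → ℂ) (x₀ : ℝ),
    (∀ᶠ ζ in 𝓝 (x₀ : ℂ), DifferentiableAt ℂ γ ζ) ∧
    γ x₀ = z₀ ∧ deriv γ x₀ ≠ 0 ∧ ∀ᶠ x : ℝ in 𝓝 x₀, S (γ x) = conj (γ x)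

/-- A variation of Schwarz functions with parameter `u` near `u₀`, for which `Γ` is a set of
points of the curve with parameter `u₀`: near each point of `Γ` the functions `S u` are the
Schwarz functions of a smooth family of regular analytic curves `x ↦ w u x`. -/
def IsSchwarzFamily {E : Type} [NormedAddCommGroup E] [NormedSpace ℝ E]
    (S : E → ℂ → ℂ) (u₀ : E) (Γ : Set ℂ) : Prop :=
  SmoothNear S u₀ Γ ∧
  ∀ z₀ ∈ Γ, ∃ (w : E → ℂ → ℂ) (x₀ : ℝ),
    SmoothNear w u₀ {(x₀ : ℂ)} ∧ w u₀ x₀ = z₀ ∧ deriv (w u₀) x₀ ≠ 0 ∧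
    ∀ᶠ q : E × ℝ in 𝓝 (u₀, x₀), S q.1 (w q.1 q.2) = conj (w q.1 q.2)

/-- The derivative `∂c/∂t` of a one-parameter family. -/
def velocity (c : ℝ → ℂ → ℂ) (t : ℝ) (z : ℂ) : ℂ := deriv (fun τ : ℝ => c τ z) t

/-- `X` is tangent at `S` to the space `Λ` of Schwarz functions (along `Γ`): it is the derivative
at `t = 0` of a variation of `S` through Schwarz functions. -/
def IsTangent (S : ℂ → ℂ) (Γ : Set ℂ) (X : ℂ → ℂ) : Prop :=
  ∃ c : ℝ → ℂ → ℂ, IsSchwarzFamily c 0 Γ ∧ c 0 =ᶠ[𝓝ˢ Γ] S ∧ velocity c 0 =ᶠ[𝓝ˢ Γ] X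

/-! ### Vector fields and functions on `Λ`, extended to the space of holomorphic functions -/

/-- `X` is a vector field on `Λ` near the Schwarz function `S₀`, extended to the space of
holomorphic functions near `Γ`: it takes smooth families through `S₀` to smooth families, and along
families of Schwarz functions through `S₀` its values are tangent to `Λ`. -/
def IsVectorField (S₀ : ℂ → ℂ) (Γ : Set ℂ) (X : (ℂ → ℂ) → ℂ → ℂ) : Prop :=
  (∀ (E : Type) [NormedAddCommGroup E] [NormedSpace ℝ E] [FiniteDimensional ℝ E]
    (f : E → ℂ → ℂ) (u₀ : E), SmoothNear f u₀ Γ → f u₀ =ᶠ[𝓝ˢ Γ] S₀ →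
      SmoothNear (fun u => X (f u)) u₀ Γ) ∧
  ∀ (E : Type) [NormedAddCommGroup E] [NormedSpace ℝ E] [FiniteDimensional ℝ E]
    (S : E → ℂ → ℂ) (u₀ : E), IsSchwarzFamily S u₀ Γ → S u₀ =ᶠ[𝓝ˢ Γ] S₀ →
      ∃ (O : Set E) (U : Set ℂ), IsOpen O ∧ u₀ ∈ O ∧ IsOpen U ∧ Γ ⊆ U ∧
        ∀ u ∈ O, ∀ Γ' ⊆ U, IsCompact Γ' → IsSchwarzFunction (S u) Γ' →
          IsTangent (S u) Γ' (X (S u))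

/-- `F` is a smooth real function near `S₀` (on `Λ`, extended to the space of holomorphic functions
near `Γ`). -/
def IsSmoothFunction (S₀ : ℂ → ℂ) (Γ : Set ℂ) (F : (ℂ → ℂ) → ℝ) : Prop :=
  ∀ (E : Type) [NormedAddCommGroup E] [NormedSpace ℝ E] [FiniteDimensional ℝ E]
    (f : E → ℂ → ℂ) (u₀ : E), SmoothNear f u₀ Γ → f u₀ =ᶠ[𝓝ˢ Γ] S₀ →
      ∃ O : Set E, IsOpen O ∧ u₀ ∈ O ∧ ContDiffOn ℝ ∞ (fun u => F (f u)) O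

/-- The derivative `X[F]` of a function `F` by a vector field `X`. -/
def applyField (X : (ℂ → ℂ) → ℂ → ℂ) (F : (ℂ → ℂ) → ℝ) (S : ℂ → ℂ) : ℝ :=
  deriv (fun r : ℝ => F (fun ζ => S ζ + r * X S ζ)) 0

/-- The covariant derivative of `Y` with respect to `X` in the ambient linear space. -/
def ambientNabla (X Y : (ℂ → ℂ) → ℂ → ℂ) (S : ℂ → ℂ) (z : ℂ) : ℂ :=
  deriv (fun r : ℝ => Y (fun ζ => S ζ + r * X S ζ) z) 0

/-- The commutator of two vector fields. -/
def bracket (X Y : (ℂ → ℂ) → ℂ → ℂ) (S : ℂ → ℂ) (z : ℂ) : ℂ :=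
  ambientNabla X Y S z - ambientNabla Y X S z

/-! ### The connection -/

/-- `∇_X Y = ambientNabla X Y - (X_z Y + Y_z X) / (2 S_z)`. -/
def nabla (X Y : (ℂ → ℂ) → ℂ → ℂ) (S : ℂ → ℂ) (z : ℂ) : ℂ :=
  ambientNabla X Y S z
    - 1 / (2 * deriv S z) * (deriv (X S) z * Y S z + deriv (Y S) z * X S z)

/-- The covariant derivative `∇_{c_t} V` of a field `V t` along a one-parameter family `c t`; here
the ambient covariant derivative is `∂V/∂t`. -/
def nablaAlong (c V : ℝ → ℂ → ℂ) (t : ℝ) (z : ℂ) : ℂ :=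
  deriv (fun τ : ℝ => V τ z) t
    - 1 / (2 * deriv (c t) z) *
      (deriv (velocity c t) z * V t z + deriv (V t) z * velocity c t z)

/-- `D` is a symmetric (torsion-free) affine connection on `Λ` near `S₀`. -/
structure IsSymmetricConnection (S₀ : ℂ → ℂ) (Γ : Set ℂ)
    (D : ((ℂ → ℂ) → ℂ → ℂ) → ((ℂ → ℂ) → ℂ → ℂ) → (ℂ → ℂ) → ℂ → ℂ) : Prop where
  isVectorField : ∀ X Y, IsVectorField S₀ Γ X → IsVectorField S₀ Γ Y → IsVectorField S₀ Γ (D X Y)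
  add_left : ∀ X X' Y, IsVectorField S₀ Γ X → IsVectorField S₀ Γ X' → IsVectorField S₀ Γ Y →
    D (fun S z => X S z + X' S z) Y S₀ =ᶠ[𝓝ˢ Γ] fun z => D X Y S₀ z + D X' Y S₀ z
  smul_left : ∀ f X Y, IsSmoothFunction S₀ Γ f → IsVectorField S₀ Γ X → IsVectorField S₀ Γ Y →
    D (fun S z => f S * X S z) Y S₀ =ᶠ[𝓝ˢ Γ] fun z => f S₀ * D X Y S₀ z
  add_right : ∀ X Y Y', IsVectorField S₀ Γ X → IsVectorField S₀ Γ Y → IsVectorField S₀ Γ Y' →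
    D X (fun S z => Y S z + Y' S z) S₀ =ᶠ[𝓝ˢ Γ] fun z => D X Y S₀ z + D X Y' S₀ z
  leibniz : ∀ f X Y, IsSmoothFunction S₀ Γ f → IsVectorField S₀ Γ X → IsVectorField S₀ Γ Y →
    D X (fun S z => f S * Y S z) S₀ =ᶠ[𝓝ˢ Γ]
      fun z => f S₀ * D X Y S₀ z + applyField X f S₀ * Y S₀ z
  symmetric : ∀ X Y, IsVectorField S₀ Γ X → IsVectorField S₀ Γ Y →
    (fun z => D X Y S₀ z - D Y X S₀ z) =ᶠ[𝓝ˢ Γ] bracket X Y S₀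

/-- The Riemann tensor `R(X,Y)Z`. -/
def riemann (X Y Z : (ℂ → ℂ) → ℂ → ℂ) (S : ℂ → ℂ) (z : ℂ) : ℂ :=
  nabla X (nabla Y Z) S z - nabla Y (nabla X Z) S z - nabla (bracket X Y) Z S z

/-- The covariant derivative `(∇_W R)(X,Y,Z)` of the Riemann tensor. -/
def nablaRiemann (W X Y Z : (ℂ → ℂ) → ℂ → ℂ) (S : ℂ → ℂ) (z : ℂ) : ℂ :=
  nabla W (riemann X Y Z) S z - riemann (nabla W X) Y Z S z
    - riemann X (nabla W Y) Z S z - riemann X Y (nabla W Z) S z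

/-! ### Multiplication of Schwarz functions and the canonical connection -/

/-- The conjugate `z ↦ conj (f (conj z))` of a holomorphic function. -/
def bar (f : ℂ → ℂ) (z : ℂ) : ℂ := conj (f (conj z))

/-- The product `S · T = S ∘ bar T ∘ S` of Schwarz functions. -/
def schwarzMul (S T : ℂ → ℂ) (z : ℂ) : ℂ := S (bar T (S z))

/-- `D` is at `S₀` the canonical connection of the multiplication `schwarzMul`:
`(D_X Y)[F] = X[Y[F]] + (1/2) (X · Y)[F]`, where `(X · Y)[F]` is the mixed derivative
`∂_r ∂_t F (P r · Q t)` at `r = t = 0`, for variations `P`, `Q` of `S₀` through Schwarz functions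
with derivatives `X`, `Y` at `S₀`. -/
def IsCanonicalConnection (S₀ : ℂ → ℂ) (Γ : Set ℂ)
    (D : ((ℂ → ℂ) → ℂ → ℂ) → ((ℂ → ℂ) → ℂ → ℂ) → (ℂ → ℂ) → ℂ → ℂ) : Prop :=
  ∀ X Y F, IsVectorField S₀ Γ X → IsVectorField S₀ Γ Y → IsSmoothFunction S₀ Γ F →
    ∀ P Q : ℝ → ℂ → ℂ, IsSchwarzFamily P 0 Γ → IsSchwarzFamily Q 0 Γ →
      P 0 =ᶠ[𝓝ˢ Γ] S₀ → Q 0 =ᶠ[𝓝ˢ Γ] S₀ →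
      velocity P 0 =ᶠ[𝓝ˢ Γ] X S₀ → velocity Q 0 =ᶠ[𝓝ˢ Γ] Y S₀ →
      applyField (D X Y) F S₀ = applyField X (applyField Y F) S₀
        + 1 / 2 * deriv (fun r : ℝ => deriv (fun t : ℝ => F (schwarzMul (P r) (Q t))) 0) 0

/-! ### The action of conformal maps -/

/-- The action `S ↦ bar φ ∘ S ∘ φ⁻¹` of a conformal map `φ` on Schwarz functions; `ψ` is the
inverse of `φ`. -/
def conformalAction (φ ψ : ℂ → ℂ) (S : ℂ → ℂ) (y : ℂ) : ℂ := bar φ (S (ψ y))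

/-- The vector field induced from `X` by the action of `φ` (with inverse `ψ`): its value at the
image of `S` is the derivative of the action at `S` in the direction `X S`. -/
def conformalPush (φ ψ : ℂ → ℂ) (X : (ℂ → ℂ) → ℂ → ℂ) (T : ℂ → ℂ) (y : ℂ) : ℂ :=
  deriv (fun r : ℝ => conformalAction φ ψ
    (fun ζ => conformalAction ψ φ T ζ + r * X (conformalAction ψ φ T) ζ) y) 0

end SchwarzReflection

end

/-! A Schwarz function satisfies `bar S ∘ S = id`, since both sides agree on the curve. Linearizing
gives the condition `TangencyAt`, `S' · (bar V ∘ S) = -V`, and near `Γ` this condition characterizes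
tangent vectors. For the converse (`exists_variation`) let `v = -V / (2 S')` and move `S` by the
conformal maps `Φ_t = id + t v`. The family `bar Φ_t ∘ S ∘ Φ_t⁻¹` consists of Schwarz functions, and
its velocity is `-S' v + bar v ∘ S`, where tangency makes each summand equal to `V / 2`. Tangency of
`∇` then follows by differentiating the tangency equation of `Y` along a variation with velocity
`X`, and using the `z`-derivatives of both tangency equations (`tangencyAt_nablaAlong`).

Fields are known only through their effect on smooth finite-dimensional families, so the calculus on
the space of holomorphic functions has to be derived from that. Hadamard's lemma (`SmoothAt.dslope`)
writes a family as `f_t = f_0 + t W_t`. It yields chain rules of first and second order, linearity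
of the directional derivative and symmetry of the second derivative. A gluing argument
(`IsAmbientField.eventually_eq`) shows that the values of a field along a family depend only on
germs near `Γ`.

For the canonical connection, the first derivatives of `P_r · Q_t` at `0` are `2X` and `-Y`, and the
mixed derivative is `-2G`, where `G` is the Christoffel term. By the second-order chain rule, half
the mixed derivative of `F(P_r · Q_t)` is `-D²F(X, Y) - DF(G)`. Adding `X[Y[F]] = D²F(X, Y) + DF(D_X
Y)`, with `D_X Y` the ambient derivative, cancels the Hessian and leaves `DF(D_X Y - G)`, which is
the derivative along `∇_X Y`.

Conformal invariance is a computation along a variation (`nablaAlong_conj`): the terms with the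
second derivative of the outer map cancel because the Christoffel term is symmetrized.

For the curvature, put `τ = 1 / S_z` and let `[a, b] = a_z b - b_z a`. Then `τ ∇_X Y = D_X(τY) + ½
[τX, τY]` (`mul_algNabla`). Here `D` is flat and acts by derivations of the bracket, so the
curvature is `τ R(X, Y)Z = -¼ [[τX, τY], τZ]` (`mul_algRiemann`), as for the connection `½ [·, ·]`
on a Lie group. It is covariantly constant by the Jacobi identity. This is carried out in an
abstract commutative ring with derivations, then applied to the ring of germs of ambient fields. -/

noncomputable section

namespace SchwarzReflection

/-! ### Local calculus of smooth families of holomorphic functions -/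

section LocalCalculus

variable {E : Type} [NormedAddCommGroup E] [NormedSpace ℝ E]
  {E' : Type} [NormedAddCommGroup E'] [NormedSpace ℝ E']

theorem two_le_infty : minSmoothness ℝ 2 ≤ (∞ : WithTop ℕ∞) := by
  rw [minSmoothness_of_isRCLikeNormedField]
  exact WithTop.coe_le_coe.2 (le_top : (2 : ℕ∞) ≤ ⊤)

/-- `f u z` is smooth in `(u, z)` and holomorphic in `z` near the point `p`. -/
def SmoothAt (f : E → ℂ → ℂ) (p : E × ℂ) : Prop :=
  ∀ᶠ q in 𝓝 p, ContDiffAt ℝ ∞ (fun q : E × ℂ => f q.1 q.2) q ∧ DifferentiableAt ℂ (f q.1) q.2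

/-- The tube lemma. Compactness of `Γ` lets statements that are uniform near `{u₀} × Γ` be checked
one point at a time; most of the local arguments below are transferred through it. -/
theorem eventually_prod_nhdsSet_iff {X : Type*} [TopologicalSpace X] {u₀ : X} {Γ : Set ℂ} (hΓ : IsCompact Γ) {P : X × ℂ → Prop} :
    (∀ᶠ q in 𝓝 u₀ ×ˢ 𝓝ˢ Γ, P q) ↔ ∀ z ∈ Γ, ∀ᶠ q in 𝓝 (u₀, z), P q := by
  rw [hΓ.prod_nhdsSet_eq_biSup]
  simp only [eventually_iSup, nhds_prod_eq]

theorem smoothNear_iff_eventually {f : E → ℂ → ℂ} {u₀ : E} {Γ : Set ℂ} :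
    SmoothNear f u₀ Γ ↔ ∀ᶠ q in 𝓝 u₀ ×ˢ 𝓝ˢ Γ,
      ContDiffAt ℝ ∞ (fun q : E × ℂ => f q.1 q.2) q ∧ DifferentiableAt ℂ (f q.1) q.2 := by
  constructor
  · rintro ⟨O, U, hO, hu, hU, hΓ, h1, h2⟩
    refine eventually_of_mem (prod_mem_prod (hO.mem_nhds hu) (hU.mem_nhdsSet.2 hΓ)) ?_
    rintro ⟨u, z⟩ ⟨hu', hz⟩
    exact ⟨h1.contDiffAt ((hO.prod hU).mem_nhds ⟨hu', hz⟩),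
      (h2 u hu').differentiableAt (hU.mem_nhds hz)⟩
  · intro h
    obtain ⟨s, hs, t, ht, hst⟩ := mem_prod_iff.1 h
    obtain ⟨O, hOs, hO, hu⟩ := mem_nhds_iff.1 hs
    obtain ⟨U, hU, hΓ, hUt⟩ := mem_nhdsSet_iff_exists.1 ht
    refine ⟨O, U, hO, hu, hU, hΓ, ?_, ?_⟩
    · rintro ⟨u, z⟩ ⟨hu', hz⟩
      exact (hst (mk_mem_prod (hOs hu') (hUt hz))).1.contDiffWithinAt
    · intro u hu' z hz
      exact (hst (mk_mem_prod (hOs hu') (hUt hz))).2.differentiableWithinAt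

theorem smoothNear_iff {f : E → ℂ → ℂ} {u₀ : E} {Γ : Set ℂ} (hΓ : IsCompact Γ) :
    SmoothNear f u₀ Γ ↔ ∀ z ∈ Γ, SmoothAt f (u₀, z) := by
  rw [smoothNear_iff_eventually, eventually_prod_nhdsSet_iff hΓ]
  rfl

namespace SmoothAt

variable {f g : E → ℂ → ℂ} {p : E × ℂ}

theorem eventually (h : SmoothAt f p) : ∀ᶠ q in 𝓝 p, SmoothAt f q := eventually_eventually_nhds.2 h

theorem contDiffAt (h : SmoothAt f p) : ContDiffAt ℝ ∞ (fun q : E × ℂ => f q.1 q.2) p :=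
  h.self_of_nhds.1

theorem differentiableAt (h : SmoothAt f p) : DifferentiableAt ℂ (f p.1) p.2 := h.self_of_nhds.2

theorem differentiableAt_real (h : SmoothAt f p) :
    DifferentiableAt ℝ (fun q : E × ℂ => f q.1 q.2) p := h.contDiffAt.differentiableAt (by simp)

theorem continuousAt (h : SmoothAt f p) : ContinuousAt (fun q : E × ℂ => f q.1 q.2) p :=
  h.contDiffAt.continuousAt

end SmoothAt

theorem tendsto_prodMk_right {X : Type*} [TopologicalSpace X] (p : X × ℂ) : Tendsto (fun z => (p.1, z)) (𝓝 p.2) (𝓝 p) :=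
  (Continuous.prodMk_right p.1).tendsto' _ _ rfl

namespace SmoothAt

variable {f g : E → ℂ → ℂ} {p : E × ℂ}

theorem congr (h : SmoothAt f p) (hfg : ∀ᶠ q in 𝓝 p, f q.1 q.2 = g q.1 q.2) : SmoothAt g p := by
  filter_upwards [h, hfg.eventually_nhds] with q hq hq'
  refine ⟨hq.1.congr_of_eventuallyEq (hq'.mono fun _ h => h.symm),
    hq.2.congr_of_eventuallyEq ?_⟩
  filter_upwards [(tendsto_prodMk_right q).eventually hq'] with z hz using hz.symm

theorem const (c : ℂ) : SmoothAt (fun (_ : E) _ => c) p :=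
  .of_forall fun _ => ⟨contDiffAt_const, differentiableAt_const _⟩

theorem id : SmoothAt (fun (_ : E) z => z) p :=
  .of_forall fun _ => ⟨contDiffAt_snd, differentiableAt_id⟩

theorem ofReal {ρ : E → ℝ} (hρ : ∀ᶠ u in 𝓝 p.1, ContDiffAt ℝ ∞ ρ u) :
    SmoothAt (fun u _ => (ρ u : ℂ)) p := by
  filter_upwards [continuousAt_fst.eventually hρ] with q hq
  refine ⟨?_, differentiableAt_const _⟩
  exact Complex.ofRealCLM.contDiff.contDiffAt.comp q (ContDiffAt.comp q hq contDiffAt_fst)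

theorem of_holomorphic {f : ℂ → ℂ} (hf : ∀ᶠ z in 𝓝 p.2, DifferentiableAt ℂ f z) :
    SmoothAt (fun (_ : E) => f) p := by
  filter_upwards [continuousAt_snd.eventually hf.eventually_nhds] with q hq
  refine ⟨?_, hq.self_of_nhds⟩
  have : AnalyticAt ℂ f q.2 := Complex.analyticAt_iff_eventually_differentiableAt.2 hq
  have h2 : ContDiffAt ℝ ∞ f q.2 := this.contDiffAt.restrict_scalars ℝ
  exact ContDiffAt.comp q h2 contDiffAt_snd

theorem add (hf : SmoothAt f p) (hg : SmoothAt g p) : SmoothAt (fun u z => f u z + g u z) p := by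
  filter_upwards [hf, hg] with q h1 h2 using ⟨h1.1.add h2.1, h1.2.add h2.2⟩

theorem sub (hf : SmoothAt f p) (hg : SmoothAt g p) : SmoothAt (fun u z => f u z - g u z) p := by
  filter_upwards [hf, hg] with q h1 h2 using ⟨h1.1.sub h2.1, h1.2.sub h2.2⟩

theorem mul (hf : SmoothAt f p) (hg : SmoothAt g p) : SmoothAt (fun u z => f u z * g u z) p := by
  filter_upwards [hf, hg] with q h1 h2 using ⟨h1.1.mul h2.1, h1.2.mul h2.2⟩

theorem neg (hf : SmoothAt f p) : SmoothAt (fun u z => -f u z) p := by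
  filter_upwards [hf] with q h1 using ⟨h1.1.neg, h1.2.neg⟩

theorem eventually_ne (hf : SmoothAt f p) (h0 : f p.1 p.2 ≠ 0) : ∀ᶠ q in 𝓝 p, f q.1 q.2 ≠ 0 :=
  hf.continuousAt.eventually_ne h0

theorem inv (hf : SmoothAt f p) (h0 : f p.1 p.2 ≠ 0) : SmoothAt (fun u z => (f u z)⁻¹) p := by
  filter_upwards [hf, hf.eventually_ne h0] with q h1 h2 using ⟨h1.1.inv h2, h1.2.inv h2⟩

theorem div (hf : SmoothAt f p) (hg : SmoothAt g p) (h0 : g p.1 p.2 ≠ 0) :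
    SmoothAt (fun u z => f u z / g u z) p := by
  simpa only [div_eq_mul_inv] using hf.mul (hg.inv h0)

theorem reparam {f : E' → ℂ → ℂ} {ρ : E → E'} {z : ℂ} {u : E} (hf : SmoothAt f (ρ u, z))
    (hρ : ContDiff ℝ ∞ ρ) : SmoothAt (fun u => f (ρ u)) (u, z) := by
  have hc : ContDiff ℝ ∞ (fun q : E × ℂ => (ρ q.1, q.2)) :=
    (hρ.comp contDiff_fst).prodMk contDiff_snd
  have := hc.continuous.continuousAt (x := (u, z))
  filter_upwards [this.eventually hf] with q hq
  exact ⟨ContDiffAt.comp (g := fun q : E' × ℂ => f q.1 q.2) q hq.1 hc.contDiffAt, hq.2⟩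

theorem comp (hf : SmoothAt f (p.1, g p.1 p.2)) (hg : SmoothAt g p) :
    SmoothAt (fun u z => f u (g u z)) p := by
  have hc : ContinuousAt (fun q : E × ℂ => (q.1, g q.1 q.2)) p :=
    continuousAt_fst.prodMk hg.continuousAt
  filter_upwards [hc.eventually hf, hg] with q h1 h2
  exact ⟨ContDiffAt.comp (g := fun q : E × ℂ => f q.1 q.2) q h1.1 (contDiffAt_fst.prodMk h2.1),
    DifferentiableAt.comp q.2 h1.2 h2.2⟩

theorem bar_comp {z : ℂ} {u : E} (hf : SmoothAt f (u, conj z)) :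
    SmoothAt (fun u => bar (f u)) (u, z) := by
  have hc : ContDiff ℝ ∞ (fun q : E × ℂ => (q.1, conj q.2)) :=
    contDiff_fst.prodMk (Complex.conjCLE.contDiff.comp contDiff_snd)
  filter_upwards [(hc.continuous.continuousAt (x := (u, z))).eventually hf] with q hq
  refine ⟨Complex.conjCLE.contDiff.contDiffAt.comp q
    (ContDiffAt.comp (g := fun q : E × ℂ => f q.1 q.2) q hq.1 hc.contDiffAt), ?_⟩
  have := DifferentiableAt.conj_conj hq.2
  rw [Complex.conj_conj] at this
  exact this

theorem comp_bar {z : ℂ} {u : E} (hf : SmoothAt f (u, conj (g u z))) (hg : SmoothAt g (u, z)) :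
    SmoothAt (fun u z => bar (f u) (g u z)) (u, z) :=
  SmoothAt.comp (f := fun u => bar (f u)) (p := (u, z)) hf.bar_comp hg

/-- the complex derivative is the real derivative in the direction `(0, 1)` -/
theorem fderiv_apply_snd (h : SmoothAt f p) (w : ℂ) :
    fderiv ℝ (fun q : E × ℂ => f q.1 q.2) p (0, w) = deriv (f p.1) p.2 * w := by
  have h1 := h.differentiableAt_real.hasFDerivAt
  have h2 : HasFDerivAt (fun z : ℂ => (p.1, z)) (ContinuousLinearMap.inr ℝ E ℂ) p.2 :=
    hasFDerivAt_prodMk_right p.1 p.2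
  have h3 : HasFDerivAt (f p.1) _ p.2 := HasFDerivAt.comp p.2 (g := fun q : E × ℂ => f q.1 q.2) h1 h2
  have h4 := h.differentiableAt.hasDerivAt.hasFDerivAt.restrictScalars ℝ
  have := congrArg (fun L : ℂ →L[ℝ] ℂ => L w) (h3.unique h4)
  simpa [mul_comm] using this

/-- The complex derivative is the real differential applied to the fixed vector `(0, 1)`, hence
jointly smooth; holomorphy in `z` comes from analyticity of each member. -/
theorem deriv_snd (h : SmoothAt f p) : SmoothAt (fun u => deriv (f u)) p := by
  have key : ∀ᶠ q in 𝓝 p, ContDiffAt ℝ ∞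
      (fun q => fderiv ℝ (fun q : E × ℂ => f q.1 q.2) q (0, 1)) q := by
    filter_upwards [h] with q hq
    exact (hq.1.fderiv_right (m := ∞) (by simp)).clm_apply contDiffAt_const
  filter_upwards [key, h.eventually.eventually_nhds] with q hq hq'
  refine ⟨hq.congr_of_eventuallyEq ?_, ?_⟩
  · filter_upwards [hq'] with q' h'
    simp [h'.fderiv_apply_snd]
  · have : AnalyticAt ℂ (f q.1) q.2 := by
      refine Complex.analyticAt_iff_eventually_differentiableAt.2 ?_
      filter_upwards [(tendsto_prodMk_right q).eventually hq'] with z hz using hz.differentiableAt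
    exact this.deriv.differentiableAt

/-- Parameter derivatives remain holomorphic in `z`: by symmetry of the second derivative, the
`z`-differential of the derivative along `v` is the derivative along `v` of a complex-linear map. -/
theorem fderiv_fst (h : SmoothAt f p) (v : E) :
    SmoothAt (fun u z => fderiv ℝ (fun q : E × ℂ => f q.1 q.2) (u, z) (v, 0)) p := by
  filter_upwards [h.eventually.eventually_nhds] with q hq
  have h0 := hq.self_of_nhds
  have h1 : ContDiffAt ℝ ∞ (fderiv ℝ (fun q : E × ℂ => f q.1 q.2)) q :=
    h0.contDiffAt.fderiv_right (m := ∞) (by simp)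
  have hsymm := h0.contDiffAt.isSymmSndFDerivAt two_le_infty
  refine ⟨h1.clm_apply contDiffAt_const, ?_⟩
  have h2 : HasFDerivAt (fun z : ℂ => (q.1, z)) (ContinuousLinearMap.inr ℝ E ℂ) q.2 :=
    hasFDerivAt_prodMk_right q.1 q.2
  have h3 : HasFDerivAt (fun z : ℂ => fderiv ℝ (fun q : E × ℂ => f q.1 q.2) (q.1, z)) _ q.2 :=
    HasFDerivAt.comp q.2 (h1.differentiableAt (by simp)).hasFDerivAt h2
  have h4 := h3.clm_apply (hasFDerivAt_const ((v, 0) : E × ℂ) q.2)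
  rw [differentiableAt_complex_iff_differentiableAt_real]
  refine ⟨h4.differentiableAt, ?_⟩
  rw [h4.fderiv]
  have h5 : ∀ w : ℂ, fderiv ℝ (fderiv ℝ (fun q : E × ℂ => f q.1 q.2)) q (v, 0) (0, w)
      = fderiv ℝ (fderiv ℝ (fun q : E × ℂ => f q.1 q.2)) q (v, 0) (0, 1) * w := by
    intro w
    have e : ∀ w : ℂ, HasFDerivAt (fun q' => fderiv ℝ (fun q : E × ℂ => f q.1 q.2) q' (0, w)) _ q :=
      fun w => (h1.differentiableAt (by simp)).hasFDerivAt.clm_apply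
        (hasFDerivAt_const ((0, w) : E × ℂ) q)
    have e2 : (fun q' => fderiv ℝ (fun q : E × ℂ => f q.1 q.2) q' (0, w)) =ᶠ[𝓝 q]
        fun q' => fderiv ℝ (fun q : E × ℂ => f q.1 q.2) q' (0, 1) * w := by
      filter_upwards [hq] with q' h'
      simp [h'.fderiv_apply_snd]
    have e3 := (e w).unique (((e 1).mul_const w).congr_of_eventuallyEq e2)
    simpa [mul_comm] using congrArg (fun L : E × ℂ →L[ℝ] ℂ => L (v, 0)) e3
  -- The Cauchy–Riemann criterion asks only that the real differential at `I` be `I` times its value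
  -- at `1`.
  have h6 := h5 Complex.I
  rw [hsymm.eq, hsymm.eq (v, 0) (0, 1)] at h6
  simpa [mul_comm] using h6

/-- the derivative with respect to the last real parameter -/
theorem fderiv_apply_real {f : E × ℝ → ℂ → ℂ} {u : E} {t : ℝ} {z : ℂ}
    (h : SmoothAt f ((u, t), z)) :
    HasDerivAt (fun s : ℝ => f (u, s) z)
      (fderiv ℝ (fun q : (E × ℝ) × ℂ => f q.1 q.2) ((u, t), z) ((0, 1), 0)) t := by
  have h1 := h.differentiableAt_real.hasFDerivAt
  have h2 : HasDerivAt (fun s : ℝ => ((u, s), z)) (((0 : E), (1 : ℝ)), (0:ℂ)) t :=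
    ((hasDerivAt_const _ _).prodMk (hasDerivAt_id t)).prodMk (hasDerivAt_const _ _)
  exact HasFDerivAt.comp_hasDerivAt (l := fun q : (E × ℝ) × ℂ => f q.1 q.2) t h1 h2

theorem deriv_real {f : E × ℝ → ℂ → ℂ} {u : E} {t : ℝ} {z : ℂ} (h : SmoothAt f ((u, t), z)) :
    SmoothAt (fun p z => deriv (fun s : ℝ => f (p.1, s) z) p.2) ((u, t), z) := by
  refine (h.fderiv_fst (0, 1)).congr ?_
  filter_upwards [h.eventually] with q hq
  exact (SmoothAt.fderiv_apply_real (u := q.1.1) (t := q.1.2) (z := q.2) hq).deriv.symm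

end SmoothAt

/-! ### One-parameter families and their velocities -/

section OneParameter

variable {c : ℝ → ℂ → ℂ} {t : ℝ} {z : ℂ}

theorem SmoothAt.hasDerivAt_param (h : SmoothAt c (t, z)) :
    HasDerivAt (fun s => c s z) (velocity c t z) t := by
  have := h.differentiableAt_real.comp t
    (((hasDerivAt_id t).prodMk (hasDerivAt_const t z)).differentiableAt)
  exact this.hasDerivAt

theorem SmoothAt.velocity_eq (h : SmoothAt c (t, z)) :
    velocity c t z = fderiv ℝ (fun q : ℝ × ℂ => c q.1 q.2) (t, z) (1, 0) :=
  (HasFDerivAt.comp_hasDerivAt (l := fun q : ℝ × ℂ => c q.1 q.2) t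
    h.differentiableAt_real.hasFDerivAt ((hasDerivAt_id t).prodMk (hasDerivAt_const t z))).deriv

theorem SmoothAt.velocity (h : SmoothAt c (t, z)) : SmoothAt (velocity c) (t, z) := by
  refine (h.fderiv_fst 1).congr ?_
  filter_upwards [h.eventually] with q hq
  exact hq.velocity_eq.symm

/-- Derivative of `s ↦ c s (g s)`. -/
theorem SmoothAt.hasDerivAt_comp {g : ℝ → ℂ} {g' : ℂ} (h : SmoothAt c (t, g t))
    (hg : HasDerivAt g g' t) :
    HasDerivAt (fun s => c s (g s)) (SchwarzReflection.velocity c t (g t) + deriv (c t) (g t) * g') t := by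
  have := HasFDerivAt.comp_hasDerivAt (l := fun q : ℝ × ℂ => c q.1 q.2) t
    h.differentiableAt_real.hasFDerivAt ((hasDerivAt_id t).prodMk hg)
  refine this.congr_deriv ?_
  have e : ((1 : ℝ), g') = (1, 0) + (0, g') := by simp
  rw [e, map_add, h.fderiv_apply_snd, h.velocity_eq]

theorem SmoothAt.hasDerivAt_deriv (h : SmoothAt c (t, z)) :
    HasDerivAt (fun s => deriv (c s) z) (deriv (SchwarzReflection.velocity c t) z) t := by
  have h1 := h.deriv_snd.hasDerivAt_param
  refine h1.congr_deriv ?_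
  have h2 := h.deriv_snd.velocity_eq
  rw [h2]
  have h0 := h.contDiffAt
  have hd : DifferentiableAt ℝ (fderiv ℝ (fun q : ℝ × ℂ => c q.1 q.2)) (t, z) :=
    (h0.fderiv_right (m := ∞) (by simp)).differentiableAt (by simp)
  have hsymm := h0.isSymmSndFDerivAt two_le_infty
  have e1 : fderiv ℝ (fun q : ℝ × ℂ => deriv (c q.1) q.2) (t, z) (1, 0)
      = fderiv ℝ (fderiv ℝ (fun q : ℝ × ℂ => c q.1 q.2)) (t, z) (1, 0) (0, 1) := by
    have : (fun q : ℝ × ℂ => deriv (c q.1) q.2) =ᶠ[𝓝 (t, z)]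
        fun q => fderiv ℝ (fun q : ℝ × ℂ => c q.1 q.2) q (0, 1) := by
      filter_upwards [h.eventually] with q hq
      simp [hq.fderiv_apply_snd]
    rw [this.fderiv_eq,
      (hd.hasFDerivAt.clm_apply (hasFDerivAt_const ((0, 1) : ℝ × ℂ) (t, z))).fderiv]
    simp
  have e2 := h.velocity.fderiv_apply_snd 1
  have e3 : fderiv ℝ (fun q : ℝ × ℂ => SchwarzReflection.velocity c q.1 q.2) (t, z) (0, 1)
      = fderiv ℝ (fderiv ℝ (fun q : ℝ × ℂ => c q.1 q.2)) (t, z) (0, 1) (1, 0) := by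
    have : (fun q : ℝ × ℂ => SchwarzReflection.velocity c q.1 q.2) =ᶠ[𝓝 (t, z)]
        fun q => fderiv ℝ (fun q : ℝ × ℂ => c q.1 q.2) q (1, 0) := by
      filter_upwards [h.eventually] with q hq using hq.velocity_eq
    rw [this.fderiv_eq,
      (hd.hasFDerivAt.clm_apply (hasFDerivAt_const ((1, 0) : ℝ × ℂ) (t, z))).fderiv]
    simp
  rw [e1, hsymm.eq, ← e3, e2, mul_one]

end OneParameter

theorem hasDerivAt_bar {f : ℂ → ℂ} {z : ℂ} (h : DifferentiableAt ℂ f (conj z)) :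
    HasDerivAt (bar f) (conj (deriv f (conj z))) z := by
  have := h.hasDerivAt.conj_conj
  rw [Complex.conj_conj] at this
  exact this

theorem deriv_bar (f : ℂ → ℂ) : deriv (bar f) = bar (deriv f) := by
  exact deriv_conj_conj

end LocalCalculus

/-! ### Division by the parameter -/

/-- Differentiation under the integral sign, by induction on `n`. The derivative is an integral of
the same kind with values in `H →L[ℝ] V`, which is why the target space is quantified after `n`. -/
theorem contDiffOn_intervalIntegral {H : Type} [NormedAddCommGroup H] [NormedSpace ℝ H]
    {B : Set H} (hB : IsOpen B) (n : ℕ) :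
    ∀ {V : Type} [NormedAddCommGroup V] [NormedSpace ℝ V] [CompleteSpace V] (G : H × ℝ → V),
      (∀ x ∈ B, ∀ s ∈ Icc (0 : ℝ) 1, ContDiffAt ℝ ∞ G (x, s)) →
      ContDiffOn ℝ n (fun x => ∫ s in (0 : ℝ)..1, G (x, s)) B := by
  have key : ∀ {V : Type} [NormedAddCommGroup V] [NormedSpace ℝ V] [CompleteSpace V]
      (G : H × ℝ → V), (∀ x ∈ B, ∀ s ∈ Icc (0 : ℝ) 1, ContDiffAt ℝ ∞ G (x, s)) →
      ∀ x ∈ B, HasFDerivAt (fun x => ∫ s in (0 : ℝ)..1, G (x, s))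
        (∫ s in (0 : ℝ)..1, (fderiv ℝ G (x, s)).comp (ContinuousLinearMap.inl ℝ H ℝ)) x := by
    intro V _ _ _ G hG x₀ hx₀
    set G' : H × ℝ → H →L[ℝ] V := fun q => (fderiv ℝ G q).comp (ContinuousLinearMap.inl ℝ H ℝ)
    have hG' : ∀ x ∈ B, ∀ s ∈ Icc (0 : ℝ) 1, ContinuousAt G' (x, s) := fun x hx s hs =>
      (((hG x hx s hs).fderiv_right (m := ∞) (by simp)).clm_comp
        contDiffAt_const).continuousAt
    have hc : ∀ {W : Type} [NormedAddCommGroup W] (K : H × ℝ → W),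
        (∀ x ∈ B, ∀ s ∈ Icc (0 : ℝ) 1, ContinuousAt K (x, s)) → ∀ x ∈ B,
        ContinuousOn (fun s => K (x, s)) (Icc 0 1) := fun K hK x hx s hs =>
      ((hK x hx s hs).comp (f := fun s : ℝ => (x, s))
        (Continuous.prodMk_right x).continuousAt).continuousWithinAt
    have hGc : ∀ x ∈ B, ContinuousOn (fun s => G (x, s)) (Icc 0 1) :=
      hc G fun x hx s hs => (hG x hx s hs).continuousAt
    have hI : uIoc (0 : ℝ) 1 ⊆ Icc 0 1 := by
      rw [uIoc_of_le zero_le_one]; exact Ioc_subset_Icc_self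
    obtain ⟨C, hC⟩ := isCompact_Icc.exists_bound_of_continuousOn (hc G' hG' x₀ hx₀)
    -- The bound `C` holds at `x₀` only; compactness of `[0, 1]` extends the slightly larger bound
    -- `C + 1` to a neighbourhood, and this constant is the dominating function.
    have hbd : ∀ᶠ x in 𝓝 x₀, ∀ s ∈ Icc (0 : ℝ) 1, ‖G' (x, s)‖ < C + 1 := by
      refine isCompact_Icc.eventually_forall_of_forall_eventually fun s hs => ?_
      exact (hG' x₀ hx₀ s hs).norm.eventually_lt_const ((hC s hs).trans_lt (lt_add_one C))
    refine intervalIntegral.hasFDerivAt_integral_of_dominated_of_fderiv_le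
      (s := B ∩ {x | ∀ s ∈ Icc (0 : ℝ) 1, ‖G' (x, s)‖ < C + 1}) (bound := fun _ => C + 1)
      (F := fun x s => G (x, s)) (F' := fun x s => G' (x, s))
      (inter_mem (hB.mem_nhds hx₀) hbd) ?_ ?_ ?_ ?_ ?_ ?_
    · filter_upwards [hB.mem_nhds hx₀] with x hx
      exact ((hGc x hx).mono hI).aestronglyMeasurable measurableSet_uIoc
    · exact ContinuousOn.intervalIntegrable (by rw [uIcc_of_le zero_le_one]; exact hGc x₀ hx₀)
    · exact ((hc G' hG' x₀ hx₀).mono hI).aestronglyMeasurable measurableSet_uIoc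
    · exact .of_forall fun t ht x hx => (hx.2 t (hI ht)).le
    · exact intervalIntegrable_const
    · refine .of_forall fun t ht x hx => ?_
      have h1 := ((hG x hx.1 t (hI ht)).differentiableAt (by simp)).hasFDerivAt
      exact HasFDerivAt.comp x h1 (hasFDerivAt_prodMk_left x t)
  induction n with
  | zero =>
    intro V _ _ _ G hG
    exact contDiffOn_zero.2 fun x hx => (key G hG x hx).continuousAt.continuousWithinAt
  | succ n ih =>
    intro V _ _ _ G hG
    push_cast
    rw [contDiffOn_succ_iff_fderiv_of_isOpen hB]
    refine ⟨fun x hx => (key G hG x hx).differentiableAt.differentiableWithinAt, by simp, ?_⟩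
    refine (ih (fun q => (fderiv ℝ G q).comp (ContinuousLinearMap.inl ℝ H ℝ)) ?_).congr
      fun x hx => (key G hG x hx).fderiv
    intro x hx s hs
    exact ((hG x hx s hs).fderiv_right (m := ∞) (by simp)).clm_comp contDiffAt_const

/-! ### Hadamard's division lemma -/

section

variable {E : Type} [NormedAddCommGroup E] [NormedSpace ℝ E]

/-- If `f (u, t) z` is smooth, so is the difference quotient `(f (u, t) z - f (u, 0) z) / t`. -/
theorem SmoothAt.dslope {f : E × ℝ → ℂ → ℂ} {u : E} {z : ℂ} (h : SmoothAt f ((u, 0), z)) :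
    SmoothAt (fun p z => dslope (fun s : ℝ => f (p.1, s) z) 0 p.2) ((u, 0), z) := by
  obtain ⟨δ, hδ, hball⟩ := Metric.eventually_nhds_iff_ball.1 h.eventually
  set f' : E × ℝ → ℂ → ℂ := fun p z => deriv (fun s : ℝ => f (p.1, s) z) p.2 with hf'
  set B : Set ((E × ℝ) × ℂ) := Metric.ball ((u, 0), z) δ with hB
  -- The ball is stable under shrinking the last parameter, so the segment of integration stays
  -- where `f` is smooth.
  have hmem : ∀ q ∈ B, ∀ s ∈ Icc (0 : ℝ) 1, (((q.1.1, s * q.1.2), q.2) : (E × ℝ) × ℂ) ∈ B := by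
    rintro ⟨⟨v, t⟩, w⟩ hq s hs
    simp only [hB, ← ball_prod_same, mem_prod, Metric.mem_ball, Real.dist_eq, sub_zero] at hq ⊢
    refine ⟨⟨hq.1.1, ?_⟩, hq.2⟩
    rw [abs_mul, abs_of_nonneg hs.1]
    exact (mul_le_of_le_one_left (abs_nonneg _) hs.2).trans_lt hq.1.2
  have hG : ∀ q ∈ B, ∀ s ∈ Icc (0 : ℝ) 1, ContDiffAt ℝ ∞
      (fun x : ((E × ℝ) × ℂ) × ℝ => f' (x.1.1.1, x.2 * x.1.1.2) x.1.2) (q, s) := by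
    intro q hq s hs
    have h1 := (hball _ (hmem q hq s hs)).deriv_real.contDiffAt
    have h2 : ContDiff ℝ ∞ (fun x : ((E × ℝ) × ℂ) × ℝ =>
        (((x.1.1.1, x.2 * x.1.1.2), x.1.2) : (E × ℝ) × ℂ)) := by fun_prop
    exact ContDiffAt.comp (g := fun q : (E × ℝ) × ℂ => f' q.1 q.2) (q, s) h1 h2.contDiffAt
  -- Hadamard's formula `(f(t) - f(0)) / t = ∫₀¹ f'(s t) ds`; at `t = 0` both sides are the
  -- derivative, which is the value given to `dslope` there.
  have hint : ∀ q ∈ B, ∫ s in (0 : ℝ)..1, f' (q.1.1, s * q.1.2) q.2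
      = _root_.dslope (fun s : ℝ => f (q.1.1, s) q.2) 0 q.1.2 := by
    intro q hq
    by_cases ht : q.1.2 = 0
    · simp [hf', ht, dslope_same]
    · rw [dslope_of_ne _ ht, slope_def_module]
      have hd : ∀ s ∈ uIcc (0 : ℝ) 1, HasDerivAt (fun s => q.1.2⁻¹ • f (q.1.1, s * q.1.2) q.2)
          (f' (q.1.1, s * q.1.2) q.2) s := by
        intro s hs
        rw [uIcc_of_le zero_le_one] at hs
        have h1 := (hball _ (hmem q hq s hs)).fderiv_apply_real
        have h2 : HasDerivAt (fun s => f (q.1.1, s) q.2) (f' (q.1.1, s * q.1.2) q.2)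
          (s * q.1.2) := h1.differentiableAt.hasDerivAt
        have h3 := (h2.scomp s ((hasDerivAt_id s).mul_const q.1.2)).const_smul q.1.2⁻¹
        refine h3.congr_deriv ?_
        rw [one_mul, smul_smul, inv_mul_cancel₀ ht, one_smul]
      rw [intervalIntegral.integral_eq_sub_of_hasDerivAt hd]
      · simp [smul_sub]
      · refine ContinuousOn.intervalIntegrable fun s hs => ?_
        rw [uIcc_of_le zero_le_one] at hs
        exact ((hG q hq s hs).continuousAt.comp (f := fun s : ℝ => (q, s))
          (Continuous.prodMk_right q).continuousAt).continuousWithinAt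
  have hBo : IsOpen B := Metric.isOpen_ball
  have hsm : ContDiffOn ℝ ∞ (fun q : (E × ℝ) × ℂ => _root_.dslope (fun s : ℝ => f (q.1.1, s) q.2) 0 q.1.2) B := by
    refine contDiffOn_infty.2 fun n => ?_
    exact (contDiffOn_intervalIntegral hBo n _ hG).congr fun q hq => (hint q hq).symm
  filter_upwards [hBo.mem_nhds (Metric.mem_ball_self hδ)] with q hq
  refine ⟨hsm.contDiffAt (hBo.mem_nhds hq), ?_⟩
  have hq0 : SmoothAt f ((q.1.1, 0), q.2) := by
    simpa using hball _ (hmem q hq 0 (by simp))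
  by_cases ht : q.1.2 = 0
  · have := hq0.deriv_real.differentiableAt
    simpa [ht, dslope_same] using this
  · simp only [dslope_of_ne _ ht, slope_def_module]
    exact ((hball q hq).differentiableAt.sub hq0.differentiableAt).const_smul _

end

/-! ### Smooth maps on the space of holomorphic functions -/

section Families

variable {E : Type} [NormedAddCommGroup E] [NormedSpace ℝ E]
  {E' : Type} [NormedAddCommGroup E'] [NormedSpace ℝ E']
  {S₀ : ℂ → ℂ} {Γ : Set ℂ}

/-- `f` is a smooth family through `S₀`, at the parameter `u₀`. -/
def IsFamilyThrough (S₀ : ℂ → ℂ) (Γ : Set ℂ) (f : E → ℂ → ℂ) (u₀ : E) : Prop :=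
  SmoothNear f u₀ Γ ∧ f u₀ =ᶠ[𝓝ˢ Γ] S₀

/-- `X` takes smooth families through `S₀` to smooth families. -/
def IsAmbientField (S₀ : ℂ → ℂ) (Γ : Set ℂ) (X : (ℂ → ℂ) → ℂ → ℂ) : Prop :=
  ∀ (E : Type) [NormedAddCommGroup E] [NormedSpace ℝ E] [FiniteDimensional ℝ E]
    (f : E → ℂ → ℂ) (u₀ : E), SmoothNear f u₀ Γ → f u₀ =ᶠ[𝓝ˢ Γ] S₀ →
      SmoothNear (fun u => X (f u)) u₀ Γ

theorem IsVectorField.isAmbientField {X : (ℂ → ℂ) → ℂ → ℂ} (h : IsVectorField S₀ Γ X) :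
    IsAmbientField S₀ Γ X := h.1

/-- The derivative of `Z` at `S` in the direction `A`. -/
def dirDeriv (Z : (ℂ → ℂ) → ℂ → ℂ) (S A : ℂ → ℂ) (z : ℂ) : ℂ :=
  deriv (fun r : ℝ => Z (fun ζ => S ζ + r * A ζ) z) 0

/-- The second derivative of `Z` at `S` in the directions `A`, `B`. -/
def dirDeriv₂ (Z : (ℂ → ℂ) → ℂ → ℂ) (S A B : ℂ → ℂ) (z : ℂ) : ℂ :=
  deriv (fun r : ℝ => dirDeriv Z (fun ζ => S ζ + r * A ζ) B z) 0

theorem IsFamilyThrough.reparam {f : E → ℂ → ℂ} {ρ : E' → E} {v₀ : E'} (hΓ : IsCompact Γ)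
    (hf : IsFamilyThrough S₀ Γ f (ρ v₀)) (hρ : ContDiff ℝ ∞ ρ) :
    IsFamilyThrough S₀ Γ (fun v => f (ρ v)) v₀ :=
  ⟨(smoothNear_iff hΓ).2 fun z hz => ((smoothNear_iff hΓ).1 hf.1 z hz).reparam hρ, hf.2⟩

theorem SmoothNear.reparam {f : E → ℂ → ℂ} {ρ : E' → E} {v₀ : E'} (hΓ : IsCompact Γ)
    (hf : SmoothNear f (ρ v₀) Γ) (hρ : ContDiff ℝ ∞ ρ) :
    SmoothNear (fun v => f (ρ v)) v₀ Γ :=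
  (smoothNear_iff hΓ).2 fun z hz => ((smoothNear_iff hΓ).1 hf z hz).reparam hρ

theorem IsFamilyThrough.add_smul {f g : E → ℂ → ℂ} {ρ : E → ℝ} {u₀ : E} (hΓ : IsCompact Γ)
    (hf : IsFamilyThrough S₀ Γ f u₀) (hg : SmoothNear g u₀ Γ) (hρ : ContDiff ℝ ∞ ρ)
    (h0 : ρ u₀ = 0) : IsFamilyThrough S₀ Γ (fun u ζ => f u ζ + ρ u * g u ζ) u₀ := by
  refine ⟨(smoothNear_iff hΓ).2 fun z hz => ?_, ?_⟩
  · exact ((smoothNear_iff hΓ).1 hf.1 z hz).add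
      ((SmoothAt.ofReal (.of_forall fun u => hρ.contDiffAt)).mul ((smoothNear_iff hΓ).1 hg z hz))
  · simpa [h0] using hf.2

/-- The family `f u + r * g u` with an additional real parameter. -/
theorem IsFamilyThrough.line {f g : E → ℂ → ℂ} {u₀ : E} (hΓ : IsCompact Γ)
    (hf : IsFamilyThrough S₀ Γ f u₀) (hg : SmoothNear g u₀ Γ) :
    IsFamilyThrough S₀ Γ (fun (p : E × ℝ) ζ => f p.1 ζ + p.2 * g p.1 ζ) (u₀, 0) :=
  IsFamilyThrough.add_smul (f := fun p : E × ℝ => f p.1) (g := fun p : E × ℝ => g p.1)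
    (ρ := Prod.snd) hΓ (hf.reparam (ρ := (Prod.fst : E × ℝ → E)) (v₀ := (u₀, (0:ℝ))) hΓ contDiff_fst)
    (SmoothNear.reparam (ρ := (Prod.fst : E × ℝ → E)) (v₀ := (u₀, (0:ℝ))) hΓ hg contDiff_fst)
    contDiff_snd rfl

theorem SmoothNear.smoothAt {f : E → ℂ → ℂ} {u₀ : E} (h : SmoothNear f u₀ Γ) {z : ℂ}
    (hz : z ∈ Γ) : SmoothAt f (u₀, z) := by
  have := smoothNear_iff_eventually.1 h
  rw [eventually_iff_exists_mem] at this
  obtain ⟨v, hv, h⟩ := this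
  have hle : 𝓝 (u₀, z) ≤ 𝓝 u₀ ×ˢ 𝓝ˢ Γ := by
    rw [nhds_prod_eq]; exact prod_mono le_rfl (nhds_le_nhdsSet hz)
  exact eventually_of_mem (hle hv) h

theorem SmoothNear.eventually {f : E → ℂ → ℂ} {u₀ : E} (hΓ : IsCompact Γ)
    (h : SmoothNear f u₀ Γ) : ∀ᶠ q in 𝓝 u₀ ×ˢ 𝓝ˢ Γ, SmoothAt f q :=
  (eventually_prod_nhdsSet_iff hΓ).2 fun _ hz => (h.smoothAt hz).eventually

theorem eventually_nhds_of_near {X : Type*} [TopologicalSpace X] {u₀ : X} (hΓ : IsCompact Γ)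
    {P : X × ℂ → Prop} (h : ∀ᶠ q in 𝓝 u₀ ×ˢ 𝓝ˢ Γ, P q) :
    ∀ᶠ q in 𝓝 u₀ ×ˢ 𝓝ˢ Γ, ∀ᶠ q' in 𝓝 q, P q' := by
  rw [eventually_prod_nhdsSet_iff hΓ] at h ⊢
  exact fun z hz => (h z hz).eventually_nhds

theorem near_reparam {X Y : Type*} [TopologicalSpace X] [TopologicalSpace Y] {ρ : Y → X} {v₀ : Y}
    (hρ : ContinuousAt ρ v₀) {P : X × ℂ → Prop} (h : ∀ᶠ q in 𝓝 (ρ v₀) ×ˢ 𝓝ˢ Γ, P q) :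
    ∀ᶠ q in 𝓝 v₀ ×ˢ 𝓝ˢ Γ, P (ρ q.1, q.2) :=
  (Tendsto.prodMap hρ tendsto_id).eventually h

/-- Differentiating an identity in `t` requires it as a germ at `t₀` for each fixed nearby `(u, z)`;
this extracts such germs from a joint statement. -/
theorem near_param {X Y : Type*} [TopologicalSpace X] [TopologicalSpace Y] {u₀ : X} {t₀ : Y}
    (hΓ : IsCompact Γ) {P : (X × Y) × ℂ → Prop}
    (h : ∀ᶠ q in 𝓝 (u₀, t₀) ×ˢ 𝓝ˢ Γ, P q) :
    ∀ᶠ q in 𝓝 u₀ ×ˢ 𝓝ˢ Γ, ∀ᶠ t in 𝓝 t₀, P ((q.1, t), q.2) := by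
  have := near_reparam (ρ := fun u : X => (u, t₀)) (Continuous.prodMk_left t₀).continuousAt
    (eventually_nhds_of_near hΓ h)
  filter_upwards [this] with q hq
  have hc : Continuous (fun t : Y => (((q.1, t), q.2) : (X × Y) × ℂ)) := by fun_prop
  exact hc.continuousAt.eventually hq

theorem near_const {X : Type*} [TopologicalSpace X] {u₀ : X} {P : ℂ → Prop} (h : ∀ᶠ z in 𝓝ˢ Γ, P z) :
    ∀ᶠ q in 𝓝 u₀ ×ˢ 𝓝ˢ Γ, P q.2 := tendsto_snd.eventually h

theorem near_slice {X : Type*} [TopologicalSpace X] {u₀ : X} {P : X × ℂ → Prop}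
    (h : ∀ᶠ q in 𝓝 u₀ ×ˢ 𝓝ˢ Γ, P q) : ∀ᶠ z in 𝓝ˢ Γ, P (u₀, z) := by
  obtain ⟨s, hs, t, ht, hst⟩ := mem_prod_iff.1 h
  exact eventually_of_mem ht fun z hz => hst (mk_mem_prod (mem_of_mem_nhds hs) hz)

theorem SmoothNear.congr {f g : E → ℂ → ℂ} {u₀ : E} (hΓ : IsCompact Γ)
    (h : SmoothNear f u₀ Γ) (hfg : ∀ᶠ q in 𝓝 u₀ ×ˢ 𝓝ˢ Γ, f q.1 q.2 = g q.1 q.2) :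
    SmoothNear g u₀ Γ :=
  (smoothNear_iff hΓ).2 fun z hz =>
    (h.smoothAt hz).congr ((eventually_prod_nhdsSet_iff hΓ).1 hfg z hz)

theorem IsFamilyThrough.congr {f g : E → ℂ → ℂ} {u₀ : E} (hΓ : IsCompact Γ)
    (h : IsFamilyThrough S₀ Γ f u₀) (hfg : ∀ᶠ q in 𝓝 u₀ ×ˢ 𝓝ˢ Γ, f q.1 q.2 = g q.1 q.2) :
    IsFamilyThrough S₀ Γ g u₀ := by
  refine ⟨h.1.congr hΓ hfg, ?_⟩
  filter_upwards [near_slice hfg, h.2] with z h1 h2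
  rw [← h2, ← h1]

/-- The values of an ambient field along a family depend only on the germs near `Γ`. -/
theorem IsAmbientField.eventually_eq [FiniteDimensional ℝ E] {X : (ℂ → ℂ) → ℂ → ℂ}
    (hΓ : IsCompact Γ) (hX : IsAmbientField S₀ Γ X) {f g : E → ℂ → ℂ} {u₀ : E}
    (hf : IsFamilyThrough S₀ Γ f u₀) (hfg : ∀ᶠ q in 𝓝 u₀ ×ˢ 𝓝ˢ Γ, f q.1 q.2 = g q.1 q.2) :
    ∀ᶠ q in 𝓝 u₀ ×ˢ 𝓝ˢ Γ, X (f q.1) q.2 = X (g q.1) q.2 := by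
  classical
  -- The glued family jumps from `f` to `g` as functions on all of `ℂ`, but near `Γ` it does not
  -- depend on the new parameter and is smooth. The field takes it to a smooth family, whose
  -- continuity at parameter `0` from the right identifies the two values.
  set h : E × ℝ → ℂ → ℂ := fun p => if p.2 ≤ 0 then f p.1 else g p.1 with hh
  have hth : IsFamilyThrough S₀ Γ h (u₀, 0) := by
    refine IsFamilyThrough.congr (f := fun p : E × ℝ => f p.1) hΓ
      (hf.reparam (v₀ := (u₀, (0:ℝ))) hΓ contDiff_fst) ?_
    filter_upwards [near_reparam (ρ := (Prod.fst : E × ℝ → E)) (v₀ := (u₀, (0:ℝ)))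
      continuousAt_fst hfg] with q hq
    by_cases h0 : q.1.2 ≤ 0
    · simp [hh, h0]
    · simp [hh, h0, hq]
  have hsm := (hX (E × ℝ) h (u₀, 0) hth.1 hth.2).eventually hΓ
  have h2 := near_reparam (ρ := fun u : E => (u, (0:ℝ)))
    (Continuous.prodMk_left (0:ℝ)).continuousAt hsm
  filter_upwards [h2] with q hq
  have hc : ContinuousAt (fun s : ℝ => X (h (q.1, s)) q.2) 0 := by
    have hl : Continuous (fun s : ℝ => (((q.1, s), q.2) : (E × ℝ) × ℂ)) := by fun_prop
    exact ContinuousAt.comp (g := fun q : (E × ℝ) × ℂ => X (h q.1) q.2)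
      (f := fun s : ℝ => (((q.1, s), q.2) : (E × ℝ) × ℂ)) hq.continuousAt hl.continuousAt
  have hr : Tendsto (fun s : ℝ => X (h (q.1, s)) q.2) (𝓝[>] 0) (𝓝 (X (f q.1) q.2)) := by
    have := hc.tendsto.mono_left (nhdsWithin_le_nhds (s := Ioi (0:ℝ)))
    simpa [hh] using this
  refine tendsto_nhds_unique hr (tendsto_const_nhds.congr' ?_)
  filter_upwards [self_mem_nhdsWithin] with s hs
  simp [hh, not_le.2 (mem_Ioi.1 hs)]

theorem IsAmbientField.smoothNear [FiniteDimensional ℝ E] {X : (ℂ → ℂ) → ℂ → ℂ}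
    (hX : IsAmbientField S₀ Γ X) {f : E → ℂ → ℂ} {u₀ : E}
    (hf : IsFamilyThrough S₀ Γ f u₀) : SmoothNear (fun u => X (f u)) u₀ Γ := hX E f u₀ hf.1 hf.2

theorem SmoothNear.deriv_real {f : E × ℝ → ℂ → ℂ} {u₀ : E} {t₀ : ℝ} (hΓ : IsCompact Γ)
    (h : SmoothNear f (u₀, t₀) Γ) :
    SmoothNear (fun p z => deriv (fun s : ℝ => f (p.1, s) z) p.2) (u₀, t₀) Γ :=
  (smoothNear_iff hΓ).2 fun _ hz => (h.smoothAt hz).deriv_real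

theorem SmoothNear.deriv_real_zero {f : E × ℝ → ℂ → ℂ} {u₀ : E} {t₀ : ℝ} (hΓ : IsCompact Γ)
    (h : SmoothNear f (u₀, t₀) Γ) :
    SmoothNear (fun u z => deriv (fun s : ℝ => f (u, s) z) t₀) u₀ Γ :=
  SmoothNear.reparam (v₀ := u₀) (ρ := fun u : E => (u, t₀)) hΓ (h.deriv_real hΓ)
    (contDiff_id.prodMk contDiff_const)

theorem SmoothAt.hasDerivAt_comp_curve {f : E → ℂ → ℂ} {z : ℂ} {c : ℝ → E} {t : ℝ} {c' : E}
    (h : SmoothAt f (c t, z)) (hc : HasDerivAt c c' t) :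
    HasDerivAt (fun s => f (c s) z) (fderiv ℝ (fun q : E × ℂ => f q.1 q.2) (c t, z) (c', 0)) t :=
  HasFDerivAt.comp_hasDerivAt (l := fun q : E × ℂ => f q.1 q.2) t
    h.differentiableAt_real.hasFDerivAt (hc.prodMk (hasDerivAt_const t z))

/-- Diagonal derivative of a function of two real parameters. -/
theorem SmoothAt.hasDerivAt_diag {f : ℝ × ℝ → ℂ → ℂ} {z : ℂ} {a b : ℝ}
    (h : SmoothAt f ((0, 0), z)) :
    HasDerivAt (fun s : ℝ => f (s * a, s * b) z)
      (a * deriv (fun s : ℝ => f (s, 0) z) 0 + b * deriv (fun s : ℝ => f (0, s) z) 0) 0 := by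
  have key : ∀ a b : ℝ, HasDerivAt (fun s : ℝ => f (s * a, s * b) z)
      (fderiv ℝ (fun q : (ℝ × ℝ) × ℂ => f q.1 q.2) ((0, 0), z) ((a, b), 0)) 0 := by
    intro a b
    have hc : HasDerivAt (fun s : ℝ => (s * a, s * b)) (a, b) 0 := by
      simpa using ((hasDerivAt_id (0:ℝ)).mul_const a).prodMk ((hasDerivAt_id (0:ℝ)).mul_const b)
    have := SmoothAt.hasDerivAt_comp_curve (f := f) (z := z) (c := fun s : ℝ => (s * a, s * b))
      (t := 0) (by simpa using h) hc
    simpa using this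
  have h1 := (key 1 0).deriv
  have h2 := (key 0 1).deriv
  simp only [mul_one, mul_zero] at h1 h2
  rw [h1, h2]
  refine (key a b).congr_deriv ?_
  have e : ((a, b), (0:ℂ)) = a • (((1:ℝ), (0:ℝ)), (0:ℂ)) + b • (((0:ℝ), (1:ℝ)), (0:ℂ)) := by simp
  rw [e, map_add, map_smul, map_smul]
  simp

/-! ### Chain rules for ambient fields -/

variable [FiniteDimensional ℝ E] {Z : (ℂ → ℂ) → ℂ → ℂ}

/-- Chain rule for an ambient field along a family. -/
theorem IsAmbientField.hasDerivAt_comp (hΓ : IsCompact Γ) (hZ : IsAmbientField S₀ Γ Z)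
    {f : E × ℝ → ℂ → ℂ} {u₀ : E} (hf : IsFamilyThrough S₀ Γ f (u₀, 0)) :
    ∀ᶠ q in 𝓝 u₀ ×ˢ 𝓝ˢ Γ, HasDerivAt (fun t : ℝ => Z (f (q.1, t)) q.2)
      (dirDeriv Z (f (q.1, 0)) (fun ζ => deriv (fun t : ℝ => f (q.1, t) ζ) 0) q.2) 0 := by
  set W : E × ℝ → ℂ → ℂ := fun p z => dslope (fun s : ℝ => f (p.1, s) z) 0 p.2 with hW
  have hWs : SmoothNear W (u₀, 0) Γ := (smoothNear_iff hΓ).2 fun z hz => (hf.1.smoothAt hz).dslope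
  -- The two occurrences of `t` in `f_t = f_0 + t W_t` become independent parameters. On the
  -- diagonal this is the given family. In the parameter of `W` it is constant when the factor is
  -- `0`, and in the factor it is a straight line with direction `W_0`, the velocity of `f`.
  set k : (E × ℝ) × ℝ → ℂ → ℂ := fun p ζ => f (p.1.1, 0) ζ + p.2 * W p.1 ζ with hk
  have hk1 : IsFamilyThrough S₀ Γ k ((u₀, 0), 0) :=
    IsFamilyThrough.line (f := fun p : E × ℝ => f (p.1, 0)) (g := W) hΓ
      (hf.reparam (v₀ := (u₀, (0:ℝ))) (ρ := fun p : E × ℝ => (p.1, (0:ℝ))) hΓ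
        (contDiff_fst.prodMk contDiff_const)) hWs
  have hdiag : ∀ u t, f (u, t) = k ((u, t), t) := by
    intro u t
    ext ζ
    have := sub_smul_dslope (fun s : ℝ => f (u, s) ζ) 0 t
    simp only [sub_zero, Complex.real_smul] at this
    simp [hk, hW, this]
  have hzero : ∀ u t, k ((u, t), 0) = f (u, 0) := by
    intro u t; ext ζ; simp [hk]
  have hsm := (hZ.smoothNear hk1).eventually hΓ
  have h2 := near_reparam (ρ := fun u : E => ((u, (0:ℝ)), (0:ℝ)))
    (by fun_prop : ContinuousAt (fun u : E => ((u, (0:ℝ)), (0:ℝ))) u₀) hsm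
  filter_upwards [h2] with q hq
  have h3 := SmoothAt.reparam (f := fun p => Z (k p)) (ρ := fun p : ℝ × ℝ => ((q.1, p.1), p.2))
    (u := ((0:ℝ), (0:ℝ))) hq (by fun_prop)
  have h4 := h3.hasDerivAt_diag (a := 1) (b := 1)
  simp only [mul_one, ← hdiag, hzero, deriv_const, mul_zero, zero_add, Complex.ofReal_one,
    one_mul] at h4
  simpa only [dirDeriv, hk, hW, dslope_same] using h4

theorem IsAmbientField.deriv_comp (hΓ : IsCompact Γ) (hZ : IsAmbientField S₀ Γ Z)
    {f : E × ℝ → ℂ → ℂ} {u₀ : E} (hf : IsFamilyThrough S₀ Γ f (u₀, 0)) :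
    ∀ᶠ q in 𝓝 u₀ ×ˢ 𝓝ˢ Γ, deriv (fun t : ℝ => Z (f (q.1, t)) q.2) 0
      = dirDeriv Z (f (q.1, 0)) (fun ζ => deriv (fun t : ℝ => f (q.1, t) ζ) 0) q.2 :=
  (hZ.hasDerivAt_comp hΓ hf).mono fun _ h => h.deriv

/-- the derivative in a smoothly varying direction is smooth -/
theorem IsAmbientField.smoothNear_dirDeriv (hΓ : IsCompact Γ) (hZ : IsAmbientField S₀ Γ Z)
    {f A : E → ℂ → ℂ} {u₀ : E} (hf : IsFamilyThrough S₀ Γ f u₀) (hA : SmoothNear A u₀ Γ) :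
    SmoothNear (fun u => dirDeriv Z (f u) (A u)) u₀ Γ :=
  (hZ.smoothNear (hf.line hΓ hA)).deriv_real_zero hΓ

theorem IsAmbientField.dirDeriv_congr (hΓ : IsCompact Γ) (hZ : IsAmbientField S₀ Γ Z)
    {f g A B : E → ℂ → ℂ} {u₀ : E} (hf : IsFamilyThrough S₀ Γ f u₀) (hA : SmoothNear A u₀ Γ)
    (hfg : ∀ᶠ q in 𝓝 u₀ ×ˢ 𝓝ˢ Γ, f q.1 q.2 = g q.1 q.2)
    (hAB : ∀ᶠ q in 𝓝 u₀ ×ˢ 𝓝ˢ Γ, A q.1 q.2 = B q.1 q.2) :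
    ∀ᶠ q in 𝓝 u₀ ×ˢ 𝓝ˢ Γ, dirDeriv Z (f q.1) (A q.1) q.2 = dirDeriv Z (g q.1) (B q.1) q.2 := by
  have h := near_param hΓ (hZ.eventually_eq hΓ (hf.line hΓ hA)
    (g := fun p ζ => g p.1 ζ + p.2 * B p.1 ζ) (by
      filter_upwards [near_reparam (ρ := (Prod.fst : E × ℝ → E)) (v₀ := (u₀, (0:ℝ)))
        continuousAt_fst (hfg.and hAB)] with q hq
      rw [hq.1, hq.2]))
  filter_upwards [h] with q hq
  exact EventuallyEq.deriv_eq hq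

/-- Linearity in the direction is the diagonal derivative of the smooth function of `(r, s)`
obtained from `f + r A + s B`. The neighbourhood does not depend on `a` and `b`, so a coefficient
may vary with a parameter, as it does in `IsAmbientField.deriv_deriv_comp`. -/
theorem IsAmbientField.dirDeriv_add (hΓ : IsCompact Γ) (hZ : IsAmbientField S₀ Γ Z)
    {f A B : E → ℂ → ℂ} {u₀ : E} (hf : IsFamilyThrough S₀ Γ f u₀) (hA : SmoothNear A u₀ Γ)
    (hB : SmoothNear B u₀ Γ) :
    ∀ᶠ q in 𝓝 u₀ ×ˢ 𝓝ˢ Γ, ∀ a b : ℝ, dirDeriv Z (f q.1) (fun ζ => a * A q.1 ζ + b * B q.1 ζ) q.2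
      = a * dirDeriv Z (f q.1) (A q.1) q.2 + b * dirDeriv Z (f q.1) (B q.1) q.2 := by
  have hk := (hf.line hΓ hA).line hΓ
    (hB.reparam (v₀ := (u₀, (0:ℝ))) (ρ := (Prod.fst : E × ℝ → E)) hΓ contDiff_fst)
  have hsm := (hZ.smoothNear hk).eventually hΓ
  have h2 := near_reparam (ρ := fun u : E => ((u, (0:ℝ)), (0:ℝ)))
    (by fun_prop : ContinuousAt (fun u : E => ((u, (0:ℝ)), (0:ℝ))) u₀) hsm
  filter_upwards [h2] with q hq a b
  have h3 := SmoothAt.reparam (f := fun p : (E × ℝ) × ℝ => Z fun ζ =>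
      f p.1.1 ζ + p.1.2 * A p.1.1 ζ + p.2 * B p.1.1 ζ)
    (ρ := fun p : ℝ × ℝ => ((q.1, p.1), p.2))
    (u := ((0:ℝ), (0:ℝ))) hq (by fun_prop)
  have h4 := (h3.hasDerivAt_diag (a := a) (b := b)).deriv
  simp only [Complex.ofReal_zero, zero_mul, add_zero] at h4
  rw [dirDeriv, dirDeriv, dirDeriv, ← h4]
  congr 1
  ext r
  congr 1
  ext ζ
  push_cast
  ring

theorem deriv_deriv_comm {f : ℝ × ℝ → ℂ → ℂ} {z : ℂ} {r t : ℝ} (h : SmoothAt f ((r, t), z)) :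
    deriv (fun a => deriv (fun b => f (a, b) z) t) r
      = deriv (fun b => deriv (fun a => f (a, b) z) r) t := by
  set F : (ℝ × ℝ) × ℂ → ℂ := fun q => f q.1 q.2 with hF
  have hd : DifferentiableAt ℝ (fderiv ℝ F) ((r, t), z) :=
    (h.contDiffAt.fderiv_right (m := ∞) (by simp)).differentiableAt (by simp)
  have hsymm : IsSymmSndFDerivAt ℝ F ((r, t), z) := h.contDiffAt.isSymmSndFDerivAt two_le_infty
  have l1 : ∀ q : (ℝ × ℝ) × ℂ, SmoothAt f q →
      deriv (fun b => f (q.1.1, b) q.2) q.1.2 = fderiv ℝ F q ((0, 1), 0) := fun q hq =>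
    (SmoothAt.hasDerivAt_comp_curve (f := f) (c := fun b => (q.1.1, b)) (t := q.1.2) hq
      ((hasDerivAt_const _ _).prodMk (hasDerivAt_id _))).deriv
  have l2 : ∀ q : (ℝ × ℝ) × ℂ, SmoothAt f q →
      deriv (fun a => f (a, q.1.2) q.2) q.1.1 = fderiv ℝ F q ((1, 0), 0) := fun q hq =>
    (SmoothAt.hasDerivAt_comp_curve (f := f) (c := fun a => (a, q.1.2)) (t := q.1.1) hq
      ((hasDerivAt_id _).prodMk (hasDerivAt_const _ _))).deriv
  have c1 : HasDerivAt (fun a : ℝ => (((a, t), z) : (ℝ × ℝ) × ℂ)) ((1, 0), 0) r :=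
    ((hasDerivAt_id r).prodMk (hasDerivAt_const _ _)).prodMk (hasDerivAt_const _ _)
  have c2 : HasDerivAt (fun b : ℝ => (((r, b), z) : (ℝ × ℝ) × ℂ)) ((0, 1), 0) t :=
    ((hasDerivAt_const _ _).prodMk (hasDerivAt_id t)).prodMk (hasDerivAt_const _ _)
  have e1 : (fun a => deriv (fun b => f (a, b) z) t) =ᶠ[𝓝 r]
      fun a => fderiv ℝ F ((a, t), z) ((0, 1), 0) := by
    filter_upwards [c1.continuousAt.eventually h.eventually] with a ha using l1 _ ha
  have e2 : (fun b => deriv (fun a => f (a, b) z) r) =ᶠ[𝓝 t]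
      fun b => fderiv ℝ F ((r, b), z) ((1, 0), 0) := by
    filter_upwards [c2.continuousAt.eventually h.eventually] with a ha using l2 _ ha
  rw [e1.deriv_eq, e2.deriv_eq]
  have d1 : HasDerivAt (fun a => fderiv ℝ F ((a, t), z) ((0, 1), 0)) _ r :=
    (HasFDerivAt.comp_hasDerivAt (l := fderiv ℝ F) r hd.hasFDerivAt c1).clm_apply
      (hasDerivAt_const r _)
  have d2 : HasDerivAt (fun b => fderiv ℝ F ((r, b), z) ((1, 0), 0)) _ t :=
    (HasFDerivAt.comp_hasDerivAt (l := fderiv ℝ F) t hd.hasFDerivAt c2).clm_apply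
      (hasDerivAt_const t _)
  rw [d1.deriv, d2.deriv]
  simpa using hsymm.eq _ _

theorem IsAmbientField.dirDeriv₂_comm (hΓ : IsCompact Γ) (hZ : IsAmbientField S₀ Γ Z)
    {f A B : E → ℂ → ℂ} {u₀ : E} (hf : IsFamilyThrough S₀ Γ f u₀) (hA : SmoothNear A u₀ Γ)
    (hB : SmoothNear B u₀ Γ) :
    ∀ᶠ q in 𝓝 u₀ ×ˢ 𝓝ˢ Γ, dirDeriv₂ Z (f q.1) (A q.1) (B q.1) q.2
      = dirDeriv₂ Z (f q.1) (B q.1) (A q.1) q.2 := by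
  have hk := (hf.line hΓ hA).line hΓ
    (hB.reparam (v₀ := (u₀, (0:ℝ))) (ρ := (Prod.fst : E × ℝ → E)) hΓ contDiff_fst)
  have hsm := (hZ.smoothNear hk).eventually hΓ
  have h2 := near_reparam (ρ := fun u : E => ((u, (0:ℝ)), (0:ℝ)))
    (by fun_prop : ContinuousAt (fun u : E => ((u, (0:ℝ)), (0:ℝ))) u₀) hsm
  filter_upwards [h2] with q hq
  have h3 := SmoothAt.reparam (f := fun p : (E × ℝ) × ℝ => Z fun ζ =>
      f p.1.1 ζ + p.1.2 * A p.1.1 ζ + p.2 * B p.1.1 ζ)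
    (ρ := fun p : ℝ × ℝ => ((q.1, p.1), p.2))
    (u := ((0:ℝ), (0:ℝ))) hq (by fun_prop)
  have h4 := deriv_deriv_comm h3
  simp only [dirDeriv₂, dirDeriv]
  refine h4.trans ?_
  congr 1
  ext r
  congr 1
  ext s
  congr 1
  ext ζ
  ring

/-- Second-order chain rule for an ambient field along a family. -/
theorem IsAmbientField.deriv_deriv_comp (hΓ : IsCompact Γ) (hZ : IsAmbientField S₀ Γ Z)
    {h : (E × ℝ) × ℝ → ℂ → ℂ} {u₀ : E} (hh : IsFamilyThrough S₀ Γ h ((u₀, 0), 0)) :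
    ∀ᶠ q in 𝓝 u₀ ×ˢ 𝓝ˢ Γ,
      deriv (fun r : ℝ => deriv (fun t : ℝ => Z (h ((q.1, r), t)) q.2) 0) 0
      = dirDeriv₂ Z (h ((q.1, 0), 0)) (fun ζ => deriv (fun r : ℝ => h ((q.1, r), 0) ζ) 0)
          (fun ζ => deriv (fun t : ℝ => h ((q.1, 0), t) ζ) 0) q.2
        + dirDeriv Z (h ((q.1, 0), 0))
          (fun ζ => deriv (fun r : ℝ => deriv (fun t : ℝ => h ((q.1, r), t) ζ) 0) 0) q.2 := by
  set B : E × ℝ → ℂ → ℂ := fun p ζ => deriv (fun t : ℝ => h (p, t) ζ) 0 with hB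
  have hBs : SmoothNear B (u₀, 0) Γ := hh.1.deriv_real_zero hΓ
  set h0 : E × ℝ → ℂ → ℂ := fun p => h (p, 0) with hh0
  have hh0t : IsFamilyThrough S₀ Γ h0 (u₀, 0) := hh.reparam (v₀ := (u₀, (0:ℝ)))
    (ρ := fun p : E × ℝ => (p, (0:ℝ))) hΓ (by fun_prop)
  have hsec : ∀ {f : E × ℝ → ℂ → ℂ}, SmoothNear f (u₀, 0) Γ →
      SmoothNear (fun u => f (u, 0)) u₀ Γ := fun hf =>
    hf.reparam (v₀ := u₀) (ρ := fun u : E => (u, (0:ℝ))) hΓ (by fun_prop)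
  set f : E → ℂ → ℂ := fun u => h ((u, 0), 0) with hf
  have hft : IsFamilyThrough S₀ Γ f u₀ := ⟨hsec hh0t.1, hh0t.2⟩
  set A : E → ℂ → ℂ := fun u ζ => deriv (fun r : ℝ => h0 (u, r) ζ) 0 with hA
  have hAs : SmoothNear A u₀ Γ := hh0t.1.deriv_real_zero hΓ
  set C : E → ℂ → ℂ := fun u ζ => deriv (fun r : ℝ => B (u, r) ζ) 0 with hC
  have hCs : SmoothNear C u₀ Γ := hBs.deriv_real_zero hΓ
  set B0 : E → ℂ → ℂ := fun u => B (u, 0) with hB0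
  have hB0s : SmoothNear B0 u₀ Γ := hsec hBs
  -- the inner derivative
  have s1 := near_param hΓ (hZ.deriv_comp hΓ hh)
  -- interchange the derivatives
  have hk := hh0t.line hΓ hBs
  have hsm := near_reparam (ρ := fun u : E => ((u, (0:ℝ)), (0:ℝ)))
    (by fun_prop : ContinuousAt (fun u : E => ((u, (0:ℝ)), (0:ℝ))) u₀)
    ((hZ.smoothNear hk).eventually hΓ)
  -- the derivative in `r`, with parameter `ε`
  have hk' : IsFamilyThrough S₀ Γ (fun (p : (E × ℝ) × ℝ) ζ =>
      h0 (p.1.1, p.2) ζ + p.1.2 * B (p.1.1, p.2) ζ) ((u₀, 0), 0) :=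
    hk.reparam (v₀ := ((u₀, (0:ℝ)), (0:ℝ)))
      (ρ := fun p : (E × ℝ) × ℝ => ((p.1.1, p.2), p.1.2)) hΓ (by fun_prop)
  have s2 := near_param hΓ (hZ.deriv_comp hΓ hk')
  have hl := hft.line hΓ hB0s
  have hAl : SmoothNear (fun p : E × ℝ => A p.1) (u₀, 0) Γ :=
    hAs.reparam (v₀ := (u₀, (0:ℝ))) (ρ := (Prod.fst : E × ℝ → E)) hΓ contDiff_fst
  have hCl : SmoothNear (fun p : E × ℝ => C p.1) (u₀, 0) Γ :=
    hCs.reparam (v₀ := (u₀, (0:ℝ))) (ρ := (Prod.fst : E × ℝ → E)) hΓ contDiff_fst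
  -- At `r = 0` the family `h0 + ε B` passes through `f + ε B0`, and its velocity there is `A + ε
  -- C`.
  have s3 := near_param hΓ (hZ.dirDeriv_congr hΓ (hk'.reparam (v₀ := (u₀, (0:ℝ)))
      (ρ := fun p : E × ℝ => (p, (0:ℝ))) hΓ (by fun_prop)) (hk'.1.deriv_real_zero hΓ)
    (g := fun p ζ => f p.1 ζ + p.2 * B0 p.1 ζ)
    (B := fun p ζ => ((1:ℝ):ℂ) * A p.1 ζ + p.2 * C p.1 ζ) (.of_forall fun _ => rfl) (by
      have a1 := near_reparam (ρ := fun p : E × ℝ => (p.1, (0:ℝ))) (v₀ := (u₀, (0:ℝ)))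
        (by fun_prop) (hh0t.1.eventually hΓ)
      have a2 := near_reparam (ρ := fun p : E × ℝ => (p.1, (0:ℝ))) (v₀ := (u₀, (0:ℝ)))
        (by fun_prop) (hBs.eventually hΓ)
      filter_upwards [a1, a2] with q h1 h2
      rw [deriv_fun_add h1.fderiv_apply_real.differentiableAt
        (h2.fderiv_apply_real.differentiableAt.const_mul _),
        deriv_const_mul _ h2.fderiv_apply_real.differentiableAt]
      simp [hA, hC]))
  have s4 := near_param hΓ (hZ.dirDeriv_add hΓ hl hAl hCl)
  have d1 := near_reparam (ρ := fun u : E => (u, (0:ℝ))) (v₀ := u₀) (by fun_prop)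
    ((hZ.smoothNear_dirDeriv hΓ hl hAl).eventually hΓ)
  have d2 := near_reparam (ρ := fun u : E => (u, (0:ℝ))) (v₀ := u₀) (by fun_prop)
    ((hZ.smoothNear_dirDeriv hΓ hl hCl).eventually hΓ)
  filter_upwards [s1, hsm, s2, s3, s4, d1, d2, hZ.dirDeriv₂_comm hΓ hft hAs hB0s] with
    q q1 q2 q3 q4 q5 q6 q7 q8
  have e1 : deriv (fun r : ℝ => deriv (fun t : ℝ => Z (h ((q.1, r), t)) q.2) 0) 0
      = deriv (fun r : ℝ => deriv (fun ε : ℝ => Z (fun ζ => h0 (q.1, r) ζ + ε * B (q.1, r) ζ) q.2)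
        0) 0 := EventuallyEq.deriv_eq q1
  have e2 := deriv_deriv_comm (SmoothAt.reparam (f := fun p : (E × ℝ) × ℝ => Z fun ζ =>
      h0 p.1 ζ + p.2 * B p.1 ζ) (ρ := fun p : ℝ × ℝ => ((q.1, p.1), p.2))
      (u := ((0:ℝ), (0:ℝ))) q2 (by fun_prop))
  have e3 : deriv (fun ε : ℝ => deriv (fun r : ℝ =>
        Z (fun ζ => h0 (q.1, r) ζ + ε * B (q.1, r) ζ) q.2) 0) 0
      = deriv (fun ε : ℝ => dirDeriv Z (fun ζ => f q.1 ζ + ε * B0 q.1 ζ) (A q.1) q.2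
        + ε * dirDeriv Z (fun ζ => f q.1 ζ + ε * B0 q.1 ζ) (C q.1) q.2) 0 := by
    refine EventuallyEq.deriv_eq ?_
    filter_upwards [q3, q4, q5] with ε k3 k4 k5
    refine k3.trans (k4.trans ?_)
    simpa using k5 1 ε
  rw [e1, e2, e3]
  have f1 := q6.fderiv_apply_real.differentiableAt
  have f2 := q7.fderiv_apply_real.differentiableAt.hasDerivAt
  -- Differentiating `DZ(f + ε B0)(A) + ε DZ(f + ε B0)(C)` at `ε = 0` gives the Hessian in the order
  -- `(B0, A)` plus `DZ(f)(C)`; symmetry of the Hessian restores the stated order.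
  have f3 := f1.hasDerivAt.add ((Complex.ofRealCLM.hasDerivAt (x := 0)).mul f2)
  refine (HasDerivAt.deriv f3).trans ?_
  simp only [Complex.ofRealCLM_apply, Complex.ofReal_one, Complex.ofReal_zero, zero_mul, add_zero,
    one_mul]
  rw [q8]
  rfl

end Families

/-! ### The algebra behind the canonical connection -/

section Algebra

variable {A : Type*} [CommRing A]

/-- The Lie bracket of a commutative ring with a derivation. -/
def wronskian (dz : A →+ A) (a b : A) : A := dz a * b - dz b * a

theorem derivation_one {δ : A →+ A} (hδ : ∀ a b, δ (a * b) = δ a * b + a * δ b) : δ 1 = 0 := by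
  simpa using hδ 1 1

theorem derivation_half {δ : A →+ A} (hδ : ∀ a b, δ (a * b) = δ a * b + a * δ b) {h : A}
    (h2 : 2 * h = 1) : δ h = 0 := by
  have h1 : δ (h + h) = 0 := by rw [← two_mul, h2, derivation_one hδ]
  rw [map_add] at h1
  linear_combination h * h1 - δ h * h2

theorem derivation_wronskian {dz δ : A →+ A} (hδ : ∀ a b, δ (a * b) = δ a * b + a * δ b)
    (hc : ∀ a, δ (dz a) = dz (δ a)) (a b : A) :
    δ (wronskian dz a b) = wronskian dz (δ a) b + wronskian dz a (δ b) := by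
  simp only [wronskian, map_sub, hδ, hc]
  ring

theorem wronskian_jacobi {dz : A →+ A} (hdz : ∀ a b, dz (a * b) = dz a * b + a * dz b)
    (a b c : A) : wronskian dz a (wronskian dz b c)
      = wronskian dz (wronskian dz a b) c + wronskian dz b (wronskian dz a c) := by
  simp only [wronskian, map_sub, hdz]
  ring

theorem wronskian_add_left (dz : A →+ A) (a b c : A) :
    wronskian dz (a + b) c = wronskian dz a c + wronskian dz b c := by
  simp only [wronskian, map_add]; ring

theorem wronskian_add_right (dz : A →+ A) (a b c : A) :
    wronskian dz a (b + c) = wronskian dz a b + wronskian dz a c := by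
  simp only [wronskian, map_add]; ring

theorem wronskian_mul_left {dz : A →+ A} (hdz : ∀ a b, dz (a * b) = dz a * b + a * dz b) {k : A}
    (hk : dz k = 0) (a b : A) : wronskian dz (k * a) b = k * wronskian dz a b := by
  simp only [wronskian, hdz, hk]; ring

theorem wronskian_mul_right {dz : A →+ A} (hdz : ∀ a b, dz (a * b) = dz a * b + a * dz b) {k : A}
    (hk : dz k = 0) (a b : A) : wronskian dz a (k * b) = k * wronskian dz a b := by
  simp only [wronskian, hdz, hk]; ring

/-! ### Connection and curvature in a commutative ring with derivations -/

variable (dz : A →+ A) (D : A →+ A →+ A) (τ h : A)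

/-- The connection `D x y - (dz x * y + dz y * x) * h * τ`. -/
def algNabla (x y : A) : A := D x y - h * τ * (dz x * y + dz y * x)

/-- The curvature of `algNabla`. -/
def algRiemann (x y z : A) : A :=
  algNabla dz D τ h x (algNabla dz D τ h y z) - algNabla dz D τ h y (algNabla dz D τ h x z)
    - algNabla dz D τ h (D x y - D y x) z

variable {dz D τ h} {σ : A} (hdz : ∀ a b, dz (a * b) = dz a * b + a * dz b)
  (hD : ∀ x a b, D x (a * b) = D x a * b + a * D x b) (hDdz : ∀ x a, D x (dz a) = dz (D x a))
  (hDD : ∀ x y a, D x (D y a) - D y (D x a) = D (D x y - D y x) a) (hσ : ∀ x, D x σ = x)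
  (hτ : τ * dz σ = 1) (h2 : 2 * h = 1)
include hdz hD hDdz hσ hτ h2

/-- In the application `σ` is the field `S ↦ S`, `τ` is `1 / S_z` and `h` is one half.
Differentiating `τ · dz σ = 1` gives `D x τ = -τ² dz x`. After multiplication by `τ`, this turns the
symmetric Christoffel term into the antisymmetric Wronskian bracket. -/
theorem mul_algNabla (x y : A) : τ * algNabla dz D τ h x y
    = D x (τ * y) + h * wronskian dz (τ * x) (τ * y) := by
  have e1 : D x τ = -(τ ^ 2 * dz x) := by
    have := hD x τ (dz σ)
    rw [hτ, derivation_one (hD x), hDdz, hσ] at this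
    linear_combination (-τ) * this - D x τ * hτ
  simp only [algNabla, wronskian, hD, hdz, e1]
  linear_combination (-τ ^ 2 * dz x * y) * h2

include hDD in
-- Write `a, b, c` for `τx, τy, τz`. The commutator of `x` and `y` corresponds to `D x b - D y a +
-- [a, b]` (`eb`). The terms with second derivatives cancel by flatness `hDD`, and those with one
-- derivative by the product rule for the bracket. What remains is `¼ ([a, [b, c]] - [b, [a, c]]) -
-- ½ [[a, b], c]`, which the Jacobi identity makes `-¼ [[a, b], c]`.
theorem mul_algRiemann (x y z : A) : τ * algRiemann dz D τ h x y z
    = -h ^ 2 * wronskian dz (wronskian dz (τ * x) (τ * y)) (τ * z) := by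
  have N := mul_algNabla hdz hD hDdz hσ hτ h2
  have hh : dz h = 0 := derivation_half hdz h2
  have hDh : ∀ x, D x h = 0 := fun x => derivation_half (hD x) h2
  have eb : τ * (D x y - D y x) = D x (τ * y) - D y (τ * x) + wronskian dz (τ * x) (τ * y) := by
    have a1 := N x y
    have a2 := N y x
    have a3 : wronskian dz (τ * y) (τ * x) = - wronskian dz (τ * x) (τ * y) := by
      simp only [wronskian]; ring
    rw [a3] at a2
    simp only [algNabla] at a1 a2
    linear_combination a1 - a2 + wronskian dz (τ * x) (τ * y) * h2
  have w3 : wronskian dz (D x (τ * y) - D y (τ * x) + wronskian dz (τ * x) (τ * y)) (τ * z)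
      = wronskian dz (D x (τ * y)) (τ * z) - wronskian dz (D y (τ * x)) (τ * z)
        + wronskian dz (wronskian dz (τ * x) (τ * y)) (τ * z) := by
    rw [wronskian_add_left]
    simp only [wronskian, map_sub]; ring
  rw [algRiemann, mul_sub, mul_sub, N x (algNabla dz D τ h y z), N y z,
    N y (algNabla dz D τ h x z), N x z, N _ z, eb, w3, map_add, map_add, hD x h,
    hD y h, hDh, hDh, derivation_wronskian (hD x) (hDdz x), derivation_wronskian (hD y) (hDdz y),
    wronskian_add_right, wronskian_add_right, wronskian_mul_right hdz hh,
    wronskian_mul_right hdz hh]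
  have j := wronskian_jacobi hdz (τ * x) (τ * y) (τ * z)
  linear_combination hDD x y (τ * z) + h ^ 2 * j
    + h * wronskian dz (wronskian dz (τ * x) (τ * y)) (τ * z) * h2

include hDD in
/-- The curvature of `algNabla` is covariantly constant. -/
theorem algNabla_algRiemann (w x y z : A) :
    algNabla dz D τ h w (algRiemann dz D τ h x y z)
      - algRiemann dz D τ h (algNabla dz D τ h w x) y z
      - algRiemann dz D τ h x (algNabla dz D τ h w y) z
      - algRiemann dz D τ h x y (algNabla dz D τ h w z) = 0 := by
  have N := mul_algNabla hdz hD hDdz hσ hτ h2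
  have R := mul_algRiemann hdz hD hDdz hDD hσ hτ h2
  have hh : dz h = 0 := derivation_half hdz h2
  have hDh : D w h = 0 := derivation_half (hD w) h2
  have hk : dz (-h ^ 2) = 0 := by simp [sq, hdz, hh]
  have hDk : D w (-h ^ 2) = 0 := by simp [sq, hD, hDh]
  -- After multiplication by `τ` the covariant derivative is `D w` plus half the bracket with `τw`.
  -- Both are derivations of the bracket, the latter by Jacobi, so they annihilate the triple
  -- bracket that is the curvature.
  have key : τ * (algNabla dz D τ h w (algRiemann dz D τ h x y z)
      - algRiemann dz D τ h (algNabla dz D τ h w x) y z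
      - algRiemann dz D τ h x (algNabla dz D τ h w y) z
      - algRiemann dz D τ h x y (algNabla dz D τ h w z)) = 0 := by
    simp only [mul_sub, N, R]
    rw [hD w (-h ^ 2), hDk, derivation_wronskian (hD w) (hDdz w),
      derivation_wronskian (hD w) (hDdz w), wronskian_mul_right hdz hk]
    simp only [wronskian_add_left, wronskian_add_right, wronskian_mul_left hdz hh,
      wronskian_mul_right hdz hh]
    have j1 := wronskian_jacobi hdz (τ * w) (wronskian dz (τ * x) (τ * y)) (τ * z)
    have j2 := wronskian_jacobi hdz (τ * w) (τ * x) (τ * y)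
    rw [j2, wronskian_add_left] at j1
    linear_combination (-h ^ 3) * j1
  -- The factor `τ` is removed by its inverse `dz σ`.
  linear_combination dz σ * key - (algNabla dz D τ h w (algRiemann dz D τ h x y z)
      - algRiemann dz D τ h (algNabla dz D τ h w x) y z
      - algRiemann dz D τ h x (algNabla dz D τ h w y) z
      - algRiemann dz D τ h x y (algNabla dz D τ h w z)) * hτ

end Algebra

/-! ### Operations on ambient fields -/

section Fields

variable {S₀ : ℂ → ℂ} {Γ : Set ℂ} {W X X' Y Y' Z : (ℂ → ℂ) → ℂ → ℂ}

theorem IsAmbientField.of_smoothAt (hΓ : IsCompact Γ)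
    (h : ∀ (E : Type) [NormedAddCommGroup E] [NormedSpace ℝ E] [FiniteDimensional ℝ E]
      (f : E → ℂ → ℂ) (u₀ : E), IsFamilyThrough S₀ Γ f u₀ → ∀ z ∈ Γ,
        SmoothAt (fun u => X (f u)) (u₀, z)) : IsAmbientField S₀ Γ X :=
  fun E _ _ _ f u₀ h1 h2 => (smoothNear_iff hΓ).2 fun z hz => h E f u₀ ⟨h1, h2⟩ z hz

theorem IsAmbientField.smoothAt {E : Type} [NormedAddCommGroup E] [NormedSpace ℝ E]
    [FiniteDimensional ℝ E] {f : E → ℂ → ℂ} {u₀ : E} {z : ℂ} (hX : IsAmbientField S₀ Γ X)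
    (hf : IsFamilyThrough S₀ Γ f u₀) (hz : z ∈ Γ) : SmoothAt (fun u => X (f u)) (u₀, z) :=
  (hX.smoothNear hf).smoothAt hz

theorem IsAmbientField.const (hΓ : IsCompact Γ) (c : ℂ) : IsAmbientField S₀ Γ fun _ _ => c :=
  .of_smoothAt hΓ fun _ _ _ _ _ _ _ _ _ => SmoothAt.const c

theorem IsAmbientField.id (hΓ : IsCompact Γ) : IsAmbientField S₀ Γ fun S z => S z :=
  .of_smoothAt hΓ fun _ _ _ _ _ _ hf _ hz => hf.1.smoothAt hz

theorem IsAmbientField.add (hΓ : IsCompact Γ) (hX : IsAmbientField S₀ Γ X)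
    (hY : IsAmbientField S₀ Γ Y) : IsAmbientField S₀ Γ fun S z => X S z + Y S z :=
  .of_smoothAt hΓ fun _ _ _ _ _ _ hf _ hz => (hX.smoothAt hf hz).add (hY.smoothAt hf hz)

theorem IsAmbientField.sub (hΓ : IsCompact Γ) (hX : IsAmbientField S₀ Γ X)
    (hY : IsAmbientField S₀ Γ Y) : IsAmbientField S₀ Γ fun S z => X S z - Y S z :=
  .of_smoothAt hΓ fun _ _ _ _ _ _ hf _ hz => (hX.smoothAt hf hz).sub (hY.smoothAt hf hz)

theorem IsAmbientField.mul (hΓ : IsCompact Γ) (hX : IsAmbientField S₀ Γ X)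
    (hY : IsAmbientField S₀ Γ Y) : IsAmbientField S₀ Γ fun S z => X S z * Y S z :=
  .of_smoothAt hΓ fun _ _ _ _ _ _ hf _ hz => (hX.smoothAt hf hz).mul (hY.smoothAt hf hz)

theorem IsAmbientField.neg (hΓ : IsCompact Γ) (hX : IsAmbientField S₀ Γ X) :
    IsAmbientField S₀ Γ fun S z => -X S z :=
  .of_smoothAt hΓ fun _ _ _ _ _ _ hf _ hz => (hX.smoothAt hf hz).neg

theorem IsAmbientField.deriv (hΓ : IsCompact Γ) (hX : IsAmbientField S₀ Γ X) :
    IsAmbientField S₀ Γ fun S => deriv (X S) :=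
  .of_smoothAt hΓ fun _ _ _ _ _ _ hf _ hz => (hX.smoothAt hf hz).deriv_snd

theorem IsFamilyThrough.deriv_eq {E : Type} [NormedAddCommGroup E] [NormedSpace ℝ E]
    {f : E → ℂ → ℂ} {u₀ : E} (hf : IsFamilyThrough S₀ Γ f u₀) {z : ℂ} (hz : z ∈ Γ) :
    _root_.deriv (f u₀) z = _root_.deriv S₀ z :=
  (hf.2.filter_mono (nhds_le_nhdsSet hz)).deriv_eq

theorem IsAmbientField.inv_deriv (hΓ : IsCompact Γ) (h0 : ∀ z ∈ Γ, _root_.deriv S₀ z ≠ 0) :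
    IsAmbientField S₀ Γ fun S z => (_root_.deriv S z)⁻¹ :=
  .of_smoothAt hΓ fun _ _ _ _ _ _ hf z hz => (hf.1.smoothAt hz).deriv_snd.inv
    (by rw [hf.deriv_eq hz]; exact h0 z hz)

theorem IsAmbientField.ambientNabla (hΓ : IsCompact Γ) (hX : IsAmbientField S₀ Γ X)
    (hY : IsAmbientField S₀ Γ Y) : IsAmbientField S₀ Γ (ambientNabla X Y) :=
  fun _ _ _ _ _ _ h1 h2 => hY.smoothNear_dirDeriv hΓ ⟨h1, h2⟩ (hX.smoothNear ⟨h1, h2⟩)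

theorem IsAmbientField.bracket (hΓ : IsCompact Γ) (hX : IsAmbientField S₀ Γ X)
    (hY : IsAmbientField S₀ Γ Y) : IsAmbientField S₀ Γ (bracket X Y) :=
  (hX.ambientNabla hΓ hY).sub hΓ (hY.ambientNabla hΓ hX)

/-- Separates the constant `1 / 2` from the field `1 / S_z`, as in `algNabla`. -/
theorem nabla_eq (X Y : (ℂ → ℂ) → ℂ → ℂ) : nabla X Y = fun S z => ambientNabla X Y S z
    - (1 / 2) * (_root_.deriv S z)⁻¹ *
      (_root_.deriv (X S) z * Y S z + _root_.deriv (Y S) z * X S z) := by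
  ext S z
  simp only [nabla, one_div, mul_inv]

theorem IsAmbientField.nabla (hΓ : IsCompact Γ) (h0 : ∀ z ∈ Γ, _root_.deriv S₀ z ≠ 0)
    (hX : IsAmbientField S₀ Γ X) (hY : IsAmbientField S₀ Γ Y) : IsAmbientField S₀ Γ (nabla X Y) := by
  rw [nabla_eq]
  exact (hX.ambientNabla hΓ hY).sub hΓ (((IsAmbientField.const hΓ _).mul hΓ
    (IsAmbientField.inv_deriv hΓ h0)).mul hΓ
    (((hX.deriv hΓ).mul hΓ hY).add hΓ ((hY.deriv hΓ).mul hΓ hX)))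

/-! ### Fields with equal germs -/

/-- The fields `X`, `Y` agree along all families through `S₀`. -/
def FieldEq (S₀ : ℂ → ℂ) (Γ : Set ℂ) (X Y : (ℂ → ℂ) → ℂ → ℂ) : Prop :=
  ∀ (E : Type) [NormedAddCommGroup E] [NormedSpace ℝ E] [FiniteDimensional ℝ E]
    (f : E → ℂ → ℂ) (u₀ : E), IsFamilyThrough S₀ Γ f u₀ →
      ∀ᶠ q in 𝓝 u₀ ×ˢ 𝓝ˢ Γ, X (f q.1) q.2 = Y (f q.1) q.2

theorem FieldEq.refl (X : (ℂ → ℂ) → ℂ → ℂ) : FieldEq S₀ Γ X X :=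
  fun _ _ _ _ _ _ _ => .of_forall fun _ => rfl

theorem FieldEq.deriv (hΓ : IsCompact Γ) (h : FieldEq S₀ Γ X Y) :
    FieldEq S₀ Γ (fun S => deriv (X S)) (fun S => deriv (Y S)) := by
  intro E _ _ _ f u₀ hf
  filter_upwards [eventually_nhds_of_near hΓ (h E f u₀ hf)] with q hq
  exact EventuallyEq.deriv_eq ((tendsto_prodMk_right q).eventually hq)

/-- Makes the ambient derivative well defined on germs. Agreement along all families suffices,
because it may be applied to the enlarged family `f + r X'(f)` and then differentiated in `r`. -/
theorem FieldEq.ambientNabla (hΓ : IsCompact Γ) (hX : IsAmbientField S₀ Γ X)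
    (hY : IsAmbientField S₀ Γ Y) (hXX' : FieldEq S₀ Γ X X') (hYY' : FieldEq S₀ Γ Y Y') :
    FieldEq S₀ Γ (ambientNabla X Y) (ambientNabla X' Y') := by
  intro E _ _ _ f u₀ hf
  have h1 := hY.dirDeriv_congr (B := fun u => X' (f u)) hΓ hf (hX.smoothNear hf)
    (.of_forall fun _ => rfl) (hXX' E f u₀ hf)
  have hX'f := (hX.smoothNear hf).congr (g := fun u => X' (f u)) hΓ (hXX' E f u₀ hf)
  have h2 := near_param hΓ (hYY' _ _ _ (hf.line hΓ hX'f))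
  filter_upwards [h1, h2] with q h1 h2
  exact h1.trans (EventuallyEq.deriv_eq h2)

theorem ambientNabla_add_left (hΓ : IsCompact Γ) (hX : IsAmbientField S₀ Γ X)
    (hX' : IsAmbientField S₀ Γ X') (hY : IsAmbientField S₀ Γ Y) :
    FieldEq S₀ Γ (ambientNabla (fun S z => X S z + X' S z) Y)
      (fun S z => ambientNabla X Y S z + ambientNabla X' Y S z) := by
  intro E _ _ _ f u₀ hf
  filter_upwards [hY.dirDeriv_add hΓ hf (hX.smoothNear hf) (hX'.smoothNear hf)] with q hq
  have := hq 1 1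
  simp only [Complex.ofReal_one, one_mul] at this
  exact this

theorem IsAmbientField.hasDerivAt_line (hΓ : IsCompact Γ) (hX : IsAmbientField S₀ Γ X)
    (hY : IsAmbientField S₀ Γ Y) {E : Type} [NormedAddCommGroup E] [NormedSpace ℝ E]
    [FiniteDimensional ℝ E] {f : E → ℂ → ℂ} {u₀ : E} (hf : IsFamilyThrough S₀ Γ f u₀) :
    ∀ᶠ q in 𝓝 u₀ ×ˢ 𝓝ˢ Γ, HasDerivAt (fun r : ℝ => Y (fun ζ => f q.1 ζ + r * X (f q.1) ζ) q.2)
      (SchwarzReflection.ambientNabla X Y (f q.1) q.2) 0 := by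
  have h1 := near_reparam (ρ := fun u : E => (u, (0:ℝ))) (v₀ := u₀) (by fun_prop)
    ((hY.smoothNear (hf.line hΓ (hX.smoothNear hf))).eventually hΓ)
  filter_upwards [h1] with q hq
  exact hq.fderiv_apply_real.differentiableAt.hasDerivAt

theorem ambientNabla_add_right (hΓ : IsCompact Γ) (hX : IsAmbientField S₀ Γ X)
    (hY : IsAmbientField S₀ Γ Y) (hY' : IsAmbientField S₀ Γ Y') :
    FieldEq S₀ Γ (ambientNabla X fun S z => Y S z + Y' S z)
      (fun S z => ambientNabla X Y S z + ambientNabla X Y' S z) := by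
  intro E _ _ _ f u₀ hf
  filter_upwards [hX.hasDerivAt_line hΓ hY hf, hX.hasDerivAt_line hΓ hY' hf] with q h1 h2
  exact (h1.add h2).deriv

theorem ambientNabla_mul (hΓ : IsCompact Γ) (hX : IsAmbientField S₀ Γ X)
    (hY : IsAmbientField S₀ Γ Y) (hY' : IsAmbientField S₀ Γ Y') :
    FieldEq S₀ Γ (ambientNabla X fun S z => Y S z * Y' S z)
      (fun S z => ambientNabla X Y S z * Y' S z + Y S z * ambientNabla X Y' S z) := by
  intro E _ _ _ f u₀ hf
  filter_upwards [hX.hasDerivAt_line hΓ hY hf, hX.hasDerivAt_line hΓ hY' hf] with q h1 h2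
  refine (h1.mul h2).deriv.trans ?_
  simp

theorem ambientNabla_id (X : (ℂ → ℂ) → ℂ → ℂ) : ambientNabla X (fun S z => S z) = X := by
  ext S z
  have : HasDerivAt (fun r : ℝ => S z + r * X S z) (1 * X S z) 0 :=
    ((Complex.ofRealCLM.hasDerivAt (x := 0)).mul_const (X S z)).const_add (S z)
  rw [one_mul] at this
  exact this.deriv

theorem SmoothAt.deriv_real_deriv {E : Type} [NormedAddCommGroup E] [NormedSpace ℝ E]
    {f : E × ℝ → ℂ → ℂ} {u : E} {t : ℝ} {z : ℂ} (h : SmoothAt f ((u, t), z)) :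
    _root_.deriv (fun s : ℝ => _root_.deriv (f (u, s)) z) t
      = _root_.deriv (fun ζ => _root_.deriv (fun s : ℝ => f (u, s) ζ) t) z :=
  (SmoothAt.hasDerivAt_deriv (c := fun s => f (u, s))
    (SmoothAt.reparam (ρ := fun s : ℝ => (u, s)) h (by fun_prop))).deriv

theorem ambientNabla_deriv (hΓ : IsCompact Γ) (hX : IsAmbientField S₀ Γ X)
    (hY : IsAmbientField S₀ Γ Y) :
    FieldEq S₀ Γ (ambientNabla X fun S => deriv (Y S)) (fun S => deriv (ambientNabla X Y S)) := by
  intro E _ _ _ f u₀ hf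
  have h1 := near_reparam (ρ := fun u : E => (u, (0:ℝ))) (v₀ := u₀) (by fun_prop)
    ((hY.smoothNear (hf.line hΓ (hX.smoothNear hf))).eventually hΓ)
  filter_upwards [h1] with q hq
  exact hq.deriv_real_deriv

/-- The second-order chain rule for `g_r + t Y(g_r)` with `g_r = f + r X(f)`: its first derivatives
are `X` and `Y`, and its mixed derivative is the ambient derivative of `Y` along `X`. -/
theorem ambientNabla_comm_eq (hΓ : IsCompact Γ) (hX : IsAmbientField S₀ Γ X)
    (hY : IsAmbientField S₀ Γ Y) (hZ : IsAmbientField S₀ Γ Z) :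
    FieldEq S₀ Γ (ambientNabla X (ambientNabla Y Z)) (fun S z =>
      dirDeriv₂ Z S (X S) (Y S) z + dirDeriv Z S (ambientNabla X Y S) z) := by
  intro E _ _ _ f u₀ hf
  have hl := hf.line hΓ (hX.smoothNear hf)
  have h := hZ.deriv_deriv_comp hΓ (hl.line hΓ (hY.smoothNear hl))
  filter_upwards [h] with q hq
  refine hq.trans ?_
  have lin : ∀ (a b : ℂ), _root_.deriv (fun t : ℝ => a + t * b) 0 = b := by
    intro a b
    have : HasDerivAt (fun r : ℝ => a + r * b) (1 * b) 0 :=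
      ((Complex.ofRealCLM.hasDerivAt (x := 0)).mul_const b).const_add a
    simpa using this.deriv
  simp only [Complex.ofReal_zero, zero_mul, add_zero, lin]
  rfl

/-- Flatness of the ambient derivative: the Hessian terms cancel by symmetry, and linearity in the
direction combines the remaining ones. -/
theorem ambientNabla_comm (hΓ : IsCompact Γ) (hX : IsAmbientField S₀ Γ X)
    (hY : IsAmbientField S₀ Γ Y) (hZ : IsAmbientField S₀ Γ Z) :
    FieldEq S₀ Γ (fun S z => ambientNabla X (ambientNabla Y Z) S z
      - ambientNabla Y (ambientNabla X Z) S z) (ambientNabla (bracket X Y) Z) := by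
  intro E _ _ _ f u₀ hf
  have hb := hZ.dirDeriv_add hΓ hf ((hX.ambientNabla hΓ hY).smoothNear hf)
    ((hY.ambientNabla hΓ hX).smoothNear hf)
  filter_upwards [ambientNabla_comm_eq hΓ hX hY hZ E f u₀ hf,
    ambientNabla_comm_eq hΓ hY hX hZ E f u₀ hf, hb,
    hZ.dirDeriv₂_comm hΓ hf (hX.smoothNear hf) (hY.smoothNear hf)] with q h1 h2 h3 h4
  have h5 := h3 1 (-1)
  simp only [Complex.ofReal_one, one_mul, Complex.ofReal_neg, neg_mul, ← sub_eq_add_neg] at h5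
  rw [h1, h2, h4]
  refine Eq.trans ?_ h5.symm
  ring

/-! ### The ring of germs of ambient fields -/

variable (S₀) in
/-- The ring of ambient fields. -/
def fieldRing (hΓ : IsCompact Γ) : Subring ((ℂ → ℂ) → ℂ → ℂ) where
  carrier := {X | IsAmbientField S₀ Γ X}
  mul_mem' h1 h2 := h1.mul hΓ h2
  one_mem' := IsAmbientField.const hΓ 1
  add_mem' h1 h2 := h1.add hΓ h2
  zero_mem' := IsAmbientField.const hΓ 0
  neg_mem' h := h.neg hΓ

variable (S₀) in
/-- The ideal of fields with vanishing germ. -/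
def fieldIdeal (hΓ : IsCompact Γ) : Ideal (fieldRing S₀ hΓ) where
  carrier := {X | FieldEq S₀ Γ X 0}
  add_mem' := by
    intro a b ha hb E _ _ _ f u₀ hf
    filter_upwards [ha E f u₀ hf, hb E f u₀ hf] with q h1 h2
    simp_all
  zero_mem' := FieldEq.refl _
  smul_mem' := by
    intro c x hx E _ _ _ f u₀ hf
    filter_upwards [hx E f u₀ hf] with q h1
    simp_all

variable (S₀) in
/-- The ring of germs of ambient fields. -/
abbrev FieldGerm (hΓ : IsCompact Γ) : Type := fieldRing S₀ hΓ ⧸ fieldIdeal S₀ hΓ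

/-- The germ of an ambient field. -/
def fieldGerm (hΓ : IsCompact Γ) (hX : IsAmbientField S₀ Γ X) : FieldGerm S₀ hΓ :=
  Ideal.Quotient.mk _ ⟨X, hX⟩

theorem fieldGerm_eq_iff (hΓ : IsCompact Γ) (hX : IsAmbientField S₀ Γ X)
    (hY : IsAmbientField S₀ Γ Y) : fieldGerm hΓ hX = fieldGerm hΓ hY ↔ FieldEq S₀ Γ X Y := by
  rw [fieldGerm, fieldGerm, Ideal.Quotient.eq]
  constructor
  · intro h E _ _ _ f u₀ hf
    filter_upwards [h E f u₀ hf] with q hq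
    exact sub_eq_zero.1 hq
  · intro h E _ _ _ f u₀ hf
    filter_upwards [h E f u₀ hf] with q hq
    exact sub_eq_zero.2 hq

theorem exists_fieldGerm (hΓ : IsCompact Γ) (a : FieldGerm S₀ hΓ) :
    ∃ (X : (ℂ → ℂ) → ℂ → ℂ) (hX : IsAmbientField S₀ Γ X), fieldGerm hΓ hX = a := by
  obtain ⟨⟨X, hX⟩, h⟩ := Ideal.Quotient.mk_surjective a
  exact ⟨X, hX, h⟩

theorem fieldGerm_add (hΓ : IsCompact Γ) (hX : IsAmbientField S₀ Γ X)
    (hY : IsAmbientField S₀ Γ Y) :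
    fieldGerm hΓ (hX.add hΓ hY) = fieldGerm hΓ hX + fieldGerm hΓ hY := rfl

theorem fieldGerm_sub (hΓ : IsCompact Γ) (hX : IsAmbientField S₀ Γ X)
    (hY : IsAmbientField S₀ Γ Y) :
    fieldGerm hΓ (hX.sub hΓ hY) = fieldGerm hΓ hX - fieldGerm hΓ hY := rfl

theorem fieldGerm_mul (hΓ : IsCompact Γ) (hX : IsAmbientField S₀ Γ X)
    (hY : IsAmbientField S₀ Γ Y) :
    fieldGerm hΓ (hX.mul hΓ hY) = fieldGerm hΓ hX * fieldGerm hΓ hY := rfl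

/-- The operator is defined on chosen representatives; `FieldEq.deriv` makes the choice irrelevant.
Passing to germs is what makes it additive, since additivity holds only where the fields are
differentiable. -/
theorem exists_germ_deriv (hΓ : IsCompact Γ) : ∃ dz : FieldGerm S₀ hΓ →+ FieldGerm S₀ hΓ,
    ∀ (X) (hX : IsAmbientField S₀ Γ X), dz (fieldGerm hΓ hX) = fieldGerm hΓ (hX.deriv hΓ) := by
  choose rep hrep hrep' using exists_fieldGerm (S₀ := S₀) hΓ
  have key : ∀ (X) (hX : IsAmbientField S₀ Γ X),
      fieldGerm hΓ ((hrep (fieldGerm hΓ hX)).deriv hΓ) = fieldGerm hΓ (hX.deriv hΓ) := fun X hX =>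
    (fieldGerm_eq_iff hΓ _ _).2 (((fieldGerm_eq_iff hΓ _ _).1 (hrep' _)).deriv hΓ)
  refine ⟨AddMonoidHom.mk' (fun a => fieldGerm hΓ ((hrep a).deriv hΓ)) ?_, key⟩
  intro a b
  obtain ⟨X, hX, rfl⟩ := exists_fieldGerm hΓ a
  obtain ⟨Y, hY, rfl⟩ := exists_fieldGerm hΓ b
  rw [← fieldGerm_add, key, key, key, ← fieldGerm_add, fieldGerm_eq_iff]
  intro E _ _ _ f u₀ hf
  filter_upwards [(hX.smoothNear hf).eventually hΓ, (hY.smoothNear hf).eventually hΓ] with q h1 h2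
  exact deriv_fun_add h1.differentiableAt h2.differentiableAt

theorem exists_germ_ambientNabla (hΓ : IsCompact Γ) :
    ∃ D : FieldGerm S₀ hΓ →+ FieldGerm S₀ hΓ →+ FieldGerm S₀ hΓ,
    ∀ (X Y) (hX : IsAmbientField S₀ Γ X) (hY : IsAmbientField S₀ Γ Y),
      D (fieldGerm hΓ hX) (fieldGerm hΓ hY) = fieldGerm hΓ (hX.ambientNabla hΓ hY) := by
  choose rep hrep hrep' using exists_fieldGerm (S₀ := S₀) hΓ
  have key : ∀ (X Y) (hX : IsAmbientField S₀ Γ X) (hY : IsAmbientField S₀ Γ Y),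
      fieldGerm hΓ ((hrep (fieldGerm hΓ hX)).ambientNabla hΓ (hrep (fieldGerm hΓ hY)))
        = fieldGerm hΓ (hX.ambientNabla hΓ hY) := fun X Y hX hY =>
    (fieldGerm_eq_iff hΓ _ _).2 (FieldEq.ambientNabla hΓ (hrep _) (hrep _)
      ((fieldGerm_eq_iff hΓ _ hX).1 (hrep' _)) ((fieldGerm_eq_iff hΓ _ hY).1 (hrep' _)))
  refine ⟨AddMonoidHom.mk' (fun a => AddMonoidHom.mk'
    (fun b => fieldGerm hΓ ((hrep a).ambientNabla hΓ (hrep b))) ?_) ?_, key⟩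
  · intro b c
    obtain ⟨X, hX, rfl⟩ := exists_fieldGerm hΓ a
    obtain ⟨Y, hY, rfl⟩ := exists_fieldGerm hΓ b
    obtain ⟨Z, hZ, rfl⟩ := exists_fieldGerm hΓ c
    rw [← fieldGerm_add, key, key, key, ← fieldGerm_add, fieldGerm_eq_iff]
    exact ambientNabla_add_right hΓ hX hY hZ
  · intro a b
    ext c
    obtain ⟨X, hX, rfl⟩ := exists_fieldGerm hΓ a
    obtain ⟨Y, hY, rfl⟩ := exists_fieldGerm hΓ b
    obtain ⟨Z, hZ, rfl⟩ := exists_fieldGerm hΓ c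
    simp only [AddMonoidHom.mk'_apply, AddMonoidHom.add_apply]
    rw [← fieldGerm_add, key, key, key, ← fieldGerm_add, fieldGerm_eq_iff]
    exact ambientNabla_add_left hΓ hX hY hZ

theorem IsAmbientField.riemann (hΓ : IsCompact Γ) (h0 : ∀ z ∈ Γ, _root_.deriv S₀ z ≠ 0)
    (hX : IsAmbientField S₀ Γ X) (hY : IsAmbientField S₀ Γ Y) (hZ : IsAmbientField S₀ Γ Z) :
    IsAmbientField S₀ Γ (riemann X Y Z) :=
  ((hX.nabla hΓ h0 (hY.nabla hΓ h0 hZ)).sub hΓ (hY.nabla hΓ h0 (hX.nabla hΓ h0 hZ))).sub hΓ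
    ((hX.bracket hΓ hY).nabla hΓ h0 hZ)

theorem IsAmbientField.nablaRiemann (hΓ : IsCompact Γ) (h0 : ∀ z ∈ Γ, _root_.deriv S₀ z ≠ 0)
    (hW : IsAmbientField S₀ Γ W)
    (hX : IsAmbientField S₀ Γ X) (hY : IsAmbientField S₀ Γ Y) (hZ : IsAmbientField S₀ Γ Z) :
    IsAmbientField S₀ Γ (nablaRiemann W X Y Z) :=
  (((hW.nabla hΓ h0 (hX.riemann hΓ h0 hY hZ)).sub hΓ
    ((hW.nabla hΓ h0 hX).riemann hΓ h0 hY hZ)).sub hΓ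
    (hX.riemann hΓ h0 (hW.nabla hΓ h0 hY) hZ)).sub hΓ
    (hX.riemann hΓ h0 hY (hW.nabla hΓ h0 hZ))

/-- The Riemann tensor is covariantly constant. -/
theorem nablaRiemann_fieldEq_zero (hΓ : IsCompact Γ) (h0 : ∀ z ∈ Γ, deriv S₀ z ≠ 0)
    (hW : IsAmbientField S₀ Γ W) (hX : IsAmbientField S₀ Γ X) (hY : IsAmbientField S₀ Γ Y)
    (hZ : IsAmbientField S₀ Γ Z) : FieldEq S₀ Γ (nablaRiemann W X Y Z) 0 := by
  obtain ⟨dz, hdz⟩ := exists_germ_deriv (S₀ := S₀) hΓ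
  obtain ⟨D, hD⟩ := exists_germ_ambientNabla (S₀ := S₀) hΓ
  -- The germs of `S ↦ S`, `1 / S_z` and `1 / 2` fill the roles of `σ`, `τ` and `h` in the abstract
  -- computation.
  set σ := fieldGerm hΓ (IsAmbientField.id (S₀ := S₀) hΓ)
  set τ := fieldGerm hΓ (IsAmbientField.inv_deriv hΓ h0)
  set k := fieldGerm hΓ (IsAmbientField.const (S₀ := S₀) hΓ (1 / 2))
  have hN : ∀ (X Y) (hX : IsAmbientField S₀ Γ X) (hY : IsAmbientField S₀ Γ Y),
      fieldGerm hΓ (hX.nabla hΓ h0 hY) = algNabla dz D τ k (fieldGerm hΓ hX) (fieldGerm hΓ hY) := by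
    intro X Y hX hY
    rw [algNabla, hD, hdz, hdz]
    simp only [nabla_eq]
    rfl
  have hR : ∀ (X Y Z) (hX : IsAmbientField S₀ Γ X) (hY : IsAmbientField S₀ Γ Y)
      (hZ : IsAmbientField S₀ Γ Z), fieldGerm hΓ (hX.riemann hΓ h0 hY hZ)
        = algRiemann dz D τ k (fieldGerm hΓ hX) (fieldGerm hΓ hY) (fieldGerm hΓ hZ) := by
    intro X Y Z hX hY hZ
    rw [algRiemann, hD, hD, ← hN, ← hN, ← hN, ← hN, ← fieldGerm_sub, ← fieldGerm_sub]
    erw [← hN]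
    rfl
  have key : fieldGerm hΓ (hW.nablaRiemann hΓ h0 hX hY hZ) = 0 := by
    rw [← algNabla_algRiemann (dz := dz) (D := D) (τ := τ) (h := k) (σ := σ) ?_ ?_ ?_ ?_ ?_ ?_ ?_
      (fieldGerm hΓ hW) (fieldGerm hΓ hX) (fieldGerm hΓ hY) (fieldGerm hΓ hZ), ← hR, ← hN, ← hN,
      ← hN, ← hN, ← hR, ← hR, ← hR]
    · rfl
    · intro a b
      obtain ⟨X, hX, rfl⟩ := exists_fieldGerm hΓ a
      obtain ⟨Y, hY, rfl⟩ := exists_fieldGerm hΓ b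
      rw [← fieldGerm_mul, hdz, hdz, hdz, ← fieldGerm_mul, ← fieldGerm_mul, ← fieldGerm_add,
        fieldGerm_eq_iff]
      intro E _ _ _ f u₀ hf
      filter_upwards [(hX.smoothNear hf).eventually hΓ, (hY.smoothNear hf).eventually hΓ]
        with q h1 h2
      exact deriv_fun_mul h1.differentiableAt h2.differentiableAt
    · intro x a b
      obtain ⟨W, hW, rfl⟩ := exists_fieldGerm hΓ x
      obtain ⟨X, hX, rfl⟩ := exists_fieldGerm hΓ a
      obtain ⟨Y, hY, rfl⟩ := exists_fieldGerm hΓ b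
      rw [← fieldGerm_mul, hD, hD, hD, ← fieldGerm_mul, ← fieldGerm_mul, ← fieldGerm_add,
        fieldGerm_eq_iff]
      exact ambientNabla_mul hΓ hW hX hY
    · intro x a
      obtain ⟨W, hW, rfl⟩ := exists_fieldGerm hΓ x
      obtain ⟨X, hX, rfl⟩ := exists_fieldGerm hΓ a
      rw [hdz, hD, hD, hdz, fieldGerm_eq_iff]
      exact ambientNabla_deriv hΓ hW hX
    · intro x y a
      obtain ⟨W, hW, rfl⟩ := exists_fieldGerm hΓ x
      obtain ⟨X, hX, rfl⟩ := exists_fieldGerm hΓ y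
      obtain ⟨Y, hY, rfl⟩ := exists_fieldGerm hΓ a
      rw [hD, hD, hD, hD, hD, hD, ← fieldGerm_sub, ← fieldGerm_sub, hD, fieldGerm_eq_iff]
      exact ambientNabla_comm hΓ hW hX hY
    · intro x
      obtain ⟨X, hX, rfl⟩ := exists_fieldGerm hΓ x
      rw [hD, fieldGerm_eq_iff, ambientNabla_id]
      exact FieldEq.refl _
    · rw [hdz, ← fieldGerm_mul]
      refine (fieldGerm_eq_iff hΓ _ (IsAmbientField.const hΓ 1)).2 ?_
      intro E _ _ _ f u₀ hf
      have : ∀ᶠ q in 𝓝 u₀ ×ˢ 𝓝ˢ Γ, deriv (f q.1) q.2 ≠ 0 :=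
        (eventually_prod_nhdsSet_iff hΓ).2 fun z hz =>
          (hf.1.smoothAt hz).deriv_snd.eventually_ne (by rw [hf.deriv_eq hz]; exact h0 z hz)
      filter_upwards [this] with q hq
      exact inv_mul_cancel₀ hq
    · have : (2 : FieldGerm S₀ hΓ) = fieldGerm hΓ (IsAmbientField.const (S₀ := S₀) hΓ 2) := rfl
      rw [this, ← fieldGerm_mul]
      refine (fieldGerm_eq_iff hΓ _ (IsAmbientField.const hΓ 1)).2 ?_
      intro E _ _ _ f u₀ hf
      exact .of_forall fun _ => by norm_num
  exact (fieldGerm_eq_iff hΓ _ (IsAmbientField.const hΓ 0)).1 key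

end Fields

/-! ### Schwarz functions and their families -/

section SchwarzFamilies

variable {E : Type} [NormedAddCommGroup E] [NormedSpace ℝ E]
  {E' : Type} [NormedAddCommGroup E'] [NormedSpace ℝ E']
  {S₀ : ℂ → ℂ} {Γ : Set ℂ}

theorem IsSchwarzFunction.apply_eq {S : ℂ → ℂ} (h : IsSchwarzFunction S Γ) {z : ℂ} (hz : z ∈ Γ) :
    S z = conj z := by
  obtain ⟨γ, x₀, -, h1, -, h3⟩ := h.2 z hz
  have := h3.self_of_nhds
  rwa [h1] at this

theorem IsSchwarzFunction.eventually_differentiableAt {S : ℂ → ℂ} (h : IsSchwarzFunction S Γ) :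
    ∀ᶠ z in 𝓝ˢ Γ, DifferentiableAt ℂ S z := by
  obtain ⟨U, hU, hΓU, hd⟩ := h.1
  exact eventually_of_mem (hU.mem_nhdsSet.2 hΓU) fun z hz => hd.differentiableAt (hU.mem_nhds hz)

/-- Differentiating `S(γ(x)) = conj γ(x)` along the curve gives `S' γ' = conj γ'`, and `γ'` does not
vanish. -/
theorem IsSchwarzFunction.deriv_ne_zero {S : ℂ → ℂ} (h : IsSchwarzFunction S Γ) {z : ℂ}
    (hz : z ∈ Γ) : deriv S z ≠ 0 := by
  obtain ⟨γ, x₀, h0, h1, h2, h3⟩ := h.2 z hz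
  have hS := (h.eventually_differentiableAt.filter_mono (nhds_le_nhdsSet hz)).self_of_nhds
  have hγ : HasDerivAt (fun x : ℝ => γ x) (deriv γ x₀) x₀ :=
    h0.self_of_nhds.hasDerivAt.comp_ofReal
  rw [← h1] at hS
  have e1 : HasDerivAt (fun x : ℝ => S (γ x)) (deriv S (γ x₀) * deriv γ x₀) x₀ :=
    HasDerivAt.comp_ofReal (e := fun ζ => S (γ ζ))
      (HasDerivAt.comp (x₀ : ℂ) hS.hasDerivAt h0.self_of_nhds.hasDerivAt)
  have e2 : HasDerivAt (fun x : ℝ => conj (γ x)) (conj (deriv γ x₀)) x₀ := hγ.star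
  have e3 := e1.unique (e2.congr_of_eventuallyEq h3)
  intro h0
  rw [h1, h0, zero_mul] at e3
  exact h2 ((map_eq_zero _).1 e3.symm)

theorem IsSchwarzFunction.isSchwarzFamily {S : ℂ → ℂ} (h : IsSchwarzFunction S Γ)
    (hΓ : IsCompact Γ) (u₀ : E) : IsSchwarzFamily (fun _ : E => S) u₀ Γ := by
  refine ⟨(smoothNear_iff hΓ).2 fun z hz => SmoothAt.of_holomorphic
    (h.eventually_differentiableAt.filter_mono (nhds_le_nhdsSet hz)), fun z hz => ?_⟩
  obtain ⟨γ, x₀, h0, h1, h2, h3⟩ := h.2 z hz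
  refine ⟨fun _ => γ, x₀, (smoothNear_iff isCompact_singleton).2 ?_, h1, h2,
    (continuousAt_snd (p := (u₀, x₀))).eventually h3⟩
  rintro _ rfl
  exact SmoothAt.of_holomorphic h0

theorem IsSchwarzFamily.reparam {S : E → ℂ → ℂ} {ρ : E' → E} {v₀ : E'} (hΓ : IsCompact Γ)
    (h : IsSchwarzFamily S (ρ v₀) Γ) (hρ : ContDiff ℝ ∞ ρ) :
    IsSchwarzFamily (fun v => S (ρ v)) v₀ Γ := by
  refine ⟨h.1.reparam hΓ hρ, fun z hz => ?_⟩
  obtain ⟨w, x₀, h0, h1, h2, h3⟩ := h.2 z hz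
  refine ⟨fun v => w (ρ v), x₀, h0.reparam isCompact_singleton hρ, h1, h2, ?_⟩
  have hc : Continuous (fun q : E' × ℝ => (ρ q.1, q.2)) := by
    have := hρ.continuous
    fun_prop
  exact (hc.tendsto (v₀, x₀)).eventually h3

theorem SmoothAt.continuousAt_real {w : E → ℂ → ℂ} {u : E} {x : ℝ}
    (h : SmoothAt w (u, (x : ℂ))) : ContinuousAt (fun q : E × ℝ => w q.1 q.2) (u, x) := by
  have hl : Continuous (fun q : E × ℝ => ((q.1, (q.2 : ℂ)) : E × ℂ)) := by fun_prop
  exact ContinuousAt.comp (x := (u, x)) (g := fun q : E × ℂ => w q.1 q.2) h.continuousAt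
    hl.continuousAt

theorem eventually_ofReal {X : Type*} [TopologicalSpace X] {P : X × ℂ → Prop} {u : X} {x : ℝ} (h : ∀ᶠ q in 𝓝 (u, (x : ℂ)), P q) :
    ∀ᶠ q : X × ℝ in 𝓝 (u, x), P (q.1, (q.2 : ℂ)) := by
  have hl : Continuous (fun q : X × ℝ => ((q.1, (q.2 : ℂ)) : X × ℂ)) := by fun_prop
  exact (hl.tendsto (u, x)).eventually h

theorem eventually_snd_of_prod {X Y : Type*} [TopologicalSpace X] [TopologicalSpace Y]
    {P : X × Y → Prop} {q : X × Y} (h : ∀ᶠ q' in 𝓝 q, P q') : ∀ᶠ y in 𝓝 q.2, P (q.1, y) :=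
  ((Continuous.prodMk_right q.1).tendsto' q.2 q rfl).eventually h

theorem eventually_fst_of_prod {X Y : Type*} [TopologicalSpace X] [TopologicalSpace Y]
    {P : X × Y → Prop} {q : X × Y} (h : ∀ᶠ q' in 𝓝 q, P q') : ∀ᶠ x in 𝓝 q.1, P (x, q.2) :=
  ((Continuous.prodMk_left q.2).tendsto' q.1 q rfl).eventually h

/-- The nearby members of a Schwarz family are Schwarz functions at the points of their curves. -/
theorem eventually_isSchwarzFunction {S w : E → ℂ → ℂ} {u₀ : E} {x₀ : ℝ}
    (hS : SmoothAt S (u₀, w u₀ x₀)) (hw : SmoothAt w (u₀, (x₀ : ℂ))) (hw' : deriv (w u₀) x₀ ≠ 0)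
    (h : ∀ᶠ q : E × ℝ in 𝓝 (u₀, x₀), S q.1 (w q.1 q.2) = conj (w q.1 q.2)) :
    ∀ᶠ q : E × ℝ in 𝓝 (u₀, x₀), IsSchwarzFunction (S q.1) {w q.1 q.2} := by
  have hc : ContinuousAt (fun q : E × ℝ => (q.1, w q.1 q.2)) (u₀, x₀) :=
    continuousAt_fst.prodMk hw.continuousAt_real
  filter_upwards [hc.eventually hS, eventually_ofReal hw.eventually,
    eventually_ofReal (hw.deriv_snd.eventually_ne hw'), h.eventually_nhds,
    hc.eventually hS.eventually] with q h1 h2 h3 h4 h5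
  constructor
  · have : ∀ᶠ z in 𝓝 (w q.1 q.2), DifferentiableAt ℂ (S q.1) z :=
      (eventually_snd_of_prod h5.eventually).mono fun z hz => hz.differentiableAt
    obtain ⟨U, hUd, hU, hm⟩ := eventually_nhds_iff.1 this
    exact ⟨U, hU, singleton_subset_iff.2 hm, fun z hz => (hUd z hz).differentiableWithinAt⟩
  · rintro _ rfl
    refine ⟨w q.1, q.2, ?_, rfl, h3, eventually_snd_of_prod h4⟩
    exact (eventually_snd_of_prod h2.eventually).mono fun z hz => hz.differentiableAt

theorem IsSchwarzFamily.isSchwarzFunction {S : E → ℂ → ℂ} {u₀ : E} (h : IsSchwarzFamily S u₀ Γ) :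
    IsSchwarzFunction (S u₀) Γ := by
  constructor
  · obtain ⟨O, U, hO, hu, hU, hΓU, -, hd⟩ := h.1
    exact ⟨U, hU, hΓU, hd u₀ hu⟩
  · intro z hz
    obtain ⟨w, x₀, h0, rfl, h2, h3⟩ := h.2 z hz
    have := eventually_isSchwarzFunction (h.1.smoothAt hz) (h0.smoothAt rfl) h2 h3
    exact this.self_of_nhds.2 _ rfl

/-- Identity theorem with parameters: a family of holomorphic functions that vanishes on a family of
curves vanishes identically. -/
theorem eventually_eq_zero_of_curve {G w : E → ℂ → ℂ} {u₀ : E} {x₀ : ℝ}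
    (hG : SmoothAt G (u₀, w u₀ x₀)) (hw : SmoothAt w (u₀, (x₀ : ℂ))) (hw' : deriv (w u₀) x₀ ≠ 0)
    (h : ∀ᶠ q : E × ℝ in 𝓝 (u₀, x₀), G q.1 (w q.1 q.2) = 0) :
    ∀ᶠ q in 𝓝 (u₀, w u₀ x₀), G q.1 q.2 = 0 := by
  obtain ⟨O, hO, V, hV, hOV⟩ := mem_nhds_prod_iff.1 hG
  obtain ⟨r, hr, hball⟩ := Metric.mem_nhds_iff.1 hV
  have hc : ContinuousAt (fun u : E => w u x₀) u₀ :=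
    ContinuousAt.comp (g := fun q : E × ℂ => w q.1 q.2) (f := fun u : E => (u, (x₀ : ℂ)))
      hw.continuousAt (Continuous.prodMk_left _).continuousAt
  -- The ball is fixed before `u`. For `u` near `u₀` the curve passes through it with nonzero
  -- velocity, so zeros of `G u` accumulate inside and the identity theorem applies on the whole
  -- ball.
  have hOev : ∀ᶠ u in 𝓝 u₀, ∀ z ∈ Metric.ball (w u₀ x₀) r, G u z = 0 := by
    filter_upwards [hO, hc.eventually (Metric.ball_mem_nhds _ hr),
      eventually_fst_of_prod hw.eventually, eventually_fst_of_prod (hw.deriv_snd.eventually_ne hw'),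
      eventually_fst_of_prod h.eventually_nhds] with u h1 h2 h3 h4 h5
    have han : AnalyticOnNhd ℂ (G u) (Metric.ball (w u₀ x₀) r) := by
      refine DifferentiableOn.analyticOnNhd (fun z hz => ?_) Metric.isOpen_ball
      exact (hOV (mk_mem_prod h1 (hball hz))).2.differentiableWithinAt
    refine han.eqOn_zero_of_preconnected_of_frequently_eq_zero
      (convex_ball _ _).isPreconnected h2 ?_
    have hd : HasDerivAt (fun x : ℝ => w u x) (deriv (w u) x₀) x₀ :=
      h3.differentiableAt.hasDerivAt.comp_ofReal
    have ht : Tendsto (fun x : ℝ => w u x) (𝓝[≠] x₀) (𝓝[≠] (w u x₀)) := hd.tendsto_nhdsNE h4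
    have h6 : ∀ᶠ x : ℝ in 𝓝[≠] x₀, G u (w u x) = 0 :=
      (eventually_snd_of_prod h5).filter_mono nhdsWithin_le_nhds
    exact ht.frequently h6.frequently
  rw [nhds_prod_eq]
  refine (hOev.prod_mk (Metric.ball_mem_nhds (w u₀ x₀) hr)).mono ?_
  exact fun q hq => hq.1 _ hq.2

theorem IsSchwarzFamily.conj_apply {S : E → ℂ → ℂ} {u₀ : E} (h : IsSchwarzFamily S u₀ Γ) {z : ℂ}
    (hz : z ∈ Γ) : conj (S u₀ z) = z := by
  rw [h.isSchwarzFunction.apply_eq hz, Complex.conj_conj]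

/-- The map `z ↦ conj (S u z)` is Schwarzian reflection; at `u₀` it fixes `Γ` pointwise. Since `bar
f (S z)` involves `f` at the reflected point, every use of `bar` needs the hypotheses there too. -/
theorem IsSchwarzFamily.near_reflect {S : E → ℂ → ℂ} {u₀ : E} (hΓ : IsCompact Γ)
    (h : IsSchwarzFamily S u₀ Γ) {P : E × ℂ → Prop} (hP : ∀ᶠ q in 𝓝 u₀ ×ˢ 𝓝ˢ Γ, P q) :
    ∀ᶠ q in 𝓝 u₀ ×ˢ 𝓝ˢ Γ, P (q.1, conj (S q.1 q.2)) := by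
  rw [eventually_prod_nhdsSet_iff hΓ] at hP ⊢
  intro z hz
  have hc : ContinuousAt (fun q : E × ℂ => (q.1, conj (S q.1 q.2))) (u₀, z) :=
    continuousAt_fst.prodMk (Complex.continuous_conj.continuousAt.comp (h.1.smoothAt hz).continuousAt)
  have := hP z hz
  rw [← h.conj_apply hz] at this
  exact hc.eventually this

/-- The members of a Schwarz family satisfy `bar S ∘ S = id`. -/
theorem IsSchwarzFamily.bar_apply {S : E → ℂ → ℂ} {u₀ : E} (hΓ : IsCompact Γ)
    (h : IsSchwarzFamily S u₀ Γ) :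
    ∀ᶠ q in 𝓝 u₀ ×ˢ 𝓝ˢ Γ, bar (S q.1) (S q.1 q.2) = q.2 := by
  rw [eventually_prod_nhdsSet_iff hΓ]
  intro z hz
  obtain ⟨w, x₀, h0, rfl, h2, h3⟩ := h.2 z hz
  have hG : SmoothAt (fun u z => bar (S u) (S u z) - z) (u₀, w u₀ x₀) :=
    (SmoothAt.comp_bar (by rw [h.conj_apply hz]; exact h.1.smoothAt hz) (h.1.smoothAt hz)).sub
      SmoothAt.id
  refine (eventually_eq_zero_of_curve hG (h0.smoothAt rfl) h2 ?_).mono fun q hq => sub_eq_zero.1 hq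
  filter_upwards [h3] with q hq
  simp [hq, bar]

/-! ### Tangent vectors -/

/-- The linearization of the equation `bar S ∘ S = id` at `S` in the direction `V`. -/
def TangencyAt (S V : ℂ → ℂ) (z : ℂ) : Prop := deriv S z * bar V (S z) = -V z

theorem deriv_bar_mul_deriv {S : ℂ → ℂ} {z : ℂ} (h1 : DifferentiableAt ℂ S z)
    (h2 : DifferentiableAt ℂ S (conj (S z))) (h : ∀ᶠ z' in 𝓝 z, bar S (S z') = z') :
    bar (deriv S) (S z) * deriv S z = 1 := by
  have e := (hasDerivAt_bar h2).comp z h1.hasDerivAt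
  exact e.unique ((hasDerivAt_id z).congr_of_eventuallyEq h)

section OneParameter

variable {c V : ℝ → ℂ → ℂ} {t : ℝ} {z : ℂ}

theorem hasDerivAt_bar_comp (h1 : SmoothAt V (t, conj (c t z))) (h2 : SmoothAt c (t, z)) :
    HasDerivAt (fun s => bar (V s) (c s z))
      (bar (velocity V t) (c t z) + bar (deriv (V t)) (c t z) * velocity c t z) t := by
  have hb : SmoothAt (fun s => bar (V s)) (t, c t z) := h1.bar_comp
  have := SmoothAt.hasDerivAt_comp (g := fun s => c s z) hb h2.hasDerivAt_param
  rw [deriv_bar] at this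
  have e : velocity (fun s => bar (V s)) t (c t z) = bar (velocity V t) (c t z) := by
    simp only [velocity, bar]
    exact (h1.hasDerivAt_param.star).deriv.trans (by rw [velocity]; rfl)
  rwa [e] at this

/-- The velocity of a variation of Schwarz functions is tangent. -/
theorem tangencyAt_velocity (h1 : SmoothAt c (t, z)) (h2 : SmoothAt c (t, conj (c t z)))
    (h : ∀ᶠ q in 𝓝 (t, z), bar (c q.1) (c q.1 q.2) = q.2) :
    TangencyAt (c t) (velocity c t) z := by
  have e1 := deriv_bar_mul_deriv h1.differentiableAt h2.differentiableAt (eventually_snd_of_prod h)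
  have e2 := (hasDerivAt_bar_comp h2 h1).unique
    ((hasDerivAt_const t z).congr_of_eventuallyEq (eventually_fst_of_prod h))
  rw [TangencyAt]
  -- The time derivative of `bar S ∘ S = id`, multiplied by `S'`; `e1`, its `z`-derivative, removes
  -- the factor in front of the velocity.
  linear_combination deriv (c t) z * e2 - velocity c t z * e1

/-- Derivative in `z` of the tangency equation. -/
theorem TangencyAt.deriv {S V : ℂ → ℂ} {z : ℂ} (hS : AnalyticAt ℂ S z)
    (hV : DifferentiableAt ℂ V z) (hV' : DifferentiableAt ℂ V (conj (S z)))
    (h : ∀ᶠ z' in 𝓝 z, TangencyAt S V z') :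
    deriv (deriv S) z * bar V (S z) + deriv S z * (bar (deriv V) (S z) * deriv S z)
      = -deriv V z := by
  have e1 := hS.deriv.differentiableAt.hasDerivAt.mul
    ((hasDerivAt_bar hV').comp z hS.differentiableAt.hasDerivAt)
  exact e1.unique (hV.hasDerivAt.neg.congr_of_eventuallyEq h)

theorem SmoothAt.analyticAt {f : E → ℂ → ℂ} {p : E × ℂ} (h : SmoothAt f p) :
    AnalyticAt ℂ (f p.1) p.2 :=
  Complex.analyticAt_iff_eventually_differentiableAt.2
    ((eventually_snd_of_prod h.eventually).mono fun _ hz => hz.differentiableAt)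

/-- The covariant derivative of a tangent field along a variation of Schwarz functions is
tangent. -/
theorem tangencyAt_nablaAlong (h1 : SmoothAt c (t, z)) (h2 : SmoothAt c (t, conj (c t z)))
    (k1 : SmoothAt V (t, z)) (k2 : SmoothAt V (t, conj (c t z)))
    (h : ∀ᶠ q in 𝓝 (t, z), bar (c q.1) (c q.1 q.2) = q.2)
    (k : ∀ᶠ q in 𝓝 (t, z), TangencyAt (c q.1) (V q.1) q.2)
    (hx : ∀ᶠ z' in 𝓝 z, TangencyAt (c t) (velocity c t) z') :
    TangencyAt (c t) (nablaAlong c V t) z := by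
  have e1 := deriv_bar_mul_deriv h1.differentiableAt h2.differentiableAt (eventually_snd_of_prod h)
  have e2 := hx.self_of_nhds
  have e3 := k.self_of_nhds
  have e4 := TangencyAt.deriv h1.analyticAt h1.velocity.differentiableAt
    h2.velocity.differentiableAt hx
  have e5 := TangencyAt.deriv h1.analyticAt k1.differentiableAt k2.differentiableAt
    (eventually_snd_of_prod k)
  -- This is the time derivative of the tangency equation of `V`; `e4` and `e5` are the
  -- `z`-derivatives of the equations for the velocity and for `V`.
  have e6 := (h1.hasDerivAt_deriv.mul (hasDerivAt_bar_comp k2 h1)).unique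
    (k1.hasDerivAt_param.neg.congr_of_eventuallyEq (eventually_fst_of_prod k))
  simp only [TangencyAt] at e1 e2 e3 e4 e5 ⊢
  have eb : bar (nablaAlong c V t) (c t z) = bar (velocity V t) (c t z)
      - 1 / (2 * bar (deriv (c t)) (c t z)) * (bar (deriv (velocity c t)) (c t z)
          * bar (V t) (c t z) + bar (deriv (V t)) (c t z) * bar (velocity c t) (c t z)) := by
    simp only [bar, nablaAlong]
    simp [Complex.conj_ofNat, velocity]
  have ea : nablaAlong c V t z = velocity V t z
      - 1 / (2 * deriv (c t) z) * (deriv (velocity c t) z * V t z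
        + deriv (V t) z * velocity c t z) := rfl
  rw [eb, ea]
  set s1 := deriv (c t) z
  set s1b := bar (deriv (c t)) (c t z)
  set s2 := deriv (deriv (c t)) z
  set x := velocity c t z
  set xb := bar (velocity c t) (c t z)
  set x1 := deriv (velocity c t) z
  set x1b := bar (deriv (velocity c t)) (c t z)
  set v := V t z
  set vb := bar (V t) (c t z)
  set v1 := deriv (V t) z
  set v1b := bar (deriv (V t)) (c t z)
  set dv := velocity V t z
  set dvb := bar (velocity V t) (c t z)
  have hs : s1 ≠ 0 := right_ne_zero_of_mul_eq_one e1
  -- The equations determine all conjugated quantities rationally from the unconjugated ones, so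
  -- tangency becomes an identity of rational functions.
  have hsb : s1b = 1 / s1 := by field_simp; exact e1
  have hxb : xb = -x / s1 := by field_simp; linear_combination e2
  have hvb : vb = -v / s1 := by field_simp; linear_combination e3
  have hx1b : x1b = (-x1 - s2 * xb) / s1 ^ 2 := by field_simp; linear_combination e4
  have hv1b : v1b = (-v1 - s2 * vb) / s1 ^ 2 := by field_simp; linear_combination e5
  have hdvb : dvb = (-dv - x1 * vb) / s1 - v1b * x := by
    field_simp; linear_combination e6
  rw [hdvb, hx1b, hv1b, hsb, hxb, hvb]
  field_simp
  ring

end OneParameter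

end SchwarzFamilies

/-! ### Families of conformal maps -/

section Conformal

variable {E : Type} [NormedAddCommGroup E] [NormedSpace ℝ E]
  {E' : Type} [NormedAddCommGroup E'] [NormedSpace ℝ E']
  {S₀ : ℂ → ℂ} {Γ : Set ℂ} {Φ Ψ S : E → ℂ → ℂ} {u₀ : E}

/-- `Φ u` is a smooth family of conformal maps near `Γ`, with inverses `Ψ u`. -/
structure IsConformalFamily (Φ Ψ : E → ℂ → ℂ) (u₀ : E) (Γ : Set ℂ) : Prop where
  smooth : ∀ z ∈ Γ, SmoothAt Φ (u₀, z)
  smooth_inv : ∀ z ∈ Γ, SmoothAt Ψ (u₀, Φ u₀ z)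
  left_inv : ∀ z ∈ Γ, ∀ᶠ q in 𝓝 (u₀, z), Ψ q.1 (Φ q.1 q.2) = q.2
  right_inv : ∀ z ∈ Γ, ∀ᶠ q in 𝓝 (u₀, Φ u₀ z), Φ q.1 (Ψ q.1 q.2) = q.2

namespace IsConformalFamily

theorem inv_apply (h : IsConformalFamily Φ Ψ u₀ Γ) {z : ℂ} (hz : z ∈ Γ) : Ψ u₀ (Φ u₀ z) = z :=
  (h.left_inv z hz).self_of_nhds

theorem symm (h : IsConformalFamily Φ Ψ u₀ Γ) : IsConformalFamily Ψ Φ u₀ (Φ u₀ '' Γ) := by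
  constructor
  · rintro _ ⟨z, hz, rfl⟩
    exact h.smooth_inv z hz
  · rintro _ ⟨z, hz, rfl⟩
    rw [h.inv_apply hz]
    exact h.smooth z hz
  · rintro _ ⟨z, hz, rfl⟩
    exact h.right_inv z hz
  · rintro _ ⟨z, hz, rfl⟩
    rw [h.inv_apply hz]
    exact h.left_inv z hz

theorem image_image (h : IsConformalFamily Φ Ψ u₀ Γ) : Ψ u₀ '' (Φ u₀ '' Γ) = Γ := by
  rw [Set.image_image]
  exact (image_congr fun z hz => h.inv_apply hz).trans (image_id' Γ)

theorem deriv_mul (h : IsConformalFamily Φ Ψ u₀ Γ) {z : ℂ} (hz : z ∈ Γ) :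
    deriv (Ψ u₀) (Φ u₀ z) * deriv (Φ u₀) z = 1 := by
  have h1 := (h.smooth_inv z hz).differentiableAt.hasDerivAt
  have h2 := (h.smooth z hz).differentiableAt.hasDerivAt
  have h3 := HasDerivAt.comp z h1 h2
  exact h3.unique ((hasDerivAt_id z).congr_of_eventuallyEq (eventually_snd_of_prod (h.left_inv z hz)))

theorem deriv_ne_zero (h : IsConformalFamily Φ Ψ u₀ Γ) {z : ℂ} (hz : z ∈ Γ) :
    deriv (Φ u₀) z ≠ 0 := right_ne_zero_of_mul_eq_one (h.deriv_mul hz)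

end IsConformalFamily

/-! ### Inverse families and the construction of variations -/

theorem tendsto_family {f : E → ℂ → ℂ} {u : E} {z : ℂ} (hf : SmoothAt f (u, z)) :
    Tendsto (fun q : E × ℂ => (q.1, f q.1 q.2)) (𝓝 (u, z)) (𝓝 (u, f u z)) :=
  continuousAt_fst.prodMk hf.continuousAt

/-- The real derivative of `(u, z) ↦ (u, Φ u z)`. -/
def shearEquiv (A : E × ℂ →L[ℝ] ℂ) (g : ℂ) (hg : g ≠ 0) (h : ∀ w, A (0, w) = g * w) :
    (E × ℂ) ≃L[ℝ] (E × ℂ) :=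
  ContinuousLinearEquiv.equivOfInverse ((ContinuousLinearMap.fst ℝ E ℂ).prod A)
    ((ContinuousLinearMap.fst ℝ E ℂ).prod
      (g⁻¹ • (ContinuousLinearMap.snd ℝ E ℂ
        - A.comp ((ContinuousLinearMap.inl ℝ E ℂ).comp (ContinuousLinearMap.fst ℝ E ℂ)))))
    (by
      rintro ⟨v, w⟩
      have e : A (v, w) = A (v, 0) + g * w := by rw [← h, ← map_add]; simp
      simp [e, hg])
    (by
      rintro ⟨v, w⟩
      have e : ∀ w, A (v, w) = A (v, 0) + g * w := fun w => by rw [← h, ← map_add]; simp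
      simp only [ContinuousLinearMap.prod_apply, ContinuousLinearMap.coe_fst',
        smul_apply, sub_apply,
        ContinuousLinearMap.coe_snd', ContinuousLinearMap.comp_apply,
        ContinuousLinearMap.inl_apply, smul_eq_mul]
      rw [e]
      field_simp
      simp)

theorem hasFDerivAt_shear (h : SmoothAt Φ (u₀, z)) (h0 : deriv (Φ u₀) z ≠ 0) :
    HasFDerivAt (fun q : E × ℂ => (q.1, Φ q.1 q.2))
      (shearEquiv _ _ h0 h.fderiv_apply_snd : (E × ℂ) →L[ℝ] (E × ℂ)) (u₀, z) :=
  (hasFDerivAt_fst (p := (u₀, z))).prodMk h.differentiableAt_real.hasFDerivAt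

/-- The inverse function theorem for the shear `(u, z) ↦ (u, Φ u z)`, whose differential is
triangular and invertible where `∂Φ/∂z ≠ 0`. Injectivity on the compact set `{u₀} × Γ` together with
local injectivity gives injectivity on a neighbourhood, so the local inverses belong to one map. -/
theorem exists_inverse_family [CompleteSpace E] (hΓ : IsCompact Γ)
    (hΦ : ∀ z ∈ Γ, SmoothAt Φ (u₀, z)) (hinj : InjOn (Φ u₀) Γ)
    (hd : ∀ z ∈ Γ, deriv (Φ u₀) z ≠ 0) : ∃ Ψ, IsConformalFamily Φ Ψ u₀ Γ := by
  classical
  set F : E × ℂ → E × ℂ := fun q => (q.1, Φ q.1 q.2) with hF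
  have hFs : ∀ q, SmoothAt Φ q → ContDiffAt ℝ ∞ F q := fun q hq =>
    contDiffAt_fst.prodMk hq.contDiffAt
  have hloc : ∀ z ∈ Γ, ∃ e : OpenPartialHomeomorph (E × ℂ) (E × ℂ), (e : E × ℂ → E × ℂ) = F ∧
      (u₀, z) ∈ e.source := fun z hz =>
    ⟨_, ContDiffAt.toOpenPartialHomeomorph_coe (hFs _ (hΦ z hz))
      (hasFDerivAt_shear (hΦ z hz) (hd z hz)) (by simp),
      ContDiffAt.mem_toOpenPartialHomeomorph_source _ _ _⟩
  have hinj' : InjOn F ({u₀} ×ˢ Γ) := by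
    rintro ⟨u, z⟩ ⟨hu, hz⟩ ⟨u', z'⟩ ⟨hu', hz'⟩ he
    obtain rfl : u = u₀ := hu
    obtain rfl : u' = u := hu'
    exact Prod.ext rfl (hinj hz hz' (Prod.ext_iff.1 he).2)
  obtain ⟨N, hN, hNinj⟩ := hinj'.exists_mem_nhdsSet (isCompact_singleton.prod hΓ)
    (by
      rintro ⟨u, z⟩ ⟨hu, hz⟩
      obtain rfl : u = u₀ := hu
      exact (hFs _ (hΦ z hz)).continuousAt)
    (by
      rintro ⟨u, z⟩ ⟨hu, hz⟩
      obtain rfl : u = u₀ := hu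
      obtain ⟨e, he, hs⟩ := hloc z hz
      exact ⟨e.source, e.open_source.mem_nhds hs, he ▸ e.injOn⟩)
  have hNz : ∀ z ∈ Γ, N ∈ 𝓝 (u₀, z) := fun z hz =>
    nhds_le_nhdsSet (mk_mem_prod (mem_singleton u₀) hz) hN
  set Ψ : E → ℂ → ℂ := fun u y => (Function.invFunOn F N (u, y)).2 with hΨ
  have hinv : ∀ q ∈ N, Ψ (F q).1 (F q).2 = q.2 := by
    intro q hq
    have := hNinj.leftInvOn_invFunOn hq
    exact (Prod.ext_iff.1 this).2
  have hcore : ∀ z ∈ Γ, ∀ᶠ q in 𝓝 (u₀, Φ u₀ z), Φ q.1 (Ψ q.1 q.2) = q.2 ∧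
      ContDiffAt ℝ ∞ (fun q : E × ℂ => Ψ q.1 q.2) q ∧ SmoothAt Φ (q.1, Ψ q.1 q.2) ∧
      deriv (Φ q.1) (Ψ q.1 q.2) ≠ 0 := by
    intro z hz
    obtain ⟨e, he, hs⟩ := hloc z hz
    have hes : e.symm (u₀, Φ u₀ z) = (u₀, z) := by
      have := e.left_inv hs
      rwa [he] at this
    have het : (u₀, Φ u₀ z) ∈ e.target := by
      have := e.map_source hs
      rwa [he] at this
    have hcont : Tendsto e.symm (𝓝 (u₀, Φ u₀ z)) (𝓝 (u₀, z)) := by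
      have := e.continuousAt_symm het
      rwa [ContinuousAt, hes] at this
    have hsym : ∀ᶠ q in 𝓝 (u₀, Φ u₀ z), q ∈ e.target ∧ F (e.symm q) = q ∧
        Ψ q.1 q.2 = (e.symm q).2 ∧ (e.symm q).1 = q.1 := by
      filter_upwards [e.open_target.mem_nhds het, hcont.eventually (hNz z hz)] with q h1 h2
      have h3 : F (e.symm q) = q := by
        have := e.right_inv h1
        rwa [he] at this
      refine ⟨h1, h3, ?_, (Prod.ext_iff.1 h3).1⟩
      have := hinv _ h2
      rwa [h3] at this
    filter_upwards [hsym.eventually_nhds, hcont.eventually (hΦ z hz).eventually,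
      hcont.eventually ((hΦ z hz).deriv_snd.eventually_ne (hd z hz))] with q h1 h2 h3
    obtain ⟨h4, h5, h6, h7⟩ := h1.self_of_nhds
    have h8 : e.symm q = (q.1, Ψ q.1 q.2) := by rw [h6, ← h7]
    rw [h8] at h2 h3 h5
    refine ⟨(Prod.ext_iff.1 h5).2, ?_, h2, h3⟩
    have h9 : ContDiffAt ℝ ∞ e.symm q := by
      refine e.contDiffAt_symm h4 (f₀' := shearEquiv _ _ h3 h2.fderiv_apply_snd) ?_ ?_
      · rw [he, h8]
        exact hasFDerivAt_shear h2 h3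
      · rw [he, h8]
        exact hFs _ h2
    exact (contDiffAt_snd.comp q h9).congr_of_eventuallyEq (h1.mono fun q' h => h.2.2.1)
  refine ⟨Ψ, hΦ, ?_, ?_, fun z hz => (hcore z hz).mono fun q hq => hq.1⟩
  · intro z hz
    filter_upwards [(hcore z hz).eventually_nhds] with q hq
    obtain ⟨h1, h2, h3, h4⟩ := hq.self_of_nhds
    refine ⟨h2, ?_⟩
    have hc : ContinuousAt (Ψ q.1) q.2 :=
      ContinuousAt.comp (g := fun q : E × ℂ => Ψ q.1 q.2) (f := fun z => (q.1, z)) h2.continuousAt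
        (Continuous.prodMk_right _).continuousAt
    -- The inverse function theorem over `ℝ` gives only real smoothness; holomorphy in `z` follows
    -- from the complex derivative of `Φ` and continuity of the inverse.
    exact (HasDerivAt.of_local_left_inverse hc h3.differentiableAt.hasDerivAt h4
      ((eventually_snd_of_prod hq).mono fun y hy => hy.1)).differentiableAt
  · intro z hz
    filter_upwards [hNz z hz] with q hq using hinv q hq

/-- Images of Schwarz families under families of conformal maps. -/
theorem IsConformalFamily.isSchwarzFamily (hΓ : IsCompact Γ) (h : IsConformalFamily Φ Ψ u₀ Γ)
    (hS : IsSchwarzFamily S u₀ Γ) :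
    IsSchwarzFamily (fun u => conformalAction (Φ u) (Ψ u) (S u)) u₀ (Φ u₀ '' Γ) := by
  have hΦc : ContinuousOn (Φ u₀) Γ := fun z hz =>
    (h.smooth z hz).differentiableAt.continuousAt.continuousWithinAt
  constructor
  · refine (smoothNear_iff (hΓ.image_of_continuousOn hΦc)).2 ?_
    rintro _ ⟨z, hz, rfl⟩
    have h1 : SmoothAt (fun u y => S u (Ψ u y)) (u₀, Φ u₀ z) :=
      SmoothAt.comp (by rw [h.inv_apply hz]; exact hS.1.smoothAt hz) (h.smooth_inv z hz)
    refine SmoothAt.comp_bar (f := Φ) (g := fun u y => S u (Ψ u y)) ?_ h1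
    rw [h.inv_apply hz, hS.conj_apply hz]
    exact h.smooth z hz
  · rintro _ ⟨z, hz, rfl⟩
    obtain ⟨w, x₀, h0, rfl, h2, h3⟩ := hS.2 z hz
    have hw := h0.smoothAt rfl
    refine ⟨fun u ζ => Φ u (w u ζ), x₀, (smoothNear_iff isCompact_singleton).2 ?_, rfl, ?_, ?_⟩
    · rintro _ rfl
      exact SmoothAt.comp (h.smooth _ hz) hw
    · have := HasDerivAt.comp (x₀ : ℂ) (h.smooth _ hz).differentiableAt.hasDerivAt
        hw.differentiableAt.hasDerivAt
      rw [show deriv (fun ζ => Φ u₀ (w u₀ ζ)) x₀ = _ from this.deriv]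
      exact mul_ne_zero (h.deriv_ne_zero hz) h2
    -- On the image curve, `bar Φ (S w) = bar Φ (conj w) = conj (Φ w)`.
    · filter_upwards [h3, eventually_ofReal ((tendsto_family hw).eventually (h.left_inv _ hz))]
        with q h4 h5
      simp [conformalAction, h5, h4, bar]

/-- A tangency solution is integrated by deforming the curve with `Φ_t = id + t v`, `v = -V / (2
S')`. The velocity at `t = 0` is `-S' v + bar v ∘ S`; the factor `2` is there because each summand
contributes half of `V`. The construction depends smoothly on `u`, as tangency of vector fields
along families requires. -/
theorem exists_variation [CompleteSpace E] {V : E → ℂ → ℂ} (hΓ : IsCompact Γ)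
    (hS : IsSchwarzFamily S u₀ Γ) (hV : SmoothNear V u₀ Γ)
    (ht : ∀ᶠ q in 𝓝 u₀ ×ˢ 𝓝ˢ Γ, TangencyAt (S q.1) (V q.1) q.2) :
    ∃ c : E × ℝ → ℂ → ℂ, IsSchwarzFamily c (u₀, 0) Γ ∧
      (∀ᶠ q in 𝓝 u₀ ×ˢ 𝓝ˢ Γ, c (q.1, 0) q.2 = S q.1 q.2) ∧
      ∀ᶠ q in 𝓝 u₀ ×ˢ 𝓝ˢ Γ, deriv (fun t : ℝ => c (q.1, t) q.2) 0 = V q.1 q.2 := by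
  set v : E → ℂ → ℂ := fun u z => -V u z / (2 * deriv (S u) z) with hv
  have hS0 : ∀ z ∈ Γ, deriv (S u₀) z ≠ 0 := fun z hz => hS.isSchwarzFunction.deriv_ne_zero hz
  have hvs : SmoothNear v u₀ Γ := (smoothNear_iff hΓ).2 fun z hz =>
    (hV.smoothAt hz).neg.div ((SmoothAt.const 2).mul (hS.1.smoothAt hz).deriv_snd)
      (mul_ne_zero two_ne_zero (hS0 z hz))
  set Φ : E × ℝ → ℂ → ℂ := fun p z => z + p.2 * v p.1 z with hΦ
  have hpz : ∀ {f : E → ℂ → ℂ} {z : ℂ}, SmoothAt f (u₀, z) →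
      SmoothAt (fun p : E × ℝ => f p.1) ((u₀, 0), z) := fun hf =>
    SmoothAt.reparam (ρ := (Prod.fst : E × ℝ → E)) hf contDiff_fst
  have hΦs : ∀ z ∈ Γ, SmoothAt Φ ((u₀, 0), z) := fun z hz => SmoothAt.id.add
    ((SmoothAt.ofReal (.of_forall fun u => contDiff_snd.contDiffAt)).mul (hpz (hvs.smoothAt hz)))
  have hΦ0 : ∀ u, Φ (u, 0) = id := by
    intro u; ext z; simp [hΦ]
  obtain ⟨Ψ, hc⟩ := exists_inverse_family (u₀ := (u₀, (0:ℝ))) hΓ hΦs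
    (by rw [hΦ0]; exact injOn_id Γ) (by intro z hz; rw [hΦ0]; simp)
  have him : Φ (u₀, 0) '' Γ = Γ := by rw [hΦ0, image_id]
  have hSc : IsSchwarzFamily (fun p : E × ℝ => S p.1) (u₀, 0) Γ :=
    IsSchwarzFamily.reparam (ρ := (Prod.fst : E × ℝ → E)) hΓ hS contDiff_fst
  have hfam := hc.isSchwarzFamily hΓ hSc
  rw [him] at hfam
  have hΨs : SmoothNear Ψ (u₀, 0) Γ := (smoothNear_iff hΓ).2 fun z hz => by
    have := hc.smooth_inv z hz
    rwa [hΦ0] at this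
  have hl : ∀ᶠ q in 𝓝 (u₀, (0:ℝ)) ×ˢ 𝓝ˢ Γ, Ψ q.1 (Φ q.1 q.2) = q.2 :=
    (eventually_prod_nhdsSet_iff hΓ).2 hc.left_inv
  have hl0 : ∀ᶠ q in 𝓝 u₀ ×ˢ 𝓝ˢ Γ, Ψ (q.1, 0) q.2 = q.2 := by
    filter_upwards [near_reparam (ρ := fun u : E => (u, (0:ℝ))) (v₀ := u₀) (by fun_prop) hl]
      with q hq
    simpa [hΦ0] using hq
  refine ⟨_, hfam, ?_, ?_⟩
  · filter_upwards [hl0] with q hq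
    simp [conformalAction, hq, hΦ0, bar]
  · have n1 : ∀ {f : E × ℝ → ℂ → ℂ}, SmoothNear f (u₀, 0) Γ →
        ∀ᶠ q in 𝓝 u₀ ×ˢ 𝓝ˢ Γ, SmoothAt f ((q.1, 0), q.2) := fun hf =>
      near_reparam (ρ := fun u : E => (u, (0:ℝ))) (v₀ := u₀) (by fun_prop) (hf.eventually hΓ)
    have hS0e : ∀ᶠ q in 𝓝 u₀ ×ˢ 𝓝ˢ Γ, deriv (S q.1) q.2 ≠ 0 :=
      (eventually_prod_nhdsSet_iff hΓ).2 fun z hz =>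
        (hS.1.smoothAt hz).deriv_snd.eventually_ne (hS0 z hz)
    filter_upwards [n1 hΨs, near_param hΓ hl, eventually_nhds_of_near hΓ hl0, hS0e,
      hS.1.eventually hΓ, ht, hS.near_reflect hΓ (hS.1.eventually hΓ),
      eventually_nhds_of_near hΓ (hS.bar_apply hΓ), hS.near_reflect hΓ (hvs.eventually hΓ)] with
      q k1 k2 k3 k4 k5 k6 k7 k8 k9
    have hψ := SmoothAt.reparam (ρ := fun t : ℝ => (q.1, t)) (u := 0) k1 (by fun_prop)
    have hbar := deriv_bar_mul_deriv k5.differentiableAt k7.differentiableAt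
      (eventually_snd_of_prod k8)
    -- the derivative of the inverse maps
    have d1 : HasDerivAt (fun t : ℝ => Φ (q.1, t) q.2) (v q.1 q.2) 0 := by
      have : HasDerivAt (fun r : ℝ => q.2 + r * v q.1 q.2) (1 * v q.1 q.2) 0 :=
        ((Complex.ofRealCLM.hasDerivAt (x := 0)).mul_const _).const_add _
      rwa [one_mul] at this
    have e0 : Φ (q.1, 0) q.2 = q.2 := by rw [hΦ0]; rfl
    have d2 := SmoothAt.hasDerivAt_comp (c := fun t : ℝ => Ψ (q.1, t)) (t := 0)
      (g := fun t : ℝ => Φ (q.1, t) q.2) (by rw [e0]; exact hψ) d1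
    have d3 := d2.unique ((hasDerivAt_const (0:ℝ) q.2).congr_of_eventuallyEq k2)
    have e1 : deriv (Ψ (q.1, 0)) q.2 = 1 := by
      have : Ψ (q.1, 0) =ᶠ[𝓝 q.2] id := eventually_snd_of_prod k3
      rw [this.deriv_eq]; simp
    rw [e0, e1, one_mul] at d3
    -- Obtained by differentiating `Ψ_t ∘ Φ_t = id` at `t = 0`, where `Ψ_0` has derivative `1`.
    have d4 : HasDerivAt (fun t : ℝ => Ψ (q.1, t) q.2) (-v q.1 q.2) 0 := by
      rw [← eq_neg_of_add_eq_zero_left d3]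
      exact hψ.hasDerivAt_param
    have e2 : Ψ (q.1, 0) q.2 = q.2 := k3.self_of_nhds
    have d5 : HasDerivAt (fun t : ℝ => S q.1 (Ψ (q.1, t) q.2))
        (deriv (S q.1) q.2 * -v q.1 q.2) 0 := by
      have h := k5.differentiableAt.hasDerivAt
      rw [← e2] at h
      have := HasDerivAt.scomp (0:ℝ) (g₁ := S q.1) (h := fun t : ℝ => Ψ (q.1, t) q.2) h d4
      rw [e2] at this
      refine this.congr_deriv ?_
      rw [smul_eq_mul, mul_comm]
    have d6 := hasDerivAt_bar k9.differentiableAt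
    have d7 : HasDerivAt (fun t : ℝ => bar (v q.1) (S q.1 (Ψ (q.1, t) q.2))) _ 0 :=
      HasDerivAt.scomp (0:ℝ) (g₁ := bar (v q.1)) (h := fun t : ℝ => S q.1 (Ψ (q.1, t) q.2))
        (by rw [e2]; exact d6) d5
    have d8 := d5.add ((Complex.ofRealCLM.hasDerivAt (x := (0:ℝ))).mul d7)
    have e3 : (fun t : ℝ => conformalAction (Φ (q.1, t)) (Ψ (q.1, t)) (S q.1) q.2)
        = fun t : ℝ => S q.1 (Ψ (q.1, t) q.2) + t * bar (v q.1) (S q.1 (Ψ (q.1, t) q.2)) := by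
      ext t
      simp [conformalAction, bar, hΦ]
    rw [e3]
    refine (HasDerivAt.deriv d8).trans ?_
    simp only [Complex.ofRealCLM_apply, Complex.ofReal_one, Complex.ofReal_zero, zero_mul,
      add_zero, one_mul, e2]
    have e4 : bar (v q.1) (S q.1 q.2)
        = -bar (V q.1) (S q.1 q.2) / (2 * bar (deriv (S q.1)) (S q.1 q.2)) := by
      simp [bar, hv, Complex.conj_ofNat]
    rw [TangencyAt] at k6
    have hsb : bar (deriv (S q.1)) (S q.1 q.2) = 1 / deriv (S q.1) q.2 := by
      field_simp; exact hbar
    have hVb : bar (V q.1) (S q.1 q.2) = -V q.1 q.2 / deriv (S q.1) q.2 := by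
      field_simp; linear_combination k6
    rw [e4, hsb, hVb]
    simp only [hv]
    field_simp
    ring

end Conformal

/-! ### Vector fields -/

section VectorFields

variable {E : Type} [NormedAddCommGroup E] [NormedSpace ℝ E]
  {S₀ : ℂ → ℂ} {Γ : Set ℂ} {X Y : (ℂ → ℂ) → ℂ → ℂ}

theorem IsSchwarzFamily.mono {S : E → ℂ → ℂ} {u₀ : E} {Γ' : Set ℂ} (h : IsSchwarzFamily S u₀ Γ)
    (hΓ : Γ' ⊆ Γ) : IsSchwarzFamily S u₀ Γ' := by
  obtain ⟨O, U, h1, h2, h3, h4, h5⟩ := h.1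
  exact ⟨⟨O, U, h1, h2, h3, hΓ.trans h4, h5⟩, fun z hz => h.2 z (hΓ hz)⟩

theorem TangencyAt.congr {S T V W : ℂ → ℂ} {z : ℂ} (h : TangencyAt S V z) (hST : S =ᶠ[𝓝 z] T)
    (hz : V z = W z) (hz' : V (conj (S z)) = W (conj (S z))) : TangencyAt T W z := by
  simp only [TangencyAt, bar] at h ⊢
  rw [← hST.deriv_eq, ← hST.self_of_nhds, ← hz, ← hz', h]

theorem IsSchwarzFamily.velocity_tangencyAt {c : E × ℝ → ℂ → ℂ} {u₀ : E} (hΓ : IsCompact Γ)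
    (hc : IsSchwarzFamily c (u₀, 0) Γ) :
    ∀ᶠ q in 𝓝 u₀ ×ˢ 𝓝ˢ Γ,
      TangencyAt (c (q.1, 0)) (fun z => deriv (fun t : ℝ => c (q.1, t) z) 0) q.2 := by
  have n1 := near_reparam (ρ := fun u : E => (u, (0:ℝ))) (v₀ := u₀) (by fun_prop)
    ((hc.1.eventually hΓ).and ((hc.near_reflect hΓ (hc.1.eventually hΓ)).and
      (eventually_nhds_of_near hΓ (hc.bar_apply hΓ))))
  filter_upwards [n1] with q hq
  have hl : Continuous fun p : ℝ × ℂ => (((q.1, p.1), p.2) : (E × ℝ) × ℂ) := by fun_prop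
  exact tangencyAt_velocity (c := fun t => c (q.1, t)) (t := 0)
    (SmoothAt.reparam (ρ := fun t : ℝ => (q.1, t)) hq.1 (by fun_prop))
    (SmoothAt.reparam (ρ := fun t : ℝ => (q.1, t)) hq.2.1 (by fun_prop))
    ((hl.tendsto (0, q.2)).eventually hq.2.2)

theorem IsTangent.tangencyAt {S V : ℂ → ℂ} (h : IsTangent S Γ V) {z : ℂ} (hz : z ∈ Γ) :
    TangencyAt S V z := by
  obtain ⟨c, hc, h1, h2⟩ := h
  have hc' : IsSchwarzFamily (fun p : ℝ × ℝ => c p.2) (0, 0) {z} :=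
    IsSchwarzFamily.reparam (ρ := (Prod.snd : ℝ × ℝ → ℝ)) isCompact_singleton
      (hc.mono (singleton_subset_iff.2 hz)) contDiff_snd
  have h3 := (near_slice (hc'.velocity_tangencyAt isCompact_singleton)).filter_mono
    (nhds_le_nhdsSet (mem_singleton z))
  have h2' := (h2.filter_mono (nhds_le_nhdsSet hz)).self_of_nhds
  refine h3.self_of_nhds.congr (h1.filter_mono (nhds_le_nhdsSet hz)) h2' ?_
  simp only
  rw [hc.conj_apply hz]
  exact h2'

theorem isTangent_of_tangencyAt {S V : ℂ → ℂ} (hΓ : IsCompact Γ) (hS : IsSchwarzFunction S Γ)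
    (hV : ∀ z ∈ Γ, ∀ᶠ z' in 𝓝 z, DifferentiableAt ℂ V z')
    (h : ∀ᶠ z in 𝓝ˢ Γ, TangencyAt S V z) : IsTangent S Γ V := by
  obtain ⟨c, h1, h2, h3⟩ := exists_variation (u₀ := (0:ℝ)) (V := fun _ => V) hΓ
    (hS.isSchwarzFamily hΓ (0:ℝ)) ((smoothNear_iff hΓ).2 fun z hz =>
      SmoothAt.of_holomorphic (hV z hz)) (near_const h)
  refine ⟨fun t => c (0, t), IsSchwarzFamily.reparam (ρ := fun t : ℝ => ((0:ℝ), t)) hΓ h1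
    (by fun_prop), near_slice h2, near_slice h3⟩

/-- The definition of a vector field, applied to single points of the nearby curves, gives the
equation on those curves. The identity theorem with parameters extends it to a full neighbourhood.
-/
theorem IsVectorField.tangencyAt [FiniteDimensional ℝ E] (hΓ : IsCompact Γ) (hX : IsVectorField S₀ Γ X) {S : E → ℂ → ℂ}
    {u₀ : E} (hS : IsSchwarzFamily S u₀ Γ) (h0 : S u₀ =ᶠ[𝓝ˢ Γ] S₀) :
    ∀ᶠ q in 𝓝 u₀ ×ˢ 𝓝ˢ Γ, TangencyAt (S q.1) (X (S q.1)) q.2 := by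
  rw [eventually_prod_nhdsSet_iff hΓ]
  intro z hz
  obtain ⟨O, U, hO, hu, hU, hΓU, hT⟩ := hX.2 E S u₀ hS h0
  obtain ⟨w, x₀, h1, rfl, h2, h3⟩ := hS.2 z hz
  have hw := h1.smoothAt rfl
  have hs := hS.1.smoothAt hz
  have hXs := hX.isAmbientField.smoothAt ⟨hS.1, h0⟩ hz
  have hG : SmoothAt (fun u z => deriv (S u) z * bar (X (S u)) (S u z) + X (S u) z)
      (u₀, w u₀ x₀) :=
    (hs.deriv_snd.mul (SmoothAt.comp_bar (by rw [hS.conj_apply hz]; exact hXs) hs)).add hXs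
  refine (eventually_eq_zero_of_curve hG hw h2 ?_).mono
    fun q hq => eq_neg_of_add_eq_zero_left hq
  filter_upwards [eventually_isSchwarzFunction hs hw h2 h3,
    hw.continuousAt_real.eventually (hU.mem_nhds (hΓU hz)),
    continuousAt_fst.eventually (hO.mem_nhds hu)] with q q1 q2 q3
  have := (hT q.1 q3 {w q.1 q.2} (singleton_subset_iff.2 q2) isCompact_singleton q1).tangencyAt
    (mem_singleton _)
  rw [TangencyAt] at this
  rw [this, neg_add_cancel]

theorem IsAmbientField.isVectorField (hΓ : IsCompact Γ) (hX : IsAmbientField S₀ Γ X)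
    (h : ∀ (E : Type) [NormedAddCommGroup E] [NormedSpace ℝ E] [FiniteDimensional ℝ E]
      (S : E → ℂ → ℂ) (u₀ : E), IsSchwarzFamily S u₀ Γ → S u₀ =ᶠ[𝓝ˢ Γ] S₀ →
      ∀ᶠ q in 𝓝 u₀ ×ˢ 𝓝ˢ Γ, TangencyAt (S q.1) (X (S q.1)) q.2) : IsVectorField S₀ Γ X := by
  refine ⟨hX, fun E _ _ _ S u₀ hS h0 => ?_⟩
  have h1 := (h E S u₀ hS h0).and ((hX.smoothNear ⟨hS.1, h0⟩).eventually hΓ)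
  obtain ⟨s, hs, t, ht, hst⟩ := mem_prod_iff.1 h1
  obtain ⟨O, hOs, hO, hu⟩ := mem_nhds_iff.1 hs
  obtain ⟨U, hU, hΓU, hUt⟩ := mem_nhdsSet_iff_exists.1 ht
  refine ⟨O, U, hO, hu, hU, hΓU, fun u huO Γ' hΓ' hc hSu => ?_⟩
  refine isTangent_of_tangencyAt hc hSu (fun z hz => ?_)
    (eventually_of_mem (hU.mem_nhdsSet.2 hΓ') fun z hz => (hst (mk_mem_prod (hOs huO) (hUt hz))).1)
  filter_upwards [hU.mem_nhds (hΓ' hz)] with z' hz'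
  exact (hst (mk_mem_prod (hOs huO) (hUt hz'))).2.differentiableAt

/-- `nabla X Y` along a family is the covariant derivative along variations with velocity `X`. -/
theorem nabla_eventually_eq_nablaAlong [FiniteDimensional ℝ E] (hΓ : IsCompact Γ)
    (hY : IsAmbientField S₀ Γ Y) {c : E × ℝ → ℂ → ℂ} {S : E → ℂ → ℂ} {u₀ : E}
    (hc : IsFamilyThrough S₀ Γ c (u₀, 0))
    (h0 : ∀ᶠ q in 𝓝 u₀ ×ˢ 𝓝ˢ Γ, c (q.1, 0) q.2 = S q.1 q.2)
    (h1 : ∀ᶠ q in 𝓝 u₀ ×ˢ 𝓝ˢ Γ, deriv (fun t : ℝ => c (q.1, t) q.2) 0 = X (S q.1) q.2) :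
    ∀ᶠ q in 𝓝 u₀ ×ˢ 𝓝ˢ Γ, nabla X Y (S q.1) q.2
      = nablaAlong (fun t => c (q.1, t)) (fun t => Y (c (q.1, t))) 0 q.2 := by
  have hc0 : IsFamilyThrough S₀ Γ (fun u => c (u, 0)) u₀ :=
    hc.reparam (ρ := fun u : E => (u, (0:ℝ))) (v₀ := u₀) hΓ (by fun_prop)
  have d1 := hY.deriv_comp hΓ hc
  have d2 := hY.dirDeriv_congr (g := S) (B := fun u => X (S u)) hΓ hc0
    (hc.1.deriv_real_zero hΓ) h0 h1
  have e1 := hY.eventually_eq (g := S) hΓ hc0 h0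
  filter_upwards [d1, d2, eventually_nhds_of_near hΓ e1, eventually_nhds_of_near hΓ h0,
    eventually_nhds_of_near hΓ h1] with q q1 q2 q3 q4 q5
  have a1 := (eventually_snd_of_prod q3)
  have a2 := (eventually_snd_of_prod q4)
  have a3 := (eventually_snd_of_prod q5)
  have b1 : deriv (Y (c (q.1, 0))) q.2 = deriv (Y (S q.1)) q.2 := EventuallyEq.deriv_eq a1
  have b2 : deriv (c (q.1, 0)) q.2 = deriv (S q.1) q.2 := EventuallyEq.deriv_eq a2
  have b3 : deriv (velocity (fun t => c (q.1, t)) 0) q.2 = deriv (X (S q.1)) q.2 :=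
    EventuallyEq.deriv_eq a3
  have b4 : velocity (fun t => c (q.1, t)) 0 q.2 = X (S q.1) q.2 := a3.self_of_nhds
  have b5 : Y (c (q.1, 0)) q.2 = Y (S q.1) q.2 := a1.self_of_nhds
  rw [nablaAlong, b1, b2, b3, b4, b5, q1, q2]
  rfl

/-- Covariant derivatives along variations of Schwarz functions are tangent, with parameters. -/
theorem IsSchwarzFamily.tangencyAt_nablaAlong {c V : E × ℝ → ℂ → ℂ} {u₀ : E} (hΓ : IsCompact Γ)
    (hc : IsSchwarzFamily c (u₀, 0) Γ) (hV : SmoothNear V (u₀, 0) Γ)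
    (h : ∀ᶠ q in 𝓝 (u₀, (0 : ℝ)) ×ˢ 𝓝ˢ Γ, TangencyAt (c q.1) (V q.1) q.2) :
    ∀ᶠ q in 𝓝 u₀ ×ˢ 𝓝ˢ Γ, TangencyAt (c (q.1, 0))
      (nablaAlong (fun t => c (q.1, t)) (fun t => V (q.1, t)) 0) q.2 := by
  have n1 := near_reparam (ρ := fun u : E => (u, (0:ℝ))) (v₀ := u₀) (by fun_prop)
    (((hc.1.eventually hΓ).and (hc.near_reflect hΓ (hc.1.eventually hΓ))).and
      (((hV.eventually hΓ).and (hc.near_reflect hΓ (hV.eventually hΓ))).and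
        ((eventually_nhds_of_near hΓ (hc.bar_apply hΓ)).and (eventually_nhds_of_near hΓ h))))
  filter_upwards [n1, eventually_nhds_of_near hΓ (hc.velocity_tangencyAt hΓ)] with q hq hq'
  obtain ⟨⟨h1, h2⟩, ⟨k1, k2⟩, hb, ht⟩ := hq
  have hl : Continuous fun p : ℝ × ℂ => (((q.1, p.1), p.2) : (E × ℝ) × ℂ) := by fun_prop
  have hl' := hl.tendsto (0, q.2)
  exact SchwarzReflection.tangencyAt_nablaAlong (c := fun t => c (q.1, t))
    (V := fun t => V (q.1, t)) (t := 0)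
    (SmoothAt.reparam (ρ := fun t : ℝ => (q.1, t)) h1 (by fun_prop))
    (SmoothAt.reparam (ρ := fun t : ℝ => (q.1, t)) h2 (by fun_prop))
    (SmoothAt.reparam (ρ := fun t : ℝ => (q.1, t)) k1 (by fun_prop))
    (SmoothAt.reparam (ρ := fun t : ℝ => (q.1, t)) k2 (by fun_prop))
    (hl'.eventually hb) (hl'.eventually ht) (eventually_snd_of_prod hq')

/-- Each member of the family is varied with velocity `X`, smoothly in the parameter. Along that
variation `∇_X Y` is the covariant derivative of a tangent field. -/
theorem IsVectorField.nabla (hΓ : IsCompact Γ) (hS₀ : IsSchwarzFunction S₀ Γ)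
    (hX : IsVectorField S₀ Γ X) (hY : IsVectorField S₀ Γ Y) : IsVectorField S₀ Γ (nabla X Y) := by
  refine (hX.isAmbientField.nabla hΓ (fun z hz => hS₀.deriv_ne_zero hz)
    hY.isAmbientField).isVectorField hΓ ?_
  intro E _ _ _ S u₀ hS h0
  have : CompleteSpace E := FiniteDimensional.complete ℝ E
  obtain ⟨c, c1, c2, c3⟩ := exists_variation hΓ hS (hX.isAmbientField.smoothNear ⟨hS.1, h0⟩)
    (hX.tangencyAt hΓ hS h0)
  have c0 : c (u₀, 0) =ᶠ[𝓝ˢ Γ] S₀ := EventuallyEq.trans (near_slice c2) h0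
  have n1 := c1.tangencyAt_nablaAlong hΓ (hY.isAmbientField.smoothNear ⟨c1.1, c0⟩)
    (hY.tangencyAt hΓ c1 c0)
  have n2 := nabla_eventually_eq_nablaAlong hΓ hY.isAmbientField ⟨c1.1, c0⟩ c2 c3
  filter_upwards [n1, n2, hS.near_reflect hΓ n2, eventually_nhds_of_near hΓ c2]
    with q q1 q2 q3 q4
  have q5 := eventually_snd_of_prod q4
  refine q1.congr q5 q2.symm ?_
  rw [show c (q.1, 0) q.2 = S q.1 q.2 from q5.self_of_nhds]
  exact q3.symm

end VectorFields

/-! ### The connection -/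

section Connection

variable {S₀ : ℂ → ℂ} {Γ : Set ℂ} {X X' Y Y' : (ℂ → ℂ) → ℂ → ℂ} {F : (ℂ → ℂ) → ℝ}

theorem IsSchwarzFunction.isFamilyThrough {E : Type} [NormedAddCommGroup E] [NormedSpace ℝ E]
    (hΓ : IsCompact Γ) (hS₀ : IsSchwarzFunction S₀ Γ) (u₀ : E) :
    IsFamilyThrough S₀ Γ (fun _ : E => S₀) u₀ :=
  ⟨(hS₀.isSchwarzFamily hΓ u₀).1, EventuallyEq.rfl⟩

theorem FieldEq.eventuallyEq (hΓ : IsCompact Γ) (hS₀ : IsSchwarzFunction S₀ Γ)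
    (h : FieldEq S₀ Γ X Y) : X S₀ =ᶠ[𝓝ˢ Γ] Y S₀ :=
  near_slice (h ℝ _ 0 (hS₀.isFamilyThrough hΓ 0))

theorem IsAmbientField.differentiableAt (hΓ : IsCompact Γ) (hS₀ : IsSchwarzFunction S₀ Γ)
    (hX : IsAmbientField S₀ Γ X) : ∀ᶠ z in 𝓝ˢ Γ, DifferentiableAt ℂ (X S₀) z :=
  (near_slice ((hX.smoothNear (hS₀.isFamilyThrough hΓ (0:ℝ))).eventually hΓ)).mono
    fun _ h => h.differentiableAt

/-! #### Functions as fields -/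

/-- A real function, considered as a field that is constant in `z`. -/
def toField (F : (ℂ → ℂ) → ℝ) (S : ℂ → ℂ) (_ : ℂ) : ℂ := F S

theorem deriv_ofReal_comp (g : ℝ → ℝ) (t : ℝ) : deriv (fun r => (g r : ℂ)) t = (deriv g t : ℝ) := by
  by_cases h : DifferentiableAt ℝ g t
  · exact h.hasDerivAt.ofReal_comp.deriv
  · rw [deriv_zero_of_not_differentiableAt h, deriv_zero_of_not_differentiableAt]
    · simp
    · intro h'
      exact h ((Complex.reCLM.differentiableAt.comp t h').congr_of_eventuallyEq
        (.of_forall fun r => by simp))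

/-- Allows the calculus of fields to be used for functions, without a second set of chain rules. -/
theorem ambientNabla_toField (X : (ℂ → ℂ) → ℂ → ℂ) (F : (ℂ → ℂ) → ℝ) :
    ambientNabla X (toField F) = toField (applyField X F) := by
  ext S z
  exact deriv_ofReal_comp _ _

theorem IsSmoothFunction.isAmbientField (hF : IsSmoothFunction S₀ Γ F) :
    IsAmbientField S₀ Γ (toField F) := by
  intro E _ _ _ f u₀ h1 h2
  obtain ⟨O, hO, hu, hs⟩ := hF E f u₀ h1 h2
  refine ⟨O, univ, hO, hu, isOpen_univ, subset_univ _, ?_, fun u _ => differentiableOn_const _⟩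
  refine Complex.ofRealCLM.contDiff.comp_contDiffOn ?_
  exact hs.comp contDiffOn_fst fun p hp => hp.1

/-- When `Γ` is empty there is no point at which to evaluate a field built from `F`, so this case is
separate. Every family is smooth near the empty set, even one jumping from `f` to `g`, and
continuity of `F` along it forces equality. -/
theorem IsSmoothFunction.eq_of_empty (hF : IsSmoothFunction S₀ ∅ F) (f g : ℂ → ℂ) : F f = F g := by
  classical
  obtain ⟨O, hO, hu, hs⟩ := hF ℝ (fun s => if s ≤ 0 then f else g) 0
    ⟨univ, ∅, isOpen_univ, mem_univ _, isOpen_empty, subset_rfl, by simp,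
      fun _ _ => differentiableOn_empty⟩ (by simp [EventuallyEq])
  have hc := (hs.contDiffAt (hO.mem_nhds hu)).continuousAt
  have hr := hc.tendsto.mono_left (nhdsWithin_le_nhds (s := Ioi (0:ℝ)))
  simp only [le_refl, if_true] at hr
  refine tendsto_nhds_unique hr (tendsto_const_nhds.congr' ?_)
  filter_upwards [self_mem_nhdsWithin] with s hs
  simp [not_le.2 (mem_Ioi.1 hs)]

theorem applyField_bracket (hΓ : IsCompact Γ) (hS₀ : IsSchwarzFunction S₀ Γ)
    (hX : IsAmbientField S₀ Γ X) (hY : IsAmbientField S₀ Γ Y) (hF : IsSmoothFunction S₀ Γ F) :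
    applyField (bracket X Y) F S₀
      = applyField X (applyField Y F) S₀ - applyField Y (applyField X F) S₀ := by
  rcases Γ.eq_empty_or_nonempty with rfl | ⟨z, hz⟩
  · have : F = fun _ => F 0 := funext fun f => hF.eq_of_empty f 0
    rw [this]
    simp [applyField]
  · have h := (ambientNabla_comm hΓ hX hY hF.isAmbientField).eventuallyEq hΓ hS₀
    have := (h.filter_mono (nhds_le_nhdsSet hz)).self_of_nhds
    simp only [ambientNabla_toField, toField] at this
    exact_mod_cast this.symm

/-! #### The axioms of a connection -/

theorem nabla_add_left (hΓ : IsCompact Γ) (hS₀ : IsSchwarzFunction S₀ Γ)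
    (hX : IsAmbientField S₀ Γ X) (hX' : IsAmbientField S₀ Γ X') (hY : IsAmbientField S₀ Γ Y) :
    nabla (fun S z => X S z + X' S z) Y S₀ =ᶠ[𝓝ˢ Γ] fun z => nabla X Y S₀ z + nabla X' Y S₀ z := by
  filter_upwards [(ambientNabla_add_left hΓ hX hX' hY).eventuallyEq hΓ hS₀,
    hX.differentiableAt hΓ hS₀, hX'.differentiableAt hΓ hS₀] with z h1 h2 h3
  simp only [nabla, h1, deriv_fun_add h2 h3]
  ring

theorem nabla_add_right (hΓ : IsCompact Γ) (hS₀ : IsSchwarzFunction S₀ Γ)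
    (hX : IsAmbientField S₀ Γ X) (hY : IsAmbientField S₀ Γ Y) (hY' : IsAmbientField S₀ Γ Y') :
    nabla X (fun S z => Y S z + Y' S z) S₀ =ᶠ[𝓝ˢ Γ] fun z => nabla X Y S₀ z + nabla X Y' S₀ z := by
  filter_upwards [(ambientNabla_add_right hΓ hX hY hY').eventuallyEq hΓ hS₀,
    hY.differentiableAt hΓ hS₀, hY'.differentiableAt hΓ hS₀] with z h1 h2 h3
  simp only [nabla, h1, deriv_fun_add h2 h3]
  ring

theorem dirDeriv_smul (Z : (ℂ → ℂ) → ℂ → ℂ) (S A : ℂ → ℂ) (a : ℝ) (z : ℂ) :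
    dirDeriv Z S (fun ζ => a * A ζ) z = a * dirDeriv Z S A z := by
  have := deriv_comp_mul_left a (fun r : ℝ => Z (fun ζ => S ζ + r * A ζ) z) 0
  simp only [mul_zero, Complex.real_smul] at this
  rw [dirDeriv, dirDeriv, ← this]
  congr 1
  ext r
  congr 1
  ext ζ
  push_cast
  ring

theorem nabla_smul_left (f : (ℂ → ℂ) → ℝ) (X Y : (ℂ → ℂ) → ℂ → ℂ) (S : ℂ → ℂ) (z : ℂ) :
    nabla (fun S z => f S * X S z) Y S z = f S * nabla X Y S z := by
  have h : ambientNabla (fun S z => f S * X S z) Y S z = f S * ambientNabla X Y S z :=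
    dirDeriv_smul Y S (X S) (f S) z
  simp only [nabla, h, deriv_const_mul_field]
  ring

theorem nabla_leibniz (hΓ : IsCompact Γ) (hS₀ : IsSchwarzFunction S₀ Γ)
    (hX : IsAmbientField S₀ Γ X) (hY : IsAmbientField S₀ Γ Y) (hF : IsSmoothFunction S₀ Γ F) :
    nabla X (fun S z => F S * Y S z) S₀ =ᶠ[𝓝ˢ Γ]
      fun z => F S₀ * nabla X Y S₀ z + applyField X F S₀ * Y S₀ z := by
  filter_upwards [(ambientNabla_mul hΓ hX hF.isAmbientField hY).eventuallyEq hΓ hS₀] with z h1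
  simp only [ambientNabla_toField] at h1
  simp only [toField] at h1
  simp only [nabla, h1, deriv_const_mul_field]
  ring

theorem nabla_sub_nabla (X Y : (ℂ → ℂ) → ℂ → ℂ) (S : ℂ → ℂ) (z : ℂ) :
    nabla X Y S z - nabla Y X S z = bracket X Y S z := by
  simp only [nabla, bracket]
  ring

theorem isSymmetricConnection_nabla (hΓ : IsCompact Γ) (hS₀ : IsSchwarzFunction S₀ Γ) :
    IsSymmetricConnection S₀ Γ nabla where
  isVectorField _ _ hX hY := hX.nabla hΓ hS₀ hY
  add_left _ _ _ hX hX' hY :=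
    nabla_add_left hΓ hS₀ hX.isAmbientField hX'.isAmbientField hY.isAmbientField
  smul_left f X Y _ _ _ := .of_forall fun z => nabla_smul_left f X Y S₀ z
  add_right _ _ _ hX hY hY' :=
    nabla_add_right hΓ hS₀ hX.isAmbientField hY.isAmbientField hY'.isAmbientField
  leibniz _ _ _ hf hX hY := nabla_leibniz hΓ hS₀ hX.isAmbientField hY.isAmbientField hf
  symmetric X Y _ _ := .of_forall fun z => nabla_sub_nabla X Y S₀ z

/-! #### Covariant derivatives along variations -/

theorem nabla_eq_nablaAlong (hΓ : IsCompact Γ) (hY : IsAmbientField S₀ Γ Y)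
    {c : ℝ → ℂ → ℂ} {t₀ : ℝ} (hc : IsSchwarzFamily c t₀ Γ) (h0 : c t₀ =ᶠ[𝓝ˢ Γ] S₀)
    (h1 : velocity c t₀ =ᶠ[𝓝ˢ Γ] X S₀) :
    nabla X Y S₀ =ᶠ[𝓝ˢ Γ] nablaAlong c (fun t => Y (c t)) t₀ := by
  have hv : ∀ (f : ℝ → ℂ), deriv (fun t => f (t₀ + t)) 0 = deriv f t₀ := fun f => by
    simpa using deriv_comp_const_add f t₀ 0
  -- Time is translated to `0`; the first coordinate is a dummy parameter.
  have hc' : IsFamilyThrough S₀ Γ (fun p : ℝ × ℝ => c (t₀ + p.2)) (0, 0) :=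
    IsFamilyThrough.reparam (f := c) (ρ := fun p : ℝ × ℝ => t₀ + p.2) hΓ
      (by simpa using ⟨hc.1, h0⟩) (by fun_prop)
  have h := nabla_eventually_eq_nablaAlong (X := X) (S := fun _ => S₀) hΓ hY hc'
    (near_const (P := fun z => c (t₀ + 0) z = S₀ z) (by rw [add_zero]; exact h0))
    (near_const (P := fun z => deriv (fun t : ℝ => c (t₀ + t) z) 0 = X S₀ z)
      (h1.mono fun z hz => (hv fun t => c t z).trans hz))
  filter_upwards [near_slice h] with z hz
  rw [hz]
  simp only [nablaAlong, add_zero]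
  have e : velocity (fun t => c (t₀ + t)) 0 = velocity c t₀ := by
    ext z; exact hv fun t => c t z
  rw [e, hv fun t => Y (c t) z]

theorem isTangent_nablaAlong (hΓ : IsCompact Γ) (hS₀ : IsSchwarzFunction S₀ Γ)
    {S : ℝ × ℝ → ℂ → ℂ} (hS : IsSchwarzFamily S (0, 0) Γ) (h0 : S (0, 0) =ᶠ[𝓝ˢ Γ] S₀) :
    IsTangent S₀ Γ (nablaAlong (fun r => S (r, 0))
      (fun r => velocity (fun t => S (r, t)) 0) 0) := by
  have hc : IsSchwarzFamily (fun p : ℝ × ℝ => S (p.2, 0)) (0, 0) Γ :=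
    IsSchwarzFamily.reparam (ρ := fun p : ℝ × ℝ => (p.2, (0:ℝ))) hΓ hS (by fun_prop)
  have hV : SmoothNear (fun p : ℝ × ℝ => velocity (fun t => S (p.2, t)) 0) (0, 0) Γ :=
    SmoothNear.reparam (ρ := fun p : ℝ × ℝ => p.2)
      (f := fun r => velocity (fun t => S (r, t)) 0) hΓ (hS.1.deriv_real_zero hΓ) contDiff_snd
  have ht := near_reparam (ρ := fun p : ℝ × ℝ => p.2) (v₀ := ((0:ℝ), (0:ℝ))) (by fun_prop)
    (hS.velocity_tangencyAt hΓ)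
  have h := near_slice (hc.tangencyAt_nablaAlong hΓ hV ht)
  refine isTangent_of_tangencyAt hΓ hS₀ (fun z hz => ?_) ?_
  · have hs : SmoothAt (fun r => S (r, 0)) (0, z) :=
      (hS.1.smoothAt hz).reparam (ρ := fun r : ℝ => (r, (0:ℝ))) (by fun_prop)
    have hv : SmoothAt (fun r => velocity (fun t => S (r, t)) 0) (0, z) :=
      (hS.1.deriv_real_zero hΓ).smoothAt hz
    have hd : deriv (S (0, 0)) z ≠ 0 := hS.isSchwarzFunction.deriv_ne_zero hz
    have hn : SmoothAt (nablaAlong (fun r => S (r, 0)) (fun r => velocity (fun t => S (r, t)) 0))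
        (0, z) :=
      hv.velocity.sub (((SmoothAt.const 1).div ((SmoothAt.const 2).mul hs.deriv_snd)
        (mul_ne_zero two_ne_zero hd)).mul
        ((hs.velocity.deriv_snd.mul hv).add (hv.deriv_snd.mul hs.velocity)))
    exact (eventually_snd_of_prod hn.eventually).mono fun z' h => h.differentiableAt
  · filter_upwards [h, eventually_nhdsSet_iff_forall.2 fun z hz =>
      (h0.filter_mono (nhds_le_nhdsSet hz)).eventually_nhds] with z h1 h2
    exact h1.congr h2 rfl rfl

/-- For the velocity field both Christoffel terms coincide and the factor `2` cancels, also under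
the convention for division by zero. Hence the two forms of the geodesic equation are the same
expression. -/
theorem nablaAlong_velocity (c : ℝ → ℂ → ℂ) (t : ℝ) (z : ℂ) :
    nablaAlong c (velocity c) t z = deriv (fun t => deriv (fun s => c s z) t) t
      - deriv (fun t => c t z) t / deriv (c t) z
        * deriv (fun z => deriv (fun t => c t z) t) z := by
  have e : ∀ a b d : ℂ, 1 / (2 * d) * (a * b + a * b) = b / d * a := by
    intro a b d
    rw [one_div, mul_inv, div_eq_mul_inv]
    ring
  simp only [nablaAlong, e]
  rfl

end Connection

/-! ### The canonical connection of the multiplication -/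

section Canonical

variable {S₀ : ℂ → ℂ} {Γ : Set ℂ} {X Y Z : (ℂ → ℂ) → ℂ → ℂ}

theorem dirDeriv₂_smul (Z : (ℂ → ℂ) → ℂ → ℂ) (S A B : ℂ → ℂ) (a b : ℝ) (z : ℂ) :
    dirDeriv₂ Z S (fun ζ => a * A ζ) (fun ζ => b * B ζ) z = a * b * dirDeriv₂ Z S A B z := by
  have := deriv_comp_mul_left a (fun r : ℝ => dirDeriv Z (fun ζ => S ζ + r * A ζ) B z) 0
  simp only [mul_zero, Complex.real_smul] at this
  simp only [dirDeriv₂, dirDeriv_smul, deriv_const_mul_field]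
  rw [mul_comm (a : ℂ), mul_assoc, ← this]
  congr 3
  ext r
  congr 1
  ext ζ
  push_cast
  ring

theorem IsAmbientField.dirDeriv₂_congr {E : Type} [NormedAddCommGroup E] [NormedSpace ℝ E]
    [FiniteDimensional ℝ E] (hΓ : IsCompact Γ) (hZ : IsAmbientField S₀ Γ Z)
    {f g A A' B B' : E → ℂ → ℂ} {u₀ : E} (hf : IsFamilyThrough S₀ Γ f u₀)
    (hA : SmoothNear A u₀ Γ) (hB : SmoothNear B u₀ Γ)
    (hfg : ∀ᶠ q in 𝓝 u₀ ×ˢ 𝓝ˢ Γ, f q.1 q.2 = g q.1 q.2)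
    (hAA' : ∀ᶠ q in 𝓝 u₀ ×ˢ 𝓝ˢ Γ, A q.1 q.2 = A' q.1 q.2)
    (hBB' : ∀ᶠ q in 𝓝 u₀ ×ˢ 𝓝ˢ Γ, B q.1 q.2 = B' q.1 q.2) :
    ∀ᶠ q in 𝓝 u₀ ×ˢ 𝓝ˢ Γ, dirDeriv₂ Z (f q.1) (A q.1) (B q.1) q.2
      = dirDeriv₂ Z (g q.1) (A' q.1) (B' q.1) q.2 := by
  have n1 : ∀ {P : E × ℂ → Prop}, (∀ᶠ q in 𝓝 u₀ ×ˢ 𝓝ˢ Γ, P q) →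
      ∀ᶠ q in 𝓝 (u₀, (0:ℝ)) ×ˢ 𝓝ˢ Γ, P (q.1.1, q.2) := fun h =>
    near_reparam (ρ := (Prod.fst : E × ℝ → E)) (v₀ := (u₀, (0:ℝ))) continuousAt_fst h
  have h := near_param hΓ (hZ.dirDeriv_congr hΓ (hf.line hΓ hA)
    (hB.reparam (v₀ := (u₀, (0:ℝ))) (ρ := (Prod.fst : E × ℝ → E)) hΓ contDiff_fst)
    (g := fun p ζ => g p.1 ζ + p.2 * A' p.1 ζ) (B := fun p => B' p.1) (by
      filter_upwards [n1 hfg, n1 hAA'] with q h1 h2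
      rw [h1, h2]) (n1 hBB'))
  filter_upwards [h] with q hq
  exact EventuallyEq.deriv_eq hq

theorem hasDerivAt_bar_comp_curve {φ : ℂ → ℂ} {g : ℝ → ℂ} {g' : ℂ} {t : ℝ} (hg : HasDerivAt g g' t)
    (hφ : DifferentiableAt ℂ φ (conj (g t))) :
    HasDerivAt (fun s => bar φ (g s)) (bar (deriv φ) (g t) * g') t := by
  refine (HasDerivAt.scomp t (hasDerivAt_bar hφ) hg).congr_deriv ?_
  rw [smul_eq_mul, mul_comm]
  rfl

theorem SmoothAt.hasDerivAt_bar_param {c : ℝ → ℂ → ℂ} {t : ℝ} {w : ℂ}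
    (hc : SmoothAt c (t, conj w)) :
    HasDerivAt (fun s => bar (c s) w) (bar (SchwarzReflection.velocity c t) w) t := hc.hasDerivAt_param.star

/-- Derivatives of the product of two variations. -/
theorem schwarzMul_derivs {P Q : ℝ → ℂ → ℂ} {z : ℂ} (hP : SmoothAt P (0, z))
    (hQ : SmoothAt Q (0, conj (P 0 z))) (h0 : bar (Q 0) (P 0 z) = z) :
    deriv (fun r => schwarzMul (P r) (Q 0) z) 0
      = velocity P 0 z + deriv (P 0) z * (bar (deriv (Q 0)) (P 0 z) * velocity P 0 z) ∧
    deriv (fun t => schwarzMul (P 0) (Q t) z) 0 = deriv (P 0) z * bar (velocity Q 0) (P 0 z) ∧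
    deriv (fun r => deriv (fun t => schwarzMul (P r) (Q t) z) 0) 0
      = (deriv (velocity P 0) z
          + deriv (deriv (P 0)) z * (bar (deriv (Q 0)) (P 0 z) * velocity P 0 z))
          * bar (velocity Q 0) (P 0 z)
        + deriv (P 0) z * (bar (deriv (velocity Q 0)) (P 0 z) * velocity P 0 z) := by
  have hg := hasDerivAt_bar_comp_curve hP.hasDerivAt_param hQ.differentiableAt
  dsimp only at hg
  have hP' : SmoothAt P (0, bar (Q 0) (P 0 z)) := by rw [h0]; exact hP
  -- The `t`-derivative is needed for all `r` near `0`, since it is differentiated in `r`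
  -- afterwards.
  have inner : ∀ᶠ r in 𝓝 (0:ℝ), deriv (fun t => schwarzMul (P r) (Q t) z) 0
      = deriv (P r) (bar (Q 0) (P r z)) * bar (velocity Q 0) (P r z) := by
    have c1 : ContinuousAt (fun r : ℝ => ((0:ℝ), conj (P r z))) 0 :=
      continuousAt_const.prodMk
        (Complex.continuous_conj.continuousAt.comp hP.hasDerivAt_param.continuousAt)
    have c2 : ContinuousAt (fun r : ℝ => (r, bar (Q 0) (P r z))) 0 :=
      continuousAt_id.prodMk hg.continuousAt
    filter_upwards [c1.eventually hQ.eventually, c2.eventually hP'.eventually] with r q1 q2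
    have := HasDerivAt.scomp (0:ℝ) (g₁ := P r) (h := fun t => bar (Q t) (P r z))
      q2.differentiableAt.hasDerivAt q1.hasDerivAt_bar_param
    refine this.deriv.trans ?_
    rw [smul_eq_mul, mul_comm]
  refine ⟨?_, ?_, ?_⟩
  · refine (SmoothAt.hasDerivAt_comp (g := fun r => bar (Q 0) (P r z)) hP' hg).deriv.trans ?_
    rw [h0]
  · rw [inner.self_of_nhds, h0]
  · rw [EventuallyEq.deriv_eq inner]
    have f1 := SmoothAt.hasDerivAt_comp (c := fun r => deriv (P r))
      (g := fun r => bar (Q 0) (P r z)) hP'.deriv_snd hg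
    have f2 := hasDerivAt_bar_comp_curve hP.hasDerivAt_param hQ.velocity.differentiableAt
    dsimp only at f2
    refine (f1.mul f2).deriv.trans ?_
    have e : velocity (fun r => deriv (P r)) 0 z = deriv (velocity P 0) z := hP.hasDerivAt_deriv.deriv
    rw [h0, e]

/-- The second derivative of the product gives the Christoffel term of `nabla`. -/
theorem ambientNabla_nabla_eq (hΓ : IsCompact Γ) (hS₀ : IsSchwarzFunction S₀ Γ)
    (hX : IsVectorField S₀ Γ X) (hY : IsVectorField S₀ Γ Y) (hZ : IsAmbientField S₀ Γ Z)
    {P Q : ℝ → ℂ → ℂ} (hP : IsSchwarzFamily P 0 Γ) (hQ : IsSchwarzFamily Q 0 Γ)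
    (hP0 : P 0 =ᶠ[𝓝ˢ Γ] S₀) (hQ0 : Q 0 =ᶠ[𝓝ˢ Γ] S₀)
    (hPX : velocity P 0 =ᶠ[𝓝ˢ Γ] X S₀) (hQY : velocity Q 0 =ᶠ[𝓝ˢ Γ] Y S₀) :
    ∀ᶠ z in 𝓝ˢ Γ, ambientNabla (nabla X Y) Z S₀ z = ambientNabla X (ambientNabla Y Z) S₀ z
      + 1 / 2 * deriv (fun r : ℝ => deriv (fun t : ℝ => Z (schwarzMul (P r) (Q t)) z) 0) 0 := by
  have hc := hS₀.isFamilyThrough hΓ (0:ℝ)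
  have hSf := hS₀.isSchwarzFamily hΓ (0:ℝ)
  have slice : ∀ {R : ℂ → Prop}, (∀ᶠ z in 𝓝ˢ Γ, R z) →
      (∀ᶠ z in 𝓝ˢ Γ, ∀ᶠ z' in 𝓝 z, R z') ∧ ∀ᶠ z in 𝓝ˢ Γ, ∀ᶠ z' in 𝓝 (conj (S₀ z)), R z' := by
    intro R hR
    have h1 := eventually_nhds_of_near (u₀ := (0:ℝ)) hΓ (near_const hR)
    have h2 := near_slice (hSf.near_reflect hΓ h1)
    exact ⟨(near_slice h1).mono fun z hz => eventually_snd_of_prod hz,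
      h2.mono fun z hz => eventually_snd_of_prod hz⟩
  set h : (ℝ × ℝ) × ℝ → ℂ → ℂ := fun p => schwarzMul (P p.1.2) (Q p.2) with hh
  have hbarS : ∀ᶠ z in 𝓝ˢ Γ, bar S₀ (S₀ z) = z := near_slice (hSf.bar_apply hΓ)
  have hh0 : h ((0, 0), 0) =ᶠ[𝓝ˢ Γ] S₀ := by
    filter_upwards [hbarS, hP0, (slice hQ0).2] with z h1 h2 h3
    have h4 : bar (Q 0) (S₀ z) = z :=
      (congrArg conj h3.self_of_nhds).trans h1
    simp only [hh, schwarzMul, h2, h4]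
  have hht : IsFamilyThrough S₀ Γ h ((0, 0), 0) := by
    refine ⟨(smoothNear_iff hΓ).2 fun z hz => ?_, hh0⟩
    have p1 : SmoothAt (fun p : (ℝ × ℝ) × ℝ => P p.1.2) (((0, 0), 0), z) :=
      (hP.1.smoothAt hz).reparam (ρ := fun p : (ℝ × ℝ) × ℝ => p.1.2) (by fun_prop)
    have q1 : SmoothAt (fun p : (ℝ × ℝ) × ℝ => Q p.2) (((0, 0), 0), z) :=
      (hQ.1.smoothAt hz).reparam (ρ := fun p : (ℝ × ℝ) × ℝ => p.2) (by fun_prop)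
    have b1 : SmoothAt (fun (p : (ℝ × ℝ) × ℝ) z => bar (Q p.2) (P p.1.2 z)) (((0, 0), 0), z) :=
      SmoothAt.comp_bar (f := fun p : (ℝ × ℝ) × ℝ => Q p.2) (by rw [hP.conj_apply hz]; exact q1) p1
    have e : bar (Q 0) (P 0 z) = z := by rw [bar, hP.conj_apply hz, hQ.conj_apply hz]
    exact SmoothAt.comp (f := fun p : (ℝ × ℝ) × ℝ => P p.1.2)
      (g := fun (p : (ℝ × ℝ) × ℝ) z => bar (Q p.2) (P p.1.2 z)) (by rw [e]; exact p1) b1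
  set G : ℂ → ℂ := fun z => 1 / (2 * deriv S₀ z) *
    (deriv (X S₀) z * Y S₀ z + deriv (Y S₀) z * X S₀ z) with hG
  have hXs := hX.isAmbientField.smoothNear hc
  have hYs := hY.isAmbientField.smoothNear hc
  have htan := near_slice (hY.tangencyAt hΓ hSf EventuallyEq.rfl)
  -- The `r`-derivative is `X + S' (bar S' ∘ S) X = 2X`, from `bar S ∘ S = id`; the `t`-derivative
  -- is `S' (bar Y ∘ S) = -Y`, which is tangency. The mixed derivative reduces to `-2G` by tangency
  -- of `Y` and its `z`-derivative.
  have hABC : ∀ᶠ z in 𝓝ˢ Γ,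
      deriv (fun r : ℝ => h ((0, r), 0) z) 0 = (2 : ℝ) * X S₀ z ∧
      deriv (fun t : ℝ => h ((0, 0), t) z) 0 = (-1 : ℝ) * Y S₀ z ∧
      deriv (fun r : ℝ => deriv (fun t : ℝ => h ((0, r), t) z) 0) 0 = (-2 : ℝ) * G z := by
    filter_upwards [near_slice (hP.1.eventually hΓ),
      near_slice (hP.near_reflect hΓ (near_reparam (ρ := fun _ : ℝ => (0:ℝ)) (v₀ := 0)
        continuousAt_const (hQ.1.eventually hΓ))), (slice hbarS).1, (slice hP0).1, (slice hQ0).2,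
      (slice hPX).1, (slice hQY).2, (slice htan).1,
      near_slice (hc.1.eventually hΓ), near_slice (hSf.near_reflect hΓ (hc.1.eventually hΓ)),
      near_slice (hYs.eventually hΓ), near_slice (hSf.near_reflect hΓ (hYs.eventually hΓ))] with
      z k1 k2 k3 k4 k5 k6 k7 k8 k9 k10 k11 k12
    have e0 : P 0 z = S₀ z := k4.self_of_nhds
    have e1 : bar (Q 0) (P 0 z) = z := by
      rw [e0, bar, k5.self_of_nhds]; exact k3.self_of_nhds
    obtain ⟨d1, d2, d3⟩ := schwarzMul_derivs k1 k2 e1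
    have b1 : deriv (P 0) z = deriv S₀ z := EventuallyEq.deriv_eq k4
    have b2 : deriv (deriv (P 0)) z = deriv (deriv S₀) z :=
      (EventuallyEq.deriv k4 : _).deriv_eq
    have b3 : velocity P 0 z = X S₀ z := k6.self_of_nhds
    have b4 : deriv (velocity P 0) z = deriv (X S₀) z := EventuallyEq.deriv_eq k6
    have b5 : bar (deriv (Q 0)) (S₀ z) = bar (deriv S₀) (S₀ z) :=
      congrArg conj (EventuallyEq.deriv_eq k5)
    have b6 : bar (velocity Q 0) (S₀ z) = bar (Y S₀) (S₀ z) := congrArg conj k7.self_of_nhds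
    have b7 : bar (deriv (velocity Q 0)) (S₀ z) = bar (deriv (Y S₀)) (S₀ z) :=
      congrArg conj (EventuallyEq.deriv_eq k7)
    rw [e0, b1, b3, b5] at d1
    rw [e0, b1, b6] at d2
    rw [e0, b1, b2, b3, b4, b5, b6, b7] at d3
    have t1 := deriv_bar_mul_deriv k9.differentiableAt k10.differentiableAt k3
    have t2 := k8.self_of_nhds
    have t3 := TangencyAt.deriv k9.analyticAt k11.differentiableAt k12.differentiableAt k8
    rw [TangencyAt] at t2
    simp only at t1 t3
    refine ⟨d1.trans ?_, d2.trans ?_, d3.trans ?_⟩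
    · push_cast
      linear_combination X S₀ z * t1
    · push_cast
      linear_combination t2
    · have hs : deriv S₀ z ≠ 0 := right_ne_zero_of_mul_eq_one t1
      have hsb : bar (deriv S₀) (S₀ z) = 1 / deriv S₀ z := by field_simp; exact t1
      have hvb : bar (Y S₀) (S₀ z) = -Y S₀ z / deriv S₀ z := by
        field_simp; linear_combination t2
      have hv1b : bar (deriv (Y S₀)) (S₀ z)
          = (-deriv (Y S₀) z - deriv (deriv S₀) z * bar (Y S₀) (S₀ z)) / deriv S₀ z ^ 2 := by
        field_simp; linear_combination t3
      rw [hv1b, hsb, hvb]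
      simp only [hG]
      push_cast
      field_simp
      ring
  have hGs : SmoothNear (fun _ : ℝ => G) 0 Γ := (smoothNear_iff hΓ).2 fun z hz =>
    ((SmoothAt.const 1).div ((SmoothAt.const 2).mul (hc.1.smoothAt hz).deriv_snd)
      (mul_ne_zero two_ne_zero (hS₀.deriv_ne_zero hz))).mul
      (((hXs.smoothAt hz).deriv_snd.mul (hYs.smoothAt hz)).add
        ((hYs.smoothAt hz).deriv_snd.mul (hXs.smoothAt hz)))
  -- the second-order chain rule
  have s1 := near_slice (hZ.deriv_deriv_comp hΓ hht)
  have hcs : ∀ (a : ℝ) {A : ℂ → ℂ}, SmoothNear (fun _ : ℝ => A) 0 Γ →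
      SmoothNear (fun (_ : ℝ) ζ => a * A ζ) 0 Γ := fun a A hA =>
    (smoothNear_iff hΓ).2 fun z hz => (SmoothAt.const _).mul (hA.smoothAt hz)
  have s2 := near_slice (hZ.dirDeriv₂_congr (g := fun _ => h ((0, 0), 0))
    (A' := fun _ ζ => deriv (fun r : ℝ => h ((0, r), 0) ζ) 0)
    (B' := fun _ ζ => deriv (fun t : ℝ => h ((0, 0), t) ζ) 0) hΓ hc (hcs 2 hXs) (hcs (-1) hYs)
    (near_const (hh0.mono fun z hz => hz.symm)) (near_const (hABC.mono fun z hz => hz.1.symm))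
    (near_const (hABC.mono fun z hz => hz.2.1.symm)))
  have s3 := near_slice (hZ.dirDeriv_congr (g := fun _ => h ((0, 0), 0))
    (B := fun _ ζ => deriv (fun r : ℝ => deriv (fun t : ℝ => h ((0, r), t) ζ) 0) 0) hΓ hc
    (hcs (-2) hGs) (near_const (hh0.mono fun z hz => hz.symm))
    (near_const (hABC.mono fun z hz => hz.2.2.symm)))
  have s4 := (ambientNabla_comm_eq hΓ hX.isAmbientField hY.isAmbientField hZ).eventuallyEq hΓ hS₀
  have s5 := near_slice (hZ.dirDeriv_add hΓ hc
    ((hX.isAmbientField.ambientNabla hΓ hY.isAmbientField).smoothNear hc) hGs)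
  filter_upwards [s1, s2, s3, s4, s5] with z q1 q2 q3 q4 q5
  have q6 : ambientNabla (nabla X Y) Z S₀ z
      = dirDeriv Z S₀ (ambientNabla X Y S₀) z - dirDeriv Z S₀ G z := by
    have := q5 1 (-1)
    simp only [Complex.ofReal_one, one_mul, Complex.ofReal_neg, neg_mul, ← sub_eq_add_neg] at this
    exact this
  rw [dirDeriv₂_smul] at q2
  rw [dirDeriv_smul] at q3
  rw [← q2, ← q3] at q1
  rw [q6, q4]
  -- Half of `D²Z(2X, -Y) + DZ(-2G)` is `-D²Z(X, Y) - DZ(G)`, which cancels the Hessian in the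
  -- iterated derivative and leaves the Christoffel term.
  refine Eq.trans ?_ (congrArg _ (congrArg _ q1.symm))
  push_cast
  ring

theorem isCanonicalConnection_nabla (hΓ : IsCompact Γ) (hS₀ : IsSchwarzFunction S₀ Γ) :
    IsCanonicalConnection S₀ Γ nabla := by
  intro X Y F hX hY hF P Q hP hQ hP0 hQ0 hPX hQY
  rcases Γ.eq_empty_or_nonempty with rfl | ⟨z, hz⟩
  · have : F = fun _ => F 0 := funext fun f => hF.eq_of_empty f 0
    rw [this]
    simp [applyField]
  · have h := ambientNabla_nabla_eq hΓ hS₀ hX hY hF.isAmbientField hP hQ hP0 hQ0 hPX hQY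
    have := (h.filter_mono (nhds_le_nhdsSet hz)).self_of_nhds
    simp only [ambientNabla_toField] at this
    simp only [toField, deriv_ofReal_comp] at this
    apply Complex.ofReal_injective
    push_cast
    exact this

end Canonical

/-! ### Conformal invariance -/

section Conformal

variable {E : Type} [NormedAddCommGroup E] [NormedSpace ℝ E] {u₀ : E}
  {S₀ : ℂ → ℂ} {Γ : Set ℂ} {X Y : (ℂ → ℂ) → ℂ → ℂ} {φ ψ : ℂ → ℂ}

theorem IsConformalFamily.isCompact_image {Φ Ψ : E → ℂ → ℂ} (h : IsConformalFamily Φ Ψ u₀ Γ)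
    (hΓ : IsCompact Γ) : IsCompact (Φ u₀ '' Γ) :=
  hΓ.image_of_continuousOn fun z hz =>
    (h.smooth z hz).differentiableAt.continuousAt.continuousWithinAt

theorem IsConformalFamily.near_image {Φ Ψ : E → ℂ → ℂ} (h : IsConformalFamily Φ Ψ u₀ Γ)
    (hΓ : IsCompact Γ) {P : E × ℂ → Prop} (hP : ∀ᶠ q in 𝓝 u₀ ×ˢ 𝓝ˢ (Φ u₀ '' Γ), P q) :
    ∀ᶠ q in 𝓝 u₀ ×ˢ 𝓝ˢ Γ, P (q.1, Φ q.1 q.2) :=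
  (eventually_prod_nhdsSet_iff hΓ).2 fun z hz => (tendsto_family (h.smooth z hz)).eventually
    ((eventually_prod_nhdsSet_iff (h.isCompact_image hΓ)).1 hP _ (mem_image_of_mem _ hz))

theorem IsConformalFamily.near_preimage {Φ Ψ : E → ℂ → ℂ} (h : IsConformalFamily Φ Ψ u₀ Γ)
    (hΓ : IsCompact Γ) {P : E × ℂ → Prop} (hP : ∀ᶠ q in 𝓝 u₀ ×ˢ 𝓝ˢ Γ, P q) :
    ∀ᶠ q in 𝓝 u₀ ×ˢ 𝓝ˢ (Φ u₀ '' Γ), P (q.1, Ψ q.1 q.2) :=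
  h.symm.near_image (h.isCompact_image hΓ) (by rwa [h.image_image])

/-- `φ` maps a neighbourhood of `Γ` conformally, with inverse `ψ`. -/
def IsConformalNear (φ ψ : ℂ → ℂ) (Γ : Set ℂ) : Prop :=
  IsConformalFamily (fun _ : ℝ => φ) (fun _ => ψ) 0 Γ

theorem eventually_prod_of_snd {X : Type*} [TopologicalSpace X] (u : X) {z : ℂ} {P : ℂ → Prop}
    (h : ∀ᶠ z' in 𝓝 z, P z') : ∀ᶠ q in 𝓝 (u, z), P q.2 :=
  (continuousAt_snd (p := (u, z))).eventually h

theorem SmoothAt.eventually_differentiableAt {f : ℝ → ℂ → ℂ} {t : ℝ} {z : ℂ}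
    (h : SmoothAt f (t, z)) : ∀ᶠ z' in 𝓝 z, DifferentiableAt ℂ (f t) z' :=
  (eventually_snd_of_prod h.eventually).mono fun _ h' => h'.differentiableAt

theorem IsConformalNear.family (h : IsConformalNear φ ψ Γ) (u₀ : E) :
    IsConformalFamily (fun _ : E => φ) (fun _ => ψ) u₀ Γ where
  smooth z hz := SmoothAt.of_holomorphic (h.smooth z hz).eventually_differentiableAt
  smooth_inv z hz := SmoothAt.of_holomorphic (h.smooth_inv z hz).eventually_differentiableAt
  left_inv z hz := eventually_prod_of_snd _ (eventually_snd_of_prod (h.left_inv z hz))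
  right_inv z hz := eventually_prod_of_snd _ (eventually_snd_of_prod (h.right_inv z hz))

theorem IsConformalNear.symm (h : IsConformalNear φ ψ Γ) : IsConformalNear ψ φ (φ '' Γ) :=
  IsConformalFamily.symm h

/-- No regularity of `ψ` is assumed. The inverse function theorem supplies a smooth local inverse
`Ψ` with values in `U` near `φ(Γ)`, and there `ψ(y) = ψ(φ(Ψ y)) = Ψ y`. -/
theorem isConformalNear_of_leftInvOn {U : Set ℂ} (hΓ : IsCompact Γ) (hU : IsOpen U) (hΓU : Γ ⊆ U)
    (hφ : DifferentiableOn ℂ φ U) (hd : ∀ z ∈ U, deriv φ z ≠ 0) (hψ : LeftInvOn ψ φ U) :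
    IsConformalNear φ ψ Γ := by
  have hs : ∀ z ∈ Γ, SmoothAt (fun _ : ℝ => φ) (0, z) := fun z hz =>
    SmoothAt.of_holomorphic (by
      filter_upwards [hU.mem_nhds (hΓU hz)] with z' hz'
      exact hφ.differentiableAt (hU.mem_nhds hz'))
  obtain ⟨Ψ, h⟩ := exists_inverse_family (Φ := fun _ : ℝ => φ) (u₀ := 0) hΓ hs
    (hψ.injOn.mono hΓU) fun z hz => hd z (hΓU hz)
  have key : ∀ z ∈ Γ, ∀ᶠ y in 𝓝 (φ z), Ψ 0 y = ψ y ∧ φ (Ψ 0 y) = y := by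
    intro z hz
    have c : ContinuousAt (Ψ 0) (φ z) := (h.smooth_inv z hz).differentiableAt.continuousAt
    have : U ∈ 𝓝 (Ψ 0 (φ z)) := by
      rw [h.inv_apply hz]
      exact hU.mem_nhds (hΓU hz)
    filter_upwards [c.eventually this, eventually_snd_of_prod (h.right_inv z hz)] with y h1 h2
    exact ⟨by rw [← hψ h1, h2], h2⟩
  refine ⟨hs, fun z hz => SmoothAt.of_holomorphic ?_, fun z hz => ?_, fun z hz => ?_⟩
  · filter_upwards [(h.smooth_inv z hz).eventually_differentiableAt,
      (key z hz).eventually_nhds] with y h1 h2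
    exact h1.congr_of_eventuallyEq (h2.mono fun w hw => hw.1.symm)
  · exact eventually_prod_of_snd (P := fun w => ψ (φ w) = w) _
      (eventually_of_mem (hU.mem_nhds (hΓU hz)) fun w hw => hψ hw)
  · exact eventually_prod_of_snd (P := fun w => φ (ψ w) = w) _ ((key z hz).mono fun w hw => by rw [← hw.1, hw.2])

theorem IsFamilyThrough.conj_apply (hS₀ : IsSchwarzFunction S₀ Γ) {c : E → ℂ → ℂ}
    (hc : IsFamilyThrough S₀ Γ c u₀) {z : ℂ} (hz : z ∈ Γ) : conj (c u₀ z) = z := by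
  rw [(hc.2.filter_mono (nhds_le_nhdsSet hz)).self_of_nhds, hS₀.apply_eq hz, Complex.conj_conj]

theorem IsFamilyThrough.near_reflect (hΓ : IsCompact Γ) (hS₀ : IsSchwarzFunction S₀ Γ)
    {c : E → ℂ → ℂ} (hc : IsFamilyThrough S₀ Γ c u₀) {P : E × ℂ → Prop}
    (hP : ∀ᶠ q in 𝓝 u₀ ×ˢ 𝓝ˢ Γ, P q) :
    ∀ᶠ q in 𝓝 u₀ ×ˢ 𝓝ˢ Γ, P (q.1, conj (c q.1 q.2)) := by
  refine (eventually_prod_nhdsSet_iff hΓ).2 fun z hz => ?_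
  have hP' := (eventually_prod_nhdsSet_iff hΓ).1 hP z hz
  have : ContinuousAt (fun q : E × ℂ => (q.1, conj (c q.1 q.2))) (u₀, z) :=
    continuousAt_fst.prodMk
      (Complex.continuous_conj.continuousAt.comp (hc.1.smoothAt hz).continuousAt)
  refine this.eventually ?_
  dsimp only
  rwa [hc.conj_apply hS₀ hz]

/-- The relation `ψ ∘ φ = id` is used twice, at `z` and, because of `bar`, at its reflection. -/
theorem IsConformalNear.action_action (hΓ : IsCompact Γ) (h : IsConformalNear φ ψ Γ)
    (hS₀ : IsSchwarzFunction S₀ Γ) {c : E → ℂ → ℂ} (hc : IsFamilyThrough S₀ Γ c u₀) :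
    ∀ᶠ q in 𝓝 u₀ ×ˢ 𝓝ˢ Γ, conformalAction ψ φ (conformalAction φ ψ (c q.1)) q.2 = c q.1 q.2 := by
  have h1 := (eventually_prod_nhdsSet_iff hΓ).2 (h.family u₀).left_inv
  filter_upwards [h1, hc.near_reflect hΓ hS₀ h1] with q h2 h3
  simp only [conformalAction, bar, h2, Complex.conj_conj, h3]

theorem IsConformalNear.isFamilyThrough (hΓ : IsCompact Γ) (h : IsConformalNear φ ψ Γ)
    (hS₀ : IsSchwarzFunction S₀ Γ) {c : E → ℂ → ℂ} (hc : IsFamilyThrough S₀ Γ c u₀) :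
    IsFamilyThrough (conformalAction φ ψ S₀) (φ '' Γ) (fun u => conformalAction φ ψ (c u)) u₀ := by
  have hu := h.family u₀
  constructor
  · refine (smoothNear_iff (hu.isCompact_image hΓ)).2 ?_
    rintro _ ⟨z, hz, rfl⟩
    have h1 : SmoothAt (fun u y => c u (ψ y)) (u₀, φ z) :=
      SmoothAt.comp (by rw [hu.inv_apply hz]; exact hc.1.smoothAt hz) (hu.smooth_inv z hz)
    refine SmoothAt.comp_bar (f := fun _ => φ) (g := fun u y => c u (ψ y)) ?_ h1
    rw [hu.inv_apply hz, hc.conj_apply hS₀ hz]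
    exact hu.smooth z hz
  · have := near_slice (hu.near_preimage hΓ (near_const hc.2))
    filter_upwards [this] with y hy
    simp only [conformalAction, hy]

theorem IsConformalNear.isSchwarzFunction (hΓ : IsCompact Γ) (h : IsConformalNear φ ψ Γ)
    (hS₀ : IsSchwarzFunction S₀ Γ) : IsSchwarzFunction (conformalAction φ ψ S₀) (φ '' Γ) :=
  ((h.family (0:ℝ)).isSchwarzFamily hΓ (hS₀.isSchwarzFamily hΓ (0:ℝ))).isSchwarzFunction

/-- Families through the image of `S₀` are images of families through `S₀`. -/
theorem IsConformalNear.isFamilyThrough_symm (hΓ : IsCompact Γ) (h : IsConformalNear φ ψ Γ)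
    (hS₀ : IsSchwarzFunction S₀ Γ) {T : E → ℂ → ℂ}
    (hT : IsFamilyThrough (conformalAction φ ψ S₀) (φ '' Γ) T u₀) :
    IsFamilyThrough S₀ Γ (fun u => conformalAction ψ φ (T u)) u₀ := by
  have h1 := h.symm.isFamilyThrough ((h.family u₀).isCompact_image hΓ)
    (h.isSchwarzFunction hΓ hS₀) hT
  have h2 : ψ '' (φ '' Γ) = Γ := (h.family u₀).image_image
  rw [h2] at h1
  exact ⟨h1.1, h1.2.trans
    (near_slice (h.action_action hΓ hS₀ (hS₀.isFamilyThrough hΓ u₀)))⟩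

theorem IsConformalNear.action_action_symm (hΓ : IsCompact Γ) (h : IsConformalNear φ ψ Γ)
    (hS₀ : IsSchwarzFunction S₀ Γ) {T : E → ℂ → ℂ}
    (hT : IsFamilyThrough (conformalAction φ ψ S₀) (φ '' Γ) T u₀) :
    ∀ᶠ q in 𝓝 u₀ ×ˢ 𝓝ˢ (φ '' Γ),
      conformalAction φ ψ (conformalAction ψ φ (T q.1)) q.2 = T q.1 q.2 :=
  h.symm.action_action ((h.family u₀).isCompact_image hΓ) (h.isSchwarzFunction hΓ hS₀) hT

theorem conformalPush_eq {T : ℂ → ℂ} {y : ℂ}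
    (hφ : DifferentiableAt ℂ φ (conj (conformalAction ψ φ T (ψ y)))) :
    conformalPush φ ψ X T y = bar (deriv φ) (conformalAction ψ φ T (ψ y))
      * X (conformalAction ψ φ T) (ψ y) := by
  have h1 : HasDerivAt (fun r : ℝ => conformalAction ψ φ T (ψ y)
      + r * X (conformalAction ψ φ T) (ψ y)) (X (conformalAction ψ φ T) (ψ y)) 0 := by
    simpa using (((hasDerivAt_id (0:ℝ)).ofReal_comp).mul_const
      (X (conformalAction ψ φ T) (ψ y))).const_add (conformalAction ψ φ T (ψ y))
  have := (hasDerivAt_bar_comp_curve (φ := φ) h1 (by simpa using hφ)).deriv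
  simpa [conformalPush, conformalAction] using this

/-- `φ` is holomorphic at the reflection of points near `Γ`. -/
theorem IsConformalNear.near_smoothAt_reflect (hΓ : IsCompact Γ) (h : IsConformalNear φ ψ Γ)
    (hS₀ : IsSchwarzFunction S₀ Γ) {c : E → ℂ → ℂ} (hc : IsFamilyThrough S₀ Γ c u₀) :
    ∀ᶠ q in 𝓝 u₀ ×ˢ 𝓝ˢ Γ, SmoothAt (fun _ : E => φ) (q.1, conj (c q.1 q.2)) :=
  hc.near_reflect hΓ hS₀ ((eventually_prod_nhdsSet_iff hΓ).2 fun z hz =>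
    ((h.family u₀).smooth z hz).eventually)

theorem IsConformalNear.near_conformalPush (hΓ : IsCompact Γ) (h : IsConformalNear φ ψ Γ)
    (hS₀ : IsSchwarzFunction S₀ Γ) {T : E → ℂ → ℂ}
    (hT : IsFamilyThrough (conformalAction φ ψ S₀) (φ '' Γ) T u₀) :
    ∀ᶠ q in 𝓝 u₀ ×ˢ 𝓝ˢ (φ '' Γ), conformalPush φ ψ X (T q.1) q.2
      = bar (deriv φ) (conformalAction ψ φ (T q.1) (ψ q.2))
        * X (conformalAction ψ φ (T q.1)) (ψ q.2) := by
  have := (h.family u₀).near_preimage hΓ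
    (h.near_smoothAt_reflect hΓ hS₀ (h.isFamilyThrough_symm hΓ hS₀ hT))
  filter_upwards [this] with q hq
  exact conformalPush_eq hq.differentiableAt

theorem IsConformalNear.near_conformalPush_action [FiniteDimensional ℝ E] (hΓ : IsCompact Γ)
    (h : IsConformalNear φ ψ Γ) (hS₀ : IsSchwarzFunction S₀ Γ) (hX : IsAmbientField S₀ Γ X)
    {c : E → ℂ → ℂ} (hc : IsFamilyThrough S₀ Γ c u₀) :
    ∀ᶠ q in 𝓝 u₀ ×ˢ 𝓝ˢ (φ '' Γ), conformalPush φ ψ X (conformalAction φ ψ (c q.1)) q.2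
      = bar (deriv φ) (c q.1 (ψ q.2)) * X (c q.1) (ψ q.2) := by
  have hT := h.isFamilyThrough hΓ hS₀ hc
  have h1 := h.action_action hΓ hS₀ hc
  have h2 := hX.eventually_eq (g := c) hΓ (h.isFamilyThrough_symm hΓ hS₀ hT) h1
  filter_upwards [h.near_conformalPush (X := X) hΓ hS₀ hT, (h.family u₀).near_preimage hΓ h1,
    (h.family u₀).near_preimage hΓ h2] with q q1 q2 q3
  rw [q1, q2, q3]

theorem IsConformalNear.isAmbientField (hΓ : IsCompact Γ) (h : IsConformalNear φ ψ Γ)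
    (hS₀ : IsSchwarzFunction S₀ Γ) (hX : IsAmbientField S₀ Γ X) :
    IsAmbientField (conformalAction φ ψ S₀) (φ '' Γ) (conformalPush φ ψ X) := by
  intro E _ _ _ T u₀ hT h0
  have hu := h.family u₀
  have hA := h.isFamilyThrough_symm hΓ hS₀ ⟨hT, h0⟩
  refine SmoothNear.congr (f := fun u y => bar (deriv φ) (conformalAction ψ φ (T u) (ψ y))
    * X (conformalAction ψ φ (T u)) (ψ y)) (hu.isCompact_image hΓ) ?_
    ((h.near_conformalPush (X := X) hΓ hS₀ ⟨hT, h0⟩).mono fun q hq => hq.symm)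
  refine (smoothNear_iff (hu.isCompact_image hΓ)).2 ?_
  rintro _ ⟨z, hz, rfl⟩
  have back : ∀ {f : E → ℂ → ℂ}, SmoothNear f u₀ Γ →
      SmoothAt (fun u y => f u (ψ y)) (u₀, φ z) := fun hf =>
    SmoothAt.comp (by rw [hu.inv_apply hz]; exact hf.smoothAt hz) (hu.smooth_inv z hz)
  refine SmoothAt.mul ?_ (back (hX.smoothNear hA))
  refine SmoothAt.comp_bar (f := fun _ => deriv φ)
    (g := fun u y => conformalAction ψ φ (T u) (ψ y)) ?_ (back hA.1)
  rw [hu.inv_apply hz, hA.conj_apply hS₀ hz]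
  exact (hu.smooth z hz).deriv_snd

/-- A family near the image is pulled back, varied with velocity `X`, and mapped forward again. The
result is a variation of Schwarz functions whose velocity is the induced field, which is therefore
tangent. -/
theorem IsConformalNear.isVectorField (hΓ : IsCompact Γ) (h : IsConformalNear φ ψ Γ)
    (hS₀ : IsSchwarzFunction S₀ Γ) (hX : IsVectorField S₀ Γ X) :
    IsVectorField (conformalAction φ ψ S₀) (φ '' Γ) (conformalPush φ ψ X) := by
  refine (h.isAmbientField hΓ hS₀ hX.isAmbientField).isVectorField
    ((h.family (0:ℝ)).isCompact_image hΓ) fun E _ _ _ T u₀ hT h0 => ?_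
  have hu := h.family u₀
  have hΔ : IsCompact (φ '' Γ) := hu.isCompact_image hΓ
  have hTt : IsFamilyThrough (conformalAction φ ψ S₀) (φ '' Γ) T u₀ := ⟨hT.1, h0⟩
  have hA := h.isFamilyThrough_symm hΓ hS₀ hTt
  have hAS : IsSchwarzFamily (fun u => conformalAction ψ φ (T u)) u₀ Γ := by
    have := hu.symm.isSchwarzFamily hΔ hT
    rwa [hu.image_image] at this
  have : CompleteSpace E := FiniteDimensional.complete ℝ E
  obtain ⟨c, hc, hc0, hc1⟩ := exists_variation hΓ hAS (hX.isAmbientField.smoothNear hA)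
    (hX.tangencyAt hΓ hAS hA.2)
  have hcA : IsFamilyThrough S₀ Γ c (u₀, 0) := ⟨hc.1, EventuallyEq.trans (near_slice hc0) hA.2⟩
  have hC := (h.family (u₀, (0:ℝ))).isSchwarzFamily hΓ hc
  have e0 : ∀ᶠ q in 𝓝 u₀ ×ˢ 𝓝ˢ (φ '' Γ), conformalAction φ ψ (c (q.1, 0)) q.2 = T q.1 q.2 := by
    filter_upwards [hu.near_preimage hΓ hc0, h.action_action_symm hΓ hS₀ hTt] with q q1 q2
    rw [← q2, conformalAction, q1]
    rfl
  have e1 : ∀ᶠ q in 𝓝 u₀ ×ˢ 𝓝ˢ (φ '' Γ),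
      deriv (fun t : ℝ => conformalAction φ ψ (c (q.1, t)) q.2) 0
        = conformalPush φ ψ X (T q.1) q.2 := by
    have s1 : ∀ᶠ q in 𝓝 u₀ ×ˢ 𝓝ˢ Γ, SmoothAt c ((q.1, 0), q.2) :=
      near_reparam (ρ := fun u : E => (u, (0:ℝ))) (v₀ := u₀) (by fun_prop) (hc.1.eventually hΓ)
    filter_upwards [hu.near_preimage hΓ hc0, hu.near_preimage hΓ hc1, hu.near_preimage hΓ s1,
      h.near_conformalPush (X := X) hΓ hS₀ hTt,
      hu.near_preimage hΓ (h.near_smoothAt_reflect hΓ hS₀ hA)] with q q1 q2 q3 q4 q5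
    have d := q3.fderiv_apply_real
    rw [← d.deriv, q2] at d
    have := hasDerivAt_bar_comp_curve (φ := φ) d (by rw [q1]; exact q5.differentiableAt)
    rw [q4]
    refine this.deriv.trans ?_
    rw [q1]
  have hreflect := IsFamilyThrough.near_reflect hΔ (h.isSchwarzFunction hΓ hS₀) hTt e1
  filter_upwards [hC.velocity_tangencyAt hΔ, e1, eventually_nhds_of_near hΔ e0, hreflect]
    with q q1 q2 q3 q4
  have g0 := eventually_snd_of_prod q3
  refine q1.congr g0 q2 ?_
  rw [g0.self_of_nhds]
  exact q4

/-- `nablaAlong` commutes with holomorphic changes of coordinates. -/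
theorem nablaAlong_conj {f ψ : ℂ → ℂ} {c V : ℝ → ℂ → ℂ} {t : ℝ} {y : ℂ}
    (hf : SmoothAt (fun _ : ℝ => f) (t, c t (ψ y))) (hψ : SmoothAt (fun _ : ℝ => ψ) (t, y))
    (hc : SmoothAt c (t, ψ y)) (hV : SmoothAt V (t, ψ y)) (f0 : deriv f (c t (ψ y)) ≠ 0)
    (ψ0 : deriv ψ y ≠ 0) (c0 : deriv (c t) (ψ y) ≠ 0) :
    nablaAlong (fun s y => f (c s (ψ y))) (fun s y => deriv f (c s (ψ y)) * V s (ψ y)) t y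
      = deriv f (c t (ψ y)) * nablaAlong c V t (ψ y) := by
  have comp_real : ∀ {g : ℂ → ℂ} {k : ℝ → ℂ} {k' : ℂ}, DifferentiableAt ℂ g (k t) →
      HasDerivAt k k' t → HasDerivAt (fun s => g (k s)) (deriv g (k t) * k') t :=
    fun hg hk => (HasDerivAt.scomp t hg.hasDerivAt hk).congr_deriv (mul_comm _ _)
  have dψ := hψ.differentiableAt.hasDerivAt
  have df := hf.differentiableAt
  have df' := hf.deriv_snd.differentiableAt
  dsimp only at dψ df df'
  have hv : velocity (fun s y => f (c s (ψ y))) t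
      =ᶠ[𝓝 y] fun y => deriv f (c t (ψ y)) * velocity c t (ψ y) := by
    have hcψ : SmoothAt (fun s y => c s (ψ y)) (t, y) := SmoothAt.comp hc hψ
    have k1 := (tendsto_family hψ).eventually hc.eventually
    have k2 := (tendsto_family hcψ).eventually hf.eventually
    filter_upwards [eventually_snd_of_prod k1, eventually_snd_of_prod k2] with y' h1 h2
    exact (comp_real h2.differentiableAt h1.hasDerivAt_param).deriv
  have hcy : HasDerivAt (fun y => c t (ψ y)) (deriv (c t) (ψ y) * deriv ψ y) y :=
    HasDerivAt.comp y hc.differentiableAt.hasDerivAt dψ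
  have hVy : HasDerivAt (fun y => V t (ψ y)) (deriv (V t) (ψ y) * deriv ψ y) y :=
    HasDerivAt.comp y hV.differentiableAt.hasDerivAt dψ
  have hvy : HasDerivAt (fun y => velocity c t (ψ y))
      (deriv (velocity c t) (ψ y) * deriv ψ y) y :=
    HasDerivAt.comp y hc.velocity.differentiableAt.hasDerivAt dψ
  have hfy : HasDerivAt (fun y => deriv f (c t (ψ y)))
      (deriv (deriv f) (c t (ψ y)) * (deriv (c t) (ψ y) * deriv ψ y)) y :=
    HasDerivAt.comp (h₂ := deriv f) y df'.hasDerivAt hcy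
  have e1 : deriv (fun y => f (c t (ψ y))) y
      = deriv f (c t (ψ y)) * (deriv (c t) (ψ y) * deriv ψ y) :=
    (HasDerivAt.comp y df.hasDerivAt hcy).deriv
  have e2 := (hfy.mul hVy).deriv
  have e3 := hv.deriv_eq.trans (hfy.mul hvy).deriv
  have e4 := ((comp_real df' hc.hasDerivAt_param).mul hV.hasDerivAt_param).deriv
  have e5 := hv.self_of_nhds
  have e2' : deriv (fun y => deriv f (c t (ψ y)) * V t (ψ y)) y = _ := e2
  have e4' : deriv (fun s => deriv f (c s (ψ y)) * V s (ψ y)) t = _ := e4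
  -- The time derivative produces `f'' · velocity · V`. Each half of the symmetrized correction
  -- produces half of this term, so it cancels, and the factors `ψ'` cancel in the quotient.
  simp only [nablaAlong, e1, e2', e3, e4', e5]
  rw [show deriv (fun τ => V τ (ψ y)) t = velocity V t (ψ y) from rfl]
  field_simp
  ring

theorem IsConformalNear.nabla_conformalPush (hΓ : IsCompact Γ) (h : IsConformalNear φ ψ Γ)
    (hS₀ : IsSchwarzFunction S₀ Γ) (hX : IsVectorField S₀ Γ X) (hY : IsVectorField S₀ Γ Y) :
    nabla (conformalPush φ ψ X) (conformalPush φ ψ Y) (conformalAction φ ψ S₀)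
      =ᶠ[𝓝ˢ (φ '' Γ)] conformalPush φ ψ (nabla X Y) (conformalAction φ ψ S₀) := by
  have hu := h.family (0:ℝ)
  have hΔ : IsCompact (φ '' Γ) := hu.isCompact_image hΓ
  have hSf := hS₀.isSchwarzFamily hΓ (0:ℝ)
  have hSt := hS₀.isFamilyThrough hΓ (0:ℝ)
  -- One variation with velocity `X` serves both sides: its image under `φ` has the induced field as
  -- velocity, which reduces the claim to `nablaAlong_conj`.
  obtain ⟨c, hc, hc0, hc1⟩ := isTangent_of_tangencyAt hΓ hS₀
    (fun z hz => (((hX.isAmbientField.smoothNear hSt).smoothAt hz).eventually_differentiableAt))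
    (near_slice (hX.tangencyAt hΓ hSf EventuallyEq.rfl))
  have hct : IsFamilyThrough S₀ Γ c 0 := ⟨hc.1, hc0⟩
  have hC := hu.isSchwarzFamily hΓ hc
  have hCt := h.isFamilyThrough hΓ hS₀ hct
  have back : ∀ {P : ℂ → Prop}, (∀ᶠ z in 𝓝ˢ Γ, P z) → ∀ᶠ y in 𝓝ˢ (φ '' Γ), P (ψ y) := fun hP =>
    near_slice (hu.near_preimage hΓ (near_const hP))
  have sc := near_slice (hc.1.eventually hΓ)
  have sφ := near_slice (h.near_smoothAt_reflect hΓ hS₀ hct)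
  have pX := near_slice (h.near_conformalPush_action hΓ hS₀ hX.isAmbientField hSt)
  have pN := near_slice (h.near_conformalPush_action hΓ hS₀
    (hX.nabla hΓ hS₀ hY).isAmbientField hSt)
  have pY := h.near_conformalPush_action hΓ hS₀ hY.isAmbientField hct
  have hvel : velocity (fun t => conformalAction φ ψ (c t)) 0
      =ᶠ[𝓝ˢ (φ '' Γ)] conformalPush φ ψ X (conformalAction φ ψ S₀) := by
    filter_upwards [back sc, back sφ, back hc0, back hc1, pX] with y q1 q2 q3 q4 q5
    rw [q5, ← q4, ← q3]
    exact (hasDerivAt_bar_comp_curve q1.hasDerivAt_param q2.differentiableAt).deriv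
  have n1 := nabla_eq_nablaAlong hΔ (h.isVectorField hΓ hS₀ hY).isAmbientField hC hCt.2 hvel
  have n2 := nabla_eq_nablaAlong hΓ hY.isAmbientField hc hc0 hc1
  have sψ : ∀ᶠ y in 𝓝ˢ (φ '' Γ), SmoothAt (fun _ : ℝ => ψ) (0, y) :=
    near_slice ((eventually_prod_nhdsSet_iff hΔ).2 fun y hy => (hu.symm.smooth y hy).eventually)
  have ne : ∀ {f : ℝ → ℂ → ℂ} {Θ : Set ℂ}, (∀ z ∈ Θ, SmoothAt f (0, z)) →
      (∀ z ∈ Θ, deriv (f 0) z ≠ 0) → ∀ᶠ w in 𝓝ˢ Θ, deriv (f 0) w ≠ 0 := fun hf h0 =>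
    eventually_nhdsSet_iff_forall.2 fun z hz =>
      eventually_snd_of_prod ((hf z hz).deriv_snd.eventually_ne (h0 z hz))
  have neφ := ne (f := fun _ => φ) hu.smooth fun z hz => hu.deriv_ne_zero hz
  have neψ := ne (f := fun _ => ψ) hu.symm.smooth fun z hz => hu.symm.deriv_ne_zero hz
  have nec := ne (fun z hz => hc.1.smoothAt hz) fun z hz => hc.isSchwarzFunction.deriv_ne_zero hz
  have neφ' := near_slice (hct.near_reflect hΓ hS₀ (near_const neφ))
  filter_upwards [n1, back n2, pN, back hc0, eventually_nhds_of_near hΔ pY |> near_slice,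
    back sc, back sφ, sψ, neψ, back nec, back neφ',
    back (near_slice ((hY.isAmbientField.smoothNear hct).eventually hΓ))]
    with y q1 q2 q3 q4 q5 k1 k2 k3 k4 k5 k6 k7
  rw [q1, q3, q2, ← q4]
  have := nablaAlong_conj (f := bar φ) (ψ := ψ) (c := c) (V := fun t => Y (c t)) (t := 0) (y := y)
    (SmoothAt.bar_comp k2) k3 k1 k7
    (by rw [deriv_bar]; exact (map_ne_zero _).2 k6) k4 k5
  rw [deriv_bar] at this
  rw [← this]
  -- The induced field of `Y` agrees with its explicit formula as a germ in both `t` and `y`, so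
  -- both kinds of derivative in `nablaAlong` agree.
  have a1 := eventually_snd_of_prod q5
  have a2 := eventually_fst_of_prod q5
  simp only [nablaAlong]
  congr 1
  · exact EventuallyEq.deriv_eq a2
  · congr 2
    · congr 1
      exact a1.self_of_nhds
    · congr 1
      exact EventuallyEq.deriv_eq a1

end Conformal

end SchwarzReflection

end

/-! ### The main theorem -/

open SchwarzReflection in
theorem mainTheorem1 (S₀ : ℂ → ℂ) (Γ : Set ℂ) (hΓ : IsCompact Γ)
    (hS₀ : IsSchwarzFunction S₀ Γ) :
    -- (a) the formula defines a symmetric affine connection, with values tangent to the space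
    IsSymmetricConnection S₀ Γ nabla ∧
    -- the bracket in the symmetry condition is the commutator of vector fields
    (∀ X Y F, IsVectorField S₀ Γ X → IsVectorField S₀ Γ Y → IsSmoothFunction S₀ Γ F →
      applyField (bracket X Y) F S₀
        = applyField X (applyField Y F) S₀ - applyField Y (applyField X F) S₀) ∧
    -- it is computed along variations of Schwarz functions by the same formula
    (∀ X Y, IsVectorField S₀ Γ X → IsVectorField S₀ Γ Y →
      ∀ (c : ℝ → ℂ → ℂ) (t₀ : ℝ), IsSchwarzFamily c t₀ Γ → c t₀ =ᶠ[𝓝ˢ Γ] S₀ →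
        velocity c t₀ =ᶠ[𝓝ˢ Γ] X S₀ →
        nabla X Y S₀ =ᶠ[𝓝ˢ Γ] nablaAlong c (fun t => Y (c t)) t₀) ∧
    -- for a two-parameter variation, the derivative of `S_t` in the direction `S_r` is tangent
    (∀ S : ℝ × ℝ → ℂ → ℂ, IsSchwarzFamily S (0, 0) Γ → S (0, 0) =ᶠ[𝓝ˢ Γ] S₀ →
      IsTangent S₀ Γ (nablaAlong (fun r => S (r, 0))
        (fun r => velocity (fun t => S (r, t)) 0) 0)) ∧
    -- the geodesic equation is the equation of continuous Schwarzian reflection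
    (∀ (c : ℝ → ℂ → ℂ) (t₀ : ℝ), IsSchwarzFamily c t₀ Γ → c t₀ =ᶠ[𝓝ˢ Γ] S₀ →
      ((∀ᶠ p in 𝓝 t₀ ×ˢ 𝓝ˢ Γ, nablaAlong c (velocity c) p.1 p.2 = 0) ↔
        ∀ᶠ p in 𝓝 t₀ ×ˢ 𝓝ˢ Γ,
          deriv (fun t => deriv (fun s => c s p.2) t) p.1
            - deriv (fun t => c t p.2) p.1 / deriv (c p.1) p.2
              * deriv (fun z => deriv (fun t => c t z) p.1) p.2 = 0)) ∧
    -- (b) it is the canonical connection of the multiplication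
    IsCanonicalConnection S₀ Γ nabla ∧
    -- it is conformally invariant
    (∀ (φ ψ : ℂ → ℂ) (U : Set ℂ), IsOpen U → Γ ⊆ U → DifferentiableOn ℂ φ U →
      (∀ z ∈ U, deriv φ z ≠ 0) → LeftInvOn ψ φ U →
      IsSchwarzFunction (conformalAction φ ψ S₀) (φ '' Γ) ∧
      (∀ X, IsVectorField S₀ Γ X →
        IsVectorField (conformalAction φ ψ S₀) (φ '' Γ) (conformalPush φ ψ X)) ∧
      ∀ X Y, IsVectorField S₀ Γ X → IsVectorField S₀ Γ Y →
        nabla (conformalPush φ ψ X) (conformalPush φ ψ Y) (conformalAction φ ψ S₀)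
          =ᶠ[𝓝ˢ (φ '' Γ)] conformalPush φ ψ (nabla X Y) (conformalAction φ ψ S₀)) ∧
    -- its Riemann tensor is covariantly constant
    (∀ W X Y Z, IsVectorField S₀ Γ W → IsVectorField S₀ Γ X → IsVectorField S₀ Γ Y →
      IsVectorField S₀ Γ Z → nablaRiemann W X Y Z S₀ =ᶠ[𝓝ˢ Γ] 0) := by
  refine ⟨isSymmetricConnection_nabla hΓ hS₀,
    fun X Y F hX hY hF => applyField_bracket hΓ hS₀ hX.isAmbientField hY.isAmbientField hF,
    fun X Y _ hY c t₀ hc h0 h1 => nabla_eq_nablaAlong hΓ hY.isAmbientField hc h0 h1,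
    fun S hS h0 => isTangent_nablaAlong hΓ hS₀ hS h0,
    fun c t₀ _ _ => by simp only [nablaAlong_velocity],
    isCanonicalConnection_nabla hΓ hS₀, fun φ ψ U hU hΓU hφ hd hψ => ?_,
    fun W X Y Z hW hX hY hZ => (nablaRiemann_fieldEq_zero hΓ (fun z hz => hS₀.deriv_ne_zero hz)
      hW.isAmbientField
      hX.isAmbientField hY.isAmbientField hZ.isAmbientField).eventuallyEq hΓ hS₀⟩
  have h := isConformalNear_of_leftInvOn hΓ hU hΓU hφ hd hψ
  exact ⟨h.isSchwarzFunction hΓ hS₀, fun X hX => h.isVectorField hΓ hS₀ hX,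
    fun X Y hX hY => h.nabla_conformalPush hΓ hS₀ hX hY⟩
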